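/- **The calculus.** Fix countably infinite sets of variables $x,y,k,\dots$ and of prompts $p,q,\dots$. Expressions, values and evaluation contexts are, up to $\alpha$-equivalence, $$e ::= v \mid e\,e \mid \mathcal G x.e \mid \#_v\, e \mid \mathcal S_v x.e \mid v\triangleleft e,\qquad v ::= x \mid \lambda x.e \mid p \mid \ulcorner E\urcorner,\qquad E ::= \square \mid E\,e \mid v\,E \mid \#_p\, E$$ where $\lambda x.e$, $\mathcal G x.e$, $\mathcal S_v x.e$ bind $x$ in $e$. $E[e]$ and $E[E']$ denote plugging, $\mathrm{pr}(m)$ is the set of prompts occurring in $m$, and $\mathrm{sp}(E)=\{p \mid \exists E_1,E_2,\ E=E_1[\#_p E_2]\}$. Write $\mathrm{fresh}(m_1,m_2,m_3)$ for $(\mathrm{pr}(m_1)\setminus \mathrm{pr}(m_2))\cap \mathrm{pr}(m_3)=\varnothing$. Reduction is defined by $(\lambda x.e)\,v\to e\{v/x\}$; $\ \#_p v\to v$; $\ \#_p E[\mathcal S_p x.e]\to e\{\ulcorner E\urcorner/x\}$ if $p\notin \mathrm{sp}(E)$; $\ \ulcorner E\urcorner\triangleleft e\to E[e]$; $\ \mathcal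 G x.e\to e\{p/x\}$ if $p\notin\mathrm{pr}(e)$; and $E[e_1]\to E[e_2]$ if $e_1\to e_2$ and $\mathrm{fresh}(e_2,e_1,E)$. A *normal form* is a closed expression that does not reduce; an expression is *control-stuck* if it is $E[\mathcal S_p x.e]$ with $p\notin\mathrm{sp}(E)$; an *error* is a normal form that is neither a value nor control-stuck. **Contextual equivalence.** For closed $e_1,e_2$, write $e_1\sim e_2$ if (1) $e_1\to^*$ some value iff $e_2\to^*$ some value; (2) $e_1\to^*$ some control-stuck expression iff $e_2\to^*$ some control-stuck expression; (3) $e_1$ diverges or reduces (in many steps) to an error iff $e_2$ does. Closed expressions $e_1,e_2$ are *contextually equivalent*, $e_1\approx_E e_2$, if $E[e_1]\sim E[e_2]$ for every closed evaluation context $E$ with $\mathrm{pr}(E)=\varnothing$. **Multi-hole contexts.** (Promptless) contexts, value contexts and evaluation contexts are $$\begin{aligned} C &::= V \mid C\,C \mid \mathcal G x.C \mid \#_V\, C\mid \mathcal S_V x.C \mid V\triangleleft C\mid \star_i[C],\\ V &::= x \mid \lambda x.C \mid \ulcorner F\urcorner \mid \square_i,\\ F &::= \square \mid F\,C \mid V\,F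 \mid \#_{\square_i} F \mid \star_i[F].\end{aligned}$$ For a finite sequence $\Gamma$ of closed values, $C[\Gamma]$, $V[\Gamma]$, $F[\Gamma]$ are obtained by replacing each $\square_i$ by $\Gamma_i$ and each $\star_i[\cdot]$ by $E[\cdot]$, where $\Gamma_i=\ulcorner E\urcorner$. They are defined only if all indices are within the length of $\Gamma$, $\Gamma_i$ is a continuation for each $\star_i$, and $\Gamma_i$ is a prompt for each $\#_{\square_i}F$. Write $F[e,\Gamma]$ for $(F[\Gamma])[e]$. **Transition system.** States are pairs $(\Gamma,e)$ with $e$ closed, or sequences $\Gamma$; if $e$ is a value $v$, then $(\Gamma,v)$ is the sequence $\Gamma$ extended with $v$. Write $e\rightsquigarrow e'$ if $e\to e'$, or $e$ is a normal form and $e'=e$. For closed $V$ and $F$ whose application to $\Gamma$ is defined, the transitions are: * $(\Gamma,e_1)\xrightarrow{\tau}(\Gamma,e_2)$ if $e_1\to e_2$ and $\mathrm{fresh}(e_2,e_1,\Gamma)$; * $\Gamma\xrightarrow{\lambda,i,V}(\Gamma,e\{V[\Gamma]/x\})$ if $\Gamma_i=\lambda x.e$; * $\Gamma\xrightarrow{\mathrm{val}}\Gamma$;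 * $\Gamma\xrightarrow{\ulcorner\cdot\urcorner,i,V}(\Gamma,E[V[\Gamma]])$ if $\Gamma_i=\ulcorner E\urcorner$; * $\Gamma\xrightarrow{\mathrm{dec},i,j}(\Gamma,\ulcorner E_1\urcorner,\ulcorner E_2\urcorner)$ if $\Gamma_i=\ulcorner E_1[\#_p E_2]\urcorner$, $\Gamma_j=p$ and $p\notin\mathrm{sp}(E_2)$; * $\Gamma\xrightarrow{\#,i,j}\Gamma$ if $\Gamma_i=\Gamma_j$ is a prompt; * $\Gamma\xrightarrow{\mathrm{new}}(\Gamma,p)$ if $p\notin\mathrm{pr}(\Gamma)$; * $(\Gamma,e)\xrightarrow{\mathrm{stuck},F}(\Gamma,e')$ if $e$ is control-stuck and $F[e,\Gamma]\rightsquigarrow e'$. The transitions labelled $(\ulcorner\cdot\urcorner,i,V)$ and $\mathrm{val}$ are *passive*, all the others *active*. The weak transition $\xRightarrow{\alpha}$ is $(\xrightarrow{\tau})^*$ if $\alpha=\tau$, and $(\xrightarrow{\tau})^*\xrightarrow{\alpha}(\xrightarrow{\tau})^*$ otherwise. **$\star$-bisimilarity.** A relation $R$ on states *diacritically progresses* to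 $S,T$ if $R\subseteq S$, $R\subseteq T$, and whenever $s\mathrel R t$: if $s\xrightarrow{\alpha}s'$ with $\alpha$ passive (resp. active), then there is $t'$ with $t\xRightarrow{\alpha}t'$ and $s'\mathrel S t'$ (resp. $s'\mathrel T t'$); and conversely for the transitions of $t$. A *$\star$-bisimulation* is a relation $R$ that diacritically progresses to $R,R$, and *$\star$-bisimilarity* $\approx_\star$ is the union of all $\star$-bisimulations. **Theorem.** For all closed expressions $e_1,e_2$, $$e_1\approx_E e_2\quad\Longleftrightarrow\quad(\varnothing,e_1)\approx_\star(\varnothing,e_2).$$ -/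

import Mathlib

/-!
  A call-by-value λ-calculus with multi-prompted delimited control and dynamic
  prompt generation, its contextual equivalence, and star-bisimilarity.
  Terms are taken up to α-equivalence: variables are well-scoped de Bruijn indices, so
  that `Exp n` is the set of expressions whose free variables are among `n` given ones,
  and `Exp 0` is the set of closed expressions.
-/

namespace MultiPrompt

/-- Prompts: a countably infinite set of names. -/
abbrev Prompt := ℕ

/-! ### Syntax -/

mutual

/-- Expressions `e ::= v | e e | 𝒢x.e | #v e | 𝒮v x.e | v ◁ e`
(prompt generation, delimiter, grab, throw). -/
inductive Exp : ℕ → Type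
  | val {n : ℕ} (v : Val n) : Exp n
  | app {n : ℕ} (e₁ e₂ : Exp n) : Exp n
  | fresh {n : ℕ} (e : Exp (n + 1)) : Exp n
  | reset {n : ℕ} (v : Val n) (e : Exp n) : Exp n
  | grab {n : ℕ} (v : Val n) (e : Exp (n + 1)) : Exp n
  | push {n : ℕ} (v : Val n) (e : Exp n) : Exp n

/-- Values `v ::= x | λx.e | p | ⌜E⌝`. -/
inductive Val : ℕ → Type
  | var {n : ℕ} (x : Fin n) : Val n
  | lam {n : ℕ} (e : Exp (n + 1)) : Val n
  | prompt {n : ℕ} (p : Prompt) : Val n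
  | cont {n : ℕ} (E : ECtx n) : Val n

/-- Evaluation contexts `E ::= □ | E e | v E | #p E`, read outside-in. -/
inductive ECtx : ℕ → Type
  | hole {n : ℕ} : ECtx n
  | appL {n : ℕ} (E : ECtx n) (e : Exp n) : ECtx n
  | appR {n : ℕ} (v : Val n) (E : ECtx n) : ECtx n
  | reset {n : ℕ} (p : Prompt) (E : ECtx n) : ECtx n

end

/-! ### Renaming and substitution -/

/-- Extension of a renaming under a binder. -/
def liftRen {n m : ℕ} (ρ : Fin n → Fin m) : Fin (n + 1) → Fin (m + 1) :=
  Fin.cases 0 (fun i => (ρ i).succ)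

mutual

def Exp.rename {n m : ℕ} (ρ : Fin n → Fin m) : Exp n → Exp m
  | .val v => .val (v.rename ρ)
  | .app e₁ e₂ => .app (e₁.rename ρ) (e₂.rename ρ)
  | .fresh e => .fresh (e.rename (liftRen ρ))
  | .reset v e => .reset (v.rename ρ) (e.rename ρ)
  | .grab v e => .grab (v.rename ρ) (e.rename (liftRen ρ))
  | .push v e => .push (v.rename ρ) (e.rename ρ)

def Val.rename {n m : ℕ} (ρ : Fin n → Fin m) : Val n → Val m
  | .var x => .var (ρ x)
  | .lam e => .lam (e.rename (liftRen ρ))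
  | .prompt p => .prompt p
  | .cont E => .cont (E.rename ρ)

def ECtx.rename {n m : ℕ} (ρ : Fin n → Fin m) : ECtx n → ECtx m
  | .hole => .hole
  | .appL E e => .appL (E.rename ρ) (e.rename ρ)
  | .appR v E => .appR (v.rename ρ) (E.rename ρ)
  | .reset p E => .reset p (E.rename ρ)

end

/-- Extension of a substitution under a binder. -/
def liftSub {n m : ℕ} (σ : Fin n → Val m) : Fin (n + 1) → Val (m + 1) :=
  Fin.cases (.var 0) (fun i => (σ i).rename Fin.succ)

mutual

/-- Simultaneous capture-avoiding substitution of values for variables. -/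
def Exp.subst {n m : ℕ} (σ : Fin n → Val m) : Exp n → Exp m
  | .val v => .val (v.subst σ)
  | .app e₁ e₂ => .app (e₁.subst σ) (e₂.subst σ)
  | .fresh e => .fresh (e.subst (liftSub σ))
  | .reset v e => .reset (v.subst σ) (e.subst σ)
  | .grab v e => .grab (v.subst σ) (e.subst (liftSub σ))
  | .push v e => .push (v.subst σ) (e.subst σ)

def Val.subst {n m : ℕ} (σ : Fin n → Val m) : Val n → Val m
  | .var x => σ x
  | .lam e => .lam (e.subst (liftSub σ))
  | .prompt p => .prompt p
  | .cont E => .cont (E.subst σ)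

def ECtx.subst {n m : ℕ} (σ : Fin n → Val m) : ECtx n → ECtx m
  | .hole => .hole
  | .appL E e => .appL (E.subst σ) (e.subst σ)
  | .appR v E => .appR (v.subst σ) (E.subst σ)
  | .reset p E => .reset p (E.subst σ)

end

/-- `e{v/x}`, where `x` is the innermost bound variable (index `0`). -/
def Exp.inst {n : ℕ} (e : Exp (n + 1)) (v : Val n) : Exp n :=
  e.subst (Fin.cases v Val.var)

/-- A closed value seen as a value over `n` variables. -/
def Val.weaken {n : ℕ} (v : Val 0) : Val n := v.rename Fin.elim0

/-- A closed evaluation context seen as one over `n` variables. -/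
def ECtx.weaken {n : ℕ} (E : ECtx 0) : ECtx n := E.rename Fin.elim0

/-! ### Prompts, plugging, surrounding prompts -/

mutual

/-- The set of prompts that occur in an expression. -/
def Exp.prompts {n : ℕ} : Exp n → Finset Prompt
  | .val v => v.prompts
  | .app e₁ e₂ => e₁.prompts ∪ e₂.prompts
  | .fresh e => e.prompts
  | .reset v e => v.prompts ∪ e.prompts
  | .grab v e => v.prompts ∪ e.prompts
  | .push v e => v.prompts ∪ e.prompts

def Val.prompts {n : ℕ} : Val n → Finset Prompt
  | .var _ => ∅
  | .lam e => e.prompts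
  | .prompt p => {p}
  | .cont E => E.prompts

def ECtx.prompts {n : ℕ} : ECtx n → Finset Prompt
  | .hole => ∅
  | .appL E e => E.prompts ∪ e.prompts
  | .appR v E => v.prompts ∪ E.prompts
  | .reset p E => {p} ∪ E.prompts

end

/-- `E[e]`. -/
def ECtx.plug {n : ℕ} : ECtx n → Exp n → Exp n
  | .hole, e => e
  | .appL E e', e => .app (E.plug e) e'
  | .appR v E, e => .app (.val v) (E.plug e)
  | .reset p E, e => .reset (.prompt p) (E.plug e)

/-- `E[E']`. -/
def ECtx.comp {n : ℕ} : ECtx n → ECtx n → ECtx n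
  | .hole, E' => E'
  | .appL E e, E' => .appL (E.comp E') e
  | .appR v E, E' => .appR v (E.comp E')
  | .reset p E, E' => .reset p (E.comp E')

/-- Surrounding prompts: the prompts of the delimiters that guard the hole, that is, all `p`
with `E = E₁[#p E₂]` for some `E₁`, `E₂`. -/
def ECtx.surr {n : ℕ} : ECtx n → Finset Prompt
  | .hole => ∅
  | .appL E _ => E.surr
  | .appR _ E => E.surr
  | .reset p E => {p} ∪ E.surr

/-- The prompts of `m₁` that are not in `m₂` do not occur in `m₃`
(stated on the sets of prompts of the three entities). -/
def FreshFor (m₁ m₂ m₃ : Finset Prompt) : Prop := (m₁ \ m₂) ∩ m₃ = ∅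

/-! ### Reduction -/

/-- Reduction of closed expressions. -/
inductive Red : Exp 0 → Exp 0 → Prop
  | beta (e : Exp 1) (v : Val 0) :
      Red (.app (.val (.lam e)) (.val v)) (e.inst v)
  | ret (p : Prompt) (v : Val 0) :
      Red (.reset (.prompt p) (.val v)) (.val v)
  | capture (p : Prompt) (E : ECtx 0) (e : Exp 1) (hp : p ∉ E.surr) :
      Red (.reset (.prompt p) (E.plug (.grab (.prompt p) e))) (e.inst (.cont E))
  | throw (E : ECtx 0) (e : Exp 0) :
      Red (.push (.cont E) e) (E.plug e)
  | gen (p : Prompt) (e : Exp 1) (hp : p ∉ e.prompts) :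
      Red (.fresh e) (e.inst (.prompt p))
  | compat (E : ECtx 0) (e₁ e₂ : Exp 0) (h : Red e₁ e₂)
      (hE : FreshFor e₂.prompts e₁.prompts E.prompts) :
      Red (E.plug e₁) (E.plug e₂)

/-- Many-step reduction. -/
def RedStar : Exp 0 → Exp 0 → Prop := Relation.ReflTransGen Red

def Exp.IsValue {n : ℕ} : Exp n → Prop
  | .val _ => True
  | .app _ _ => False
  | .fresh _ => False
  | .reset _ _ => False
  | .grab _ _ => False
  | .push _ _ => False

/-- Normal forms: closed expressions that do not reduce. -/
def IsNormal (e : Exp 0) : Prop := ∀ e', ¬ Red e e'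

/-- Control-stuck expressions `E[𝒮p x.e']` with `p` not surrounding the hole of `E`. -/
def IsStuck (e : Exp 0) : Prop :=
  ∃ (E : ECtx 0) (p : Prompt) (e' : Exp 1), p ∉ E.surr ∧ e = E.plug (.grab (.prompt p) e')

/-- Errors: the normal forms that are neither values nor control-stuck. -/
def IsError (e : Exp 0) : Prop := IsNormal e ∧ ¬ e.IsValue ∧ ¬ IsStuck e

def Diverges (e : Exp 0) : Prop :=
  ∃ f : ℕ → Exp 0, f 0 = e ∧ ∀ k, Red (f k) (f (k + 1))

def DivOrErr (e : Exp 0) : Prop := Diverges e ∨ ∃ e', RedStar e e' ∧ IsError e'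

/-! ### Contextual equivalence -/

/-- Equivalent observable actions. -/
def ObsEq (e₁ e₂ : Exp 0) : Prop :=
  ((∃ v₁, RedStar e₁ (.val v₁)) ↔ (∃ v₂, RedStar e₂ (.val v₂))) ∧
  ((∃ e₁', RedStar e₁ e₁' ∧ IsStuck e₁') ↔ (∃ e₂', RedStar e₂ e₂' ∧ IsStuck e₂')) ∧
  (DivOrErr e₁ ↔ DivOrErr e₂)

/-- Contextual equivalence of closed expressions: testing with all promptless closed
evaluation contexts. -/
def CtxEq (e₁ e₂ : Exp 0) : Prop :=
  ∀ E : ECtx 0, E.prompts = ∅ → ObsEq (E.plug e₁) (E.plug e₂)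

/-! ### Multi-hole contexts -/

mutual

/-- Contexts `C ::= V | C C | 𝒢x.C | #V C | 𝒮V x.C | V ◁ C | ⋆ᵢ[C]`. -/
inductive MCtx : ℕ → Type
  | val {n : ℕ} (V : MVal n) : MCtx n
  | app {n : ℕ} (C₁ C₂ : MCtx n) : MCtx n
  | fresh {n : ℕ} (C : MCtx (n + 1)) : MCtx n
  | reset {n : ℕ} (V : MVal n) (C : MCtx n) : MCtx n
  | grab {n : ℕ} (V : MVal n) (C : MCtx (n + 1)) : MCtx n
  | push {n : ℕ} (V : MVal n) (C : MCtx n) : MCtx n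
  | star {n : ℕ} (i : ℕ) (C : MCtx n) : MCtx n

/-- Value contexts `V ::= x | λx.C | ⌜F⌝ | □ᵢ`. -/
inductive MVal : ℕ → Type
  | var {n : ℕ} (x : Fin n) : MVal n
  | lam {n : ℕ} (C : MCtx (n + 1)) : MVal n
  | cont {n : ℕ} (F : MECtx n) : MVal n
  | hole {n : ℕ} (i : ℕ) : MVal n

/-- Multi-hole evaluation contexts `F ::= □ | F C | V F | #□ᵢ F | ⋆ᵢ[F]`. -/
inductive MECtx : ℕ → Type
  | hole {n : ℕ} : MECtx n
  | appL {n : ℕ} (F : MECtx n) (C : MCtx n) : MECtx n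
  | appR {n : ℕ} (V : MVal n) (F : MECtx n) : MECtx n
  | reset {n : ℕ} (i : ℕ) (F : MECtx n) : MECtx n
  | star {n : ℕ} (i : ℕ) (F : MECtx n) : MECtx n

end

/-- Environments: finite sequences of closed values (indexed from `0`). -/
abbrev Env := List (Val 0)

def Env.prompts (Γ : Env) : Finset Prompt := Γ.foldr (fun v s => v.prompts ∪ s) ∅

/-- The prompt `Γᵢ`, if `Γᵢ` exists and is a prompt. -/
def Env.promptAt (Γ : Env) (i : ℕ) : Option Prompt :=
  match Γ[i]? with
  | some (.prompt p) => some p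
  | _ => none

/-- The evaluation context `E`, if `Γᵢ` exists and is a continuation `⌜E⌝`. -/
def Env.contAt (Γ : Env) (i : ℕ) : Option (ECtx 0) :=
  match Γ[i]? with
  | some (.cont E) => some E
  | _ => none

mutual

/-- `C[Γ]`: every `□ᵢ` is replaced by `Γᵢ`, and `⋆ᵢ[C]` by `E[C[Γ]]` where `Γᵢ = ⌜E⌝`.
The result is `none` when the application is not defined: an index is out of range, a `⋆ᵢ` meets
a value that is not a continuation, or an `#□ᵢ F` meets a value that is not a prompt. -/
def MCtx.fill {n : ℕ} (Γ : Env) : MCtx n → Option (Exp n)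
  | .val V => (V.fill Γ).bind fun v => some (.val v)
  | .app C₁ C₂ => (C₁.fill Γ).bind fun e₁ => (C₂.fill Γ).bind fun e₂ => some (.app e₁ e₂)
  | .fresh C => (C.fill Γ).bind fun e => some (.fresh e)
  | .reset V C => (V.fill Γ).bind fun v => (C.fill Γ).bind fun e => some (.reset v e)
  | .grab V C => (V.fill Γ).bind fun v => (C.fill Γ).bind fun e => some (.grab v e)
  | .push V C => (V.fill Γ).bind fun v => (C.fill Γ).bind fun e => some (.push v e)
  | .star i C => (Γ.contAt i).bind fun E => (C.fill Γ).bind fun e => some (E.weaken.plug e)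

/-- `V[Γ]`. -/
def MVal.fill {n : ℕ} (Γ : Env) : MVal n → Option (Val n)
  | .var x => some (.var x)
  | .lam C => (C.fill Γ).bind fun e => some (.lam e)
  | .cont F => (F.fill Γ).bind fun E => some (.cont E)
  | .hole i => (Γ[i]?).bind fun v => some v.weaken

/-- `F[Γ]`, an evaluation context. -/
def MECtx.fill {n : ℕ} (Γ : Env) : MECtx n → Option (ECtx n)
  | .hole => some .hole
  | .appL F C => (F.fill Γ).bind fun E => (C.fill Γ).bind fun e => some (.appL E e)
  | .appR V F => (V.fill Γ).bind fun v => (F.fill Γ).bind fun E => some (.appR v E)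
  | .reset i F => (Γ.promptAt i).bind fun p => (F.fill Γ).bind fun E => some (.reset p E)
  | .star i F => (Γ.contAt i).bind fun E' => (F.fill Γ).bind fun E => some (E'.weaken.comp E)

end

/-! ### The labeled transition system -/

/-- States: either a sequence of values `Γ`, or `(Γ, e)` with `e` not a value. -/
inductive State : Type
  | env (Γ : Env) : State
  | run (Γ : Env) (e : Exp 0) (he : ¬ e.IsValue) : State

/-- The state `(Γ, e)` for an arbitrary closed `e`; if `e` is a value `v`, it is the
sequence of values `Γ, v`. -/
def State.of (Γ : Env) : Exp 0 → State
  | .val v => .env (Γ ++ [v])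
  | .app e₁ e₂ => .run Γ (.app e₁ e₂) (fun h => h)
  | .fresh e => .run Γ (.fresh e) (fun h => h)
  | .reset v e => .run Γ (.reset v e) (fun h => h)
  | .grab v e => .run Γ (.grab v e) (fun h => h)
  | .push v e => .run Γ (.push v e) (fun h => h)

inductive Label : Type
  /-- internal step -/
  | tau : Label
  /-- test of the `i`-th value, a λ-abstraction, with the argument built by `V` -/
  | lam (i : ℕ) (V : MVal 0) : Label
  /-- the state is made of values only -/
  | val : Label
  /-- test of the `i`-th value, a continuation, with the argument built by `V` -/
  | ctx (i : ℕ) (V : MVal 0) : Label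
  /-- the `i`-th and `j`-th values are the same prompt -/
  | eqPrompt (i j : ℕ) : Label
  /-- generation of a new prompt -/
  | newPrompt : Label
  /-- test of a control-stuck expression with the context `F` -/
  | stuck (F : MECtx 0) : Label
  /-- decomposition of the `i`-th value, a continuation, at the prompt `Γⱼ` -/
  | decomp (i j : ℕ) : Label

/-- One reduction step, or no step for a normal form. -/
def RedBis (e e' : Exp 0) : Prop := Red e e' ∨ (IsNormal e ∧ e' = e)

/-- The refined labeled transition system. -/
inductive Lts : State → Label → State → Prop
  | tau (Γ : Env) (e₁ e₂ : Exp 0) (h₁ : ¬ e₁.IsValue) (hr : Red e₁ e₂)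
      (hf : FreshFor e₂.prompts e₁.prompts Γ.prompts) :
      Lts (.run Γ e₁ h₁) .tau (.of Γ e₂)
  | lam (Γ : Env) (i : ℕ) (V : MVal 0) (e : Exp 1) (v : Val 0)
      (hi : Γ[i]? = some (.lam e)) (hV : V.fill Γ = some v) :
      Lts (.env Γ) (.lam i V) (.of Γ (e.inst v))
  | val (Γ : Env) : Lts (.env Γ) .val (.env Γ)
  | ctx (Γ : Env) (i : ℕ) (V : MVal 0) (E : ECtx 0) (v : Val 0)
      (hi : Γ[i]? = some (.cont E)) (hV : V.fill Γ = some v) :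
      Lts (.env Γ) (.ctx i V) (.of Γ (E.plug (.val v)))
  | eqPrompt (Γ : Env) (i j : ℕ) (p : Prompt)
      (hi : Γ[i]? = some (.prompt p)) (hj : Γ[j]? = some (.prompt p)) :
      Lts (.env Γ) (.eqPrompt i j) (.env Γ)
  | newPrompt (Γ : Env) (p : Prompt) (hp : p ∉ Γ.prompts) :
      Lts (.env Γ) .newPrompt (.env (Γ ++ [.prompt p]))
  | stuck (Γ : Env) (e : Exp 0) (he : ¬ e.IsValue) (F : MECtx 0) (E : ECtx 0) (e' : Exp 0)
      (hs : IsStuck e) (hF : F.fill Γ = some E) (hr : RedBis (E.plug e) e') :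
      Lts (.run Γ e he) (.stuck F) (.of Γ e')
  | decomp (Γ : Env) (i j : ℕ) (E₁ E₂ : ECtx 0) (p : Prompt)
      (hi : Γ[i]? = some (.cont (E₁.comp (.reset p E₂)))) (hj : Γ[j]? = some (.prompt p))
      (hp : p ∉ E₂.surr) :
      Lts (.env Γ) (.decomp i j) (.env (Γ ++ [.cont E₁, .cont E₂]))

/-- The passive labels; all the other ones are active. -/
def Label.Passive : Label → Prop
  | .val => True
  | .ctx _ _ => True
  | _ => False

/-- Zero or more internal steps. -/
def TauStar : State → State → Prop :=
  Relation.ReflTransGen (fun s t => Lts s .tau t)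

/-- Weak transitions. -/
def WeakLts (s : State) (a : Label) (t : State) : Prop :=
  (a = .tau ∧ TauStar s t) ∨
  (a ≠ .tau ∧ ∃ s' t', TauStar s s' ∧ Lts s' a t' ∧ TauStar t' t)

/-! ### Star-bisimilarity -/

/-- `R` diacritically progresses to `S`, `T`. -/
def DiaProgress (R S T : State → State → Prop) : Prop :=
  (∀ s t, R s t → S s t) ∧
  (∀ s t, R s t → T s t) ∧
  ∀ s t, R s t →
    (∀ a s', Lts s a s' → a.Passive → ∃ t', WeakLts t a t' ∧ S s' t') ∧
    (∀ a s', Lts s a s' → ¬ a.Passive → ∃ t', WeakLts t a t' ∧ T s' t') ∧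
    (∀ a t', Lts t a t' → a.Passive → ∃ s', WeakLts s a s' ∧ S s' t') ∧
    (∀ a t', Lts t a t' → ¬ a.Passive → ∃ s', WeakLts s a s' ∧ T s' t')

def IsStarBisimulation (R : State → State → Prop) : Prop := DiaProgress R R R

/-- Star-bisimilarity: the union of all star-bisimulations. -/
def StarBisimilar (s t : State) : Prop :=
  ∃ R : State → State → Prop, IsStarBisimulation R ∧ R s t

end MultiPrompt

/-!
Contextual equivalence and star-bisimilarity coincide.

Reduction has a unique focus (`IsFocus.decomp_unique`) and is deterministic up to the choice of
new prompts (`Red.unique`). Reaching a value and reaching a control-stuck expression are hence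
properties of an expression that are invariant under reduction, and a closed expression that does
neither diverges or reduces to an error, so the third clause of the equivalence of observable
actions follows from the first two (`obsEq_iff`).

*Soundness.* Given related environments `Γ` and `Δ`, `CongExp` relates all fillings of one
multi-hole context by `Γ` and by `Δ`. Evaluation of one filling is followed by that of the other
one: as long as the focus belongs to the context, both make the same step, and when it belongs to
a value of the environments, the transitions of the bisimulation supply the answer, extending the
environments (`CongExp.alwaysDecomposes`, `FocusPair.progresses`). A capture cuts the context at a
delimiter that is either in the context or inside a plugged continuation; the transition `decomp`
provides the two halves of the latter (`CongCtx.exists_split`). The requirements on the relations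
are collected in `Simulation`, with the conclusion that the right-hand expression reaches the
observables of the left-hand one (`Closure.reach`), and star-bisimilarity is an instance
(`simulation_starBisimilar`).

*Completeness.* Expressions over two environments are called indistinguishable if all fillings of
one evaluation context by the environments have the same observables (`IndistExp`), and this
relation is a star-bisimulation. The difficulty lies in the transitions that extend the
environments by values `v` and `w`: fillings of one expression context by the extended
environments have to be compared by fillings of an evaluation context by the old ones, applied to
`v` and `w`. One would abstract the new value out of the context and pass it as an argument, but it
can occur in positions where the grammar does not allow a variable: plugged as `⋆ᵢ[C]`, or as a
delimiter `#□ᵢ` of a quoted evaluation context. There the context is replaced by an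
expression that computes it: `E[e]` by `⌜E⌝ ◁ e`, and `⌜E⌝` by `𝒢k.#k E[𝒮k x.x]`, where `E` is
now an ordinary piece of program. That these administrative changes preserve observables is proved
by the same evaluation argument as soundness (`CongExp.sameObs`): `CongExp` has a flag that adds
these changes to its rules, and prompts paired with themselves form a `Simulation`
(`simulation_prompts`). The resulting abstraction lemma is `CongExp.abs`. What remains is to
write down tests that recognize the kind of a value, equality of prompts, and the decomposition
of a continuation, which `splitTest` performs by capturing both halves.
-/

namespace MultiPrompt

/-! ### Renaming and substitution -/

@[simp] theorem liftRen_zero {n m : ℕ} (ρ : Fin n → Fin m) : liftRen ρ 0 = 0 := rfl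

@[simp] theorem liftSub_zero {n m : ℕ} (σ : Fin n → Val m) : liftSub σ 0 = .var 0 := rfl

@[simp] theorem liftSub_succ {n m : ℕ} (σ : Fin n → Val m) (i : Fin n) :
    liftSub σ i.succ = (σ i).rename Fin.succ := rfl

theorem liftRen_comp {n m k : ℕ} (ρ : Fin n → Fin m) (ρ' : Fin m → Fin k) :
    liftRen ρ' ∘ liftRen ρ = liftRen (ρ' ∘ ρ) := by
  funext i; cases i using Fin.cases <;> rfl

theorem liftSub_comp_liftRen {n m k : ℕ} (ρ : Fin n → Fin m) (σ : Fin m → Val k) :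
    liftSub σ ∘ liftRen ρ = liftSub (σ ∘ ρ) := by
  funext i; cases i using Fin.cases <;> rfl

theorem liftSub_var {n : ℕ} : liftSub (Val.var : Fin n → Val n) = Val.var := by
  funext i; cases i using Fin.cases <;> rfl

mutual

theorem Exp.rename_rename {n m k : ℕ} (ρ : Fin n → Fin m) (ρ' : Fin m → Fin k) :
    (e : Exp n) → (e.rename ρ).rename ρ' = e.rename (ρ' ∘ ρ)
  | .val v => by
      simp only [Exp.rename, Val.rename_rename ρ ρ' v]
  | .app e₁ e₂ => by
      simp only [Exp.rename, Exp.rename_rename ρ ρ' e₁, Exp.rename_rename ρ ρ' e₂]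
  | .fresh e => by
      simp only [Exp.rename, Exp.rename_rename (liftRen ρ) (liftRen ρ') e, liftRen_comp]
  | .reset v e => by
      simp only [Exp.rename, Val.rename_rename ρ ρ' v, Exp.rename_rename ρ ρ' e]
  | .grab v e => by
      simp only [Exp.rename, Val.rename_rename ρ ρ' v,
        Exp.rename_rename (liftRen ρ) (liftRen ρ') e, liftRen_comp]
  | .push v e => by
      simp only [Exp.rename, Val.rename_rename ρ ρ' v, Exp.rename_rename ρ ρ' e]

theorem Val.rename_rename {n m k : ℕ} (ρ : Fin n → Fin m) (ρ' : Fin m → Fin k) :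
    (v : Val n) → (v.rename ρ).rename ρ' = v.rename (ρ' ∘ ρ)
  | .var x => rfl
  | .lam e => by
      simp only [Val.rename, Exp.rename_rename (liftRen ρ) (liftRen ρ') e, liftRen_comp]
  | .prompt p => rfl
  | .cont E => by
      simp only [Val.rename, ECtx.rename_rename ρ ρ' E]

theorem ECtx.rename_rename {n m k : ℕ} (ρ : Fin n → Fin m) (ρ' : Fin m → Fin k) :
    (E : ECtx n) → (E.rename ρ).rename ρ' = E.rename (ρ' ∘ ρ)
  | .hole => rfl
  | .appL E e => by
      simp only [ECtx.rename, ECtx.rename_rename ρ ρ' E, Exp.rename_rename ρ ρ' e]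
  | .appR v E => by
      simp only [ECtx.rename, Val.rename_rename ρ ρ' v, ECtx.rename_rename ρ ρ' E]
  | .reset p E => by
      simp only [ECtx.rename, ECtx.rename_rename ρ ρ' E]

end

mutual

theorem Exp.subst_rename {n m k : ℕ} (ρ : Fin n → Fin m) (σ : Fin m → Val k) :
    (e : Exp n) → (e.rename ρ).subst σ = e.subst (σ ∘ ρ)
  | .val v => by
      simp only [Exp.rename, Exp.subst, Val.subst_rename ρ σ v]
  | .app e₁ e₂ => by
      simp only [Exp.rename, Exp.subst, Exp.subst_rename ρ σ e₁, Exp.subst_rename ρ σ e₂]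
  | .fresh e => by
      simp only [Exp.rename, Exp.subst, Exp.subst_rename (liftRen ρ) (liftSub σ) e,
        liftSub_comp_liftRen]
  | .reset v e => by
      simp only [Exp.rename, Exp.subst, Val.subst_rename ρ σ v, Exp.subst_rename ρ σ e]
  | .grab v e => by
      simp only [Exp.rename, Exp.subst, Val.subst_rename ρ σ v,
        Exp.subst_rename (liftRen ρ) (liftSub σ) e, liftSub_comp_liftRen]
  | .push v e => by
      simp only [Exp.rename, Exp.subst, Val.subst_rename ρ σ v, Exp.subst_rename ρ σ e]

theorem Val.subst_rename {n m k : ℕ} (ρ : Fin n → Fin m) (σ : Fin m → Val k) :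
    (v : Val n) → (v.rename ρ).subst σ = v.subst (σ ∘ ρ)
  | .var x => rfl
  | .lam e => by
      simp only [Val.rename, Val.subst, Exp.subst_rename (liftRen ρ) (liftSub σ) e,
        liftSub_comp_liftRen]
  | .prompt p => rfl
  | .cont E => by
      simp only [Val.rename, Val.subst, ECtx.subst_rename ρ σ E]

theorem ECtx.subst_rename {n m k : ℕ} (ρ : Fin n → Fin m) (σ : Fin m → Val k) :
    (E : ECtx n) → (E.rename ρ).subst σ = E.subst (σ ∘ ρ)
  | .hole => rfl
  | .appL E e => by
      simp only [ECtx.rename, ECtx.subst, ECtx.subst_rename ρ σ E, Exp.subst_rename ρ σ e]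
  | .appR v E => by
      simp only [ECtx.rename, ECtx.subst, Val.subst_rename ρ σ v, ECtx.subst_rename ρ σ E]
  | .reset p E => by
      simp only [ECtx.rename, ECtx.subst, ECtx.subst_rename ρ σ E]

end

theorem rename_liftSub {n m k : ℕ} (σ : Fin n → Val m) (ρ : Fin m → Fin k) :
    (fun i => (liftSub σ i).rename (liftRen ρ)) = liftSub (fun i => (σ i).rename ρ) := by
  funext i
  cases i using Fin.cases with
  | zero => rfl
  | succ i => simp only [liftSub_succ, Val.rename_rename]; rfl

mutual

theorem Exp.rename_subst {n m k : ℕ} (σ : Fin n → Val m) (ρ : Fin m → Fin k) :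
    (e : Exp n) → (e.subst σ).rename ρ = e.subst (fun i => (σ i).rename ρ)
  | .val v => by
      simp only [Exp.rename, Exp.subst, Val.rename_subst σ ρ v]
  | .app e₁ e₂ => by
      simp only [Exp.rename, Exp.subst, Exp.rename_subst σ ρ e₁, Exp.rename_subst σ ρ e₂]
  | .fresh e => by
      simp only [Exp.rename, Exp.subst, Exp.rename_subst (liftSub σ) (liftRen ρ) e, rename_liftSub]
  | .reset v e => by
      simp only [Exp.rename, Exp.subst, Val.rename_subst σ ρ v, Exp.rename_subst σ ρ e]
  | .grab v e => by
      simp only [Exp.rename, Exp.subst, Val.rename_subst σ ρ v,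
        Exp.rename_subst (liftSub σ) (liftRen ρ) e, rename_liftSub]
  | .push v e => by
      simp only [Exp.rename, Exp.subst, Val.rename_subst σ ρ v, Exp.rename_subst σ ρ e]

theorem Val.rename_subst {n m k : ℕ} (σ : Fin n → Val m) (ρ : Fin m → Fin k) :
    (v : Val n) → (v.subst σ).rename ρ = v.subst (fun i => (σ i).rename ρ)
  | .var x => rfl
  | .lam e => by
      simp only [Val.rename, Val.subst, Exp.rename_subst (liftSub σ) (liftRen ρ) e, rename_liftSub]
  | .prompt p => rfl
  | .cont E => by
      simp only [Val.rename, Val.subst, ECtx.rename_subst σ ρ E]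

theorem ECtx.rename_subst {n m k : ℕ} (σ : Fin n → Val m) (ρ : Fin m → Fin k) :
    (E : ECtx n) → (E.subst σ).rename ρ = E.subst (fun i => (σ i).rename ρ)
  | .hole => rfl
  | .appL E e => by
      simp only [ECtx.rename, ECtx.subst, ECtx.rename_subst σ ρ E, Exp.rename_subst σ ρ e]
  | .appR v E => by
      simp only [ECtx.rename, ECtx.subst, Val.rename_subst σ ρ v, ECtx.rename_subst σ ρ E]
  | .reset p E => by
      simp only [ECtx.rename, ECtx.subst, ECtx.rename_subst σ ρ E]

end

mutual

theorem Exp.subst_var {n : ℕ} :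
    (e : Exp n) → e.subst Val.var = e
  | .val v => by
      simp only [Exp.subst, Val.subst_var v]
  | .app e₁ e₂ => by
      simp only [Exp.subst, Exp.subst_var e₁, Exp.subst_var e₂]
  | .fresh e => by
      simp only [Exp.subst, liftSub_var, Exp.subst_var e]
  | .reset v e => by
      simp only [Exp.subst, Val.subst_var v, Exp.subst_var e]
  | .grab v e => by
      simp only [Exp.subst, Val.subst_var v, liftSub_var, Exp.subst_var e]
  | .push v e => by
      simp only [Exp.subst, Val.subst_var v, Exp.subst_var e]

theorem Val.subst_var {n : ℕ} :
    (v : Val n) → v.subst Val.var = v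
  | .var x => rfl
  | .lam e => by
      simp only [Val.subst, liftSub_var, Exp.subst_var e]
  | .prompt p => rfl
  | .cont E => by
      simp only [Val.subst, ECtx.subst_var E]

theorem ECtx.subst_var {n : ℕ} :
    (E : ECtx n) → E.subst Val.var = E
  | .hole => rfl
  | .appL E e => by
      simp only [ECtx.subst, ECtx.subst_var E, Exp.subst_var e]
  | .appR v E => by
      simp only [ECtx.subst, Val.subst_var v, ECtx.subst_var E]
  | .reset p E => by
      simp only [ECtx.subst, ECtx.subst_var E]

end

theorem liftSub_comp_var {n m : ℕ} (ρ : Fin n → Fin m) :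
    (fun i => Val.var (liftRen ρ i)) = liftSub (fun i => Val.var (ρ i)) := by
  funext i; cases i using Fin.cases <;> rfl

mutual

theorem Exp.rename_eq_subst {n m : ℕ} (ρ : Fin n → Fin m) :
    (e : Exp n) → e.rename ρ = e.subst (fun i => .var (ρ i))
  | .val v => by
      simp only [Exp.rename, Exp.subst, Val.rename_eq_subst ρ v]
  | .app e₁ e₂ => by
      simp only [Exp.rename, Exp.subst, Exp.rename_eq_subst ρ e₁, Exp.rename_eq_subst ρ e₂]
  | .fresh e => by
      simp only [Exp.rename, Exp.subst, Exp.rename_eq_subst (liftRen ρ) e, liftSub_comp_var]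
  | .reset v e => by
      simp only [Exp.rename, Exp.subst, Val.rename_eq_subst ρ v, Exp.rename_eq_subst ρ e]
  | .grab v e => by
      simp only [Exp.rename, Exp.subst, Val.rename_eq_subst ρ v,
        Exp.rename_eq_subst (liftRen ρ) e, liftSub_comp_var]
  | .push v e => by
      simp only [Exp.rename, Exp.subst, Val.rename_eq_subst ρ v, Exp.rename_eq_subst ρ e]

theorem Val.rename_eq_subst {n m : ℕ} (ρ : Fin n → Fin m) :
    (v : Val n) → v.rename ρ = v.subst (fun i => .var (ρ i))
  | .var x => rfl
  | .lam e => by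
      simp only [Val.rename, Val.subst, Exp.rename_eq_subst (liftRen ρ) e, liftSub_comp_var]
  | .prompt p => rfl
  | .cont E => by
      simp only [Val.rename, Val.subst, ECtx.rename_eq_subst ρ E]

theorem ECtx.rename_eq_subst {n m : ℕ} (ρ : Fin n → Fin m) :
    (E : ECtx n) → E.rename ρ = E.subst (fun i => .var (ρ i))
  | .hole => rfl
  | .appL E e => by
      simp only [ECtx.rename, ECtx.subst, ECtx.rename_eq_subst ρ E, Exp.rename_eq_subst ρ e]
  | .appR v E => by
      simp only [ECtx.rename, ECtx.subst, Val.rename_eq_subst ρ v, ECtx.rename_eq_subst ρ E]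
  | .reset p E => by
      simp only [ECtx.rename, ECtx.subst, ECtx.rename_eq_subst ρ E]

end

theorem ECtx.rename_id {n : ℕ} (E : ECtx n) : E.rename id = E :=
  (ECtx.rename_eq_subst id E).trans E.subst_var

@[simp] theorem Val.weaken_self (v : Val 0) : (v.weaken : Val 0) = v := by
  rw [Val.weaken, Val.rename_eq_subst]
  exact (congrArg v.subst (funext fun i => i.elim0)).trans v.subst_var

@[simp] theorem ECtx.weaken_self (E : ECtx 0) : (E.weaken : ECtx 0) = E := by
  rw [ECtx.weaken, ECtx.rename_eq_subst]
  exact (congrArg E.subst (funext fun i => i.elim0)).trans E.subst_var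

@[simp] theorem Val.weaken_rename {n m : ℕ} (v : Val 0) (ρ : Fin n → Fin m) :
    (v.weaken : Val n).rename ρ = v.weaken := by
  rw [Val.weaken, Val.rename_rename]
  exact congrArg v.rename (funext fun i => i.elim0)

@[simp] theorem ECtx.weaken_rename {n m : ℕ} (E : ECtx 0) (ρ : Fin n → Fin m) :
    (E.weaken : ECtx n).rename ρ = E.weaken := by
  rw [ECtx.weaken, ECtx.rename_rename]
  exact congrArg E.rename (funext fun i => i.elim0)

@[simp] theorem Val.weaken_subst {n m : ℕ} (v : Val 0) (σ : Fin n → Val m) :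
    (v.weaken : Val n).subst σ = v.weaken := by
  rw [Val.weaken, Val.subst_rename, Val.weaken, Val.rename_eq_subst]
  exact congrArg v.subst (funext fun i => i.elim0)

@[simp] theorem ECtx.weaken_subst {n m : ℕ} (E : ECtx 0) (σ : Fin n → Val m) :
    (E.weaken : ECtx n).subst σ = E.weaken := by
  rw [ECtx.weaken, ECtx.subst_rename, ECtx.weaken, ECtx.rename_eq_subst]
  exact congrArg E.subst (funext fun i => i.elim0)

/-! ### Plugging and composition of evaluation contexts -/

theorem ECtx.plug_rename {n m : ℕ} (E : ECtx n) (e : Exp n) (ρ : Fin n → Fin m) :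
    (E.plug e).rename ρ = (E.rename ρ).plug (e.rename ρ) := by
  match E with
  | .hole => rfl
  | .appL E _ => simp only [ECtx.plug, Exp.rename, ECtx.rename, plug_rename E e ρ]
  | .appR _ E => simp only [ECtx.plug, Exp.rename, ECtx.rename, plug_rename E e ρ]
  | .reset _ E => simp only [ECtx.plug, Exp.rename, Val.rename, ECtx.rename, plug_rename E e ρ]

theorem ECtx.plug_subst {n m : ℕ} (E : ECtx n) (e : Exp n) (σ : Fin n → Val m) :
    (E.plug e).subst σ = (E.subst σ).plug (e.subst σ) := by
  match E with
  | .hole => rfl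
  | .appL E _ => simp only [ECtx.plug, Exp.subst, ECtx.subst, plug_subst E e σ]
  | .appR _ E => simp only [ECtx.plug, Exp.subst, ECtx.subst, plug_subst E e σ]
  | .reset _ E => simp only [ECtx.plug, Exp.subst, Val.subst, ECtx.subst, plug_subst E e σ]

theorem ECtx.comp_rename {n m : ℕ} (E E' : ECtx n) (ρ : Fin n → Fin m) :
    (E.comp E').rename ρ = (E.rename ρ).comp (E'.rename ρ) := by
  match E with
  | .hole => rfl
  | .appL E _ => simp only [ECtx.comp, ECtx.rename, comp_rename E E' ρ]
  | .appR _ E => simp only [ECtx.comp, ECtx.rename, comp_rename E E' ρ]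
  | .reset _ E => simp only [ECtx.comp, ECtx.rename, comp_rename E E' ρ]

theorem ECtx.comp_subst {n m : ℕ} (E E' : ECtx n) (σ : Fin n → Val m) :
    (E.comp E').subst σ = (E.subst σ).comp (E'.subst σ) := by
  match E with
  | .hole => rfl
  | .appL E _ => simp only [ECtx.comp, ECtx.subst, comp_subst E E' σ]
  | .appR _ E => simp only [ECtx.comp, ECtx.subst, comp_subst E E' σ]
  | .reset _ E => simp only [ECtx.comp, ECtx.subst, comp_subst E E' σ]

theorem ECtx.comp_plug {n : ℕ} (E E' : ECtx n) (e : Exp n) :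
    (E.comp E').plug e = E.plug (E'.plug e) := by
  match E with
  | .hole => rfl
  | .appL E _ => simp only [ECtx.comp, ECtx.plug, comp_plug E E' e]
  | .appR _ E => simp only [ECtx.comp, ECtx.plug, comp_plug E E' e]
  | .reset _ E => simp only [ECtx.comp, ECtx.plug, comp_plug E E' e]

theorem ECtx.comp_assoc {n : ℕ} (E E' E'' : ECtx n) :
    (E.comp E').comp E'' = E.comp (E'.comp E'') := by
  match E with
  | .hole => rfl
  | .appL E _ => simp only [ECtx.comp, comp_assoc E E' E'']
  | .appR _ E => simp only [ECtx.comp, comp_assoc E E' E'']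
  | .reset _ E => simp only [ECtx.comp, comp_assoc E E' E'']

theorem ECtx.comp_hole {n : ℕ} (E : ECtx n) : E.comp .hole = E := by
  match E with
  | .hole => rfl
  | .appL E _ => simp only [ECtx.comp, comp_hole E]
  | .appR _ E => simp only [ECtx.comp, comp_hole E]
  | .reset _ E => simp only [ECtx.comp, comp_hole E]

theorem ECtx.comp_surr {n : ℕ} (E E' : ECtx n) : (E.comp E').surr = E.surr ∪ E'.surr := by
  match E with
  | .hole => simp [ECtx.comp, ECtx.surr]
  | .appL E _ => simp only [ECtx.comp, ECtx.surr, comp_surr E E']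
  | .appR _ E => simp only [ECtx.comp, ECtx.surr, comp_surr E E']
  | .reset _ E => simp only [ECtx.comp, ECtx.surr, comp_surr E E', Finset.union_assoc]

/-- A surrounding prompt determines an innermost delimiter. -/
theorem ECtx.exists_split_of_mem_surr {n : ℕ} {p : Prompt} (E : ECtx n) (h : p ∈ E.surr) :
    ∃ E₁ E₂ : ECtx n, E = E₁.comp (.reset p E₂) ∧ p ∉ E₂.surr := by
  match E with
  | .hole => simp [ECtx.surr] at h
  | .appL E e =>
    obtain ⟨E₁, E₂, rfl, h₂⟩ := exists_split_of_mem_surr E h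
    exact ⟨.appL E₁ e, E₂, rfl, h₂⟩
  | .appR v E =>
    obtain ⟨E₁, E₂, rfl, h₂⟩ := exists_split_of_mem_surr E h
    exact ⟨.appR v E₁, E₂, rfl, h₂⟩
  | .reset q E =>
    by_cases hE : p ∈ E.surr
    · obtain ⟨E₁, E₂, rfl, h₂⟩ := exists_split_of_mem_surr E hE
      exact ⟨.reset q E₁, E₂, rfl, h₂⟩
    · obtain rfl : p = q := by simpa [ECtx.surr, hE] using h
      exact ⟨.hole, E, rfl, hE⟩

theorem ECtx.plug_prompts {n : ℕ} (E : ECtx n) (e : Exp n) :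
    (E.plug e).prompts = E.prompts ∪ e.prompts := by
  match E with
  | .hole => simp [ECtx.plug, ECtx.prompts]
  | .appL E _ =>
    simp only [ECtx.plug, Exp.prompts, ECtx.prompts, plug_prompts E e, Finset.union_right_comm]
  | .appR _ E =>
    simp only [ECtx.plug, Exp.prompts, ECtx.prompts, plug_prompts E e, Finset.union_assoc]
  | .reset _ E =>
    simp only [ECtx.plug, Exp.prompts, Val.prompts, ECtx.prompts, plug_prompts E e,
      Finset.union_assoc]

theorem ECtx.comp_prompts {n : ℕ} (E E' : ECtx n) :
    (E.comp E').prompts = E.prompts ∪ E'.prompts := by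
  match E with
  | .hole => simp [ECtx.comp, ECtx.prompts]
  | .appL E _ => simp only [ECtx.comp, ECtx.prompts, comp_prompts E E', Finset.union_right_comm]
  | .appR _ E => simp only [ECtx.comp, ECtx.prompts, comp_prompts E E', Finset.union_assoc]
  | .reset _ E => simp only [ECtx.comp, ECtx.prompts, comp_prompts E E', Finset.union_assoc]

mutual

theorem Exp.rename_prompts {n m : ℕ} (ρ : Fin n → Fin m) :
    (e : Exp n) → (e.rename ρ).prompts = e.prompts
  | .val v => by
      simp only [Exp.rename, Exp.prompts, Val.rename_prompts ρ v]
  | .app e₁ e₂ => by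
      simp only [Exp.rename, Exp.prompts, Exp.rename_prompts ρ e₁, Exp.rename_prompts ρ e₂]
  | .fresh e => by
      simp only [Exp.rename, Exp.prompts, Exp.rename_prompts (liftRen ρ) e]
  | .reset v e => by
      simp only [Exp.rename, Exp.prompts, Val.rename_prompts ρ v, Exp.rename_prompts ρ e]
  | .grab v e => by
      simp only [Exp.rename, Exp.prompts, Val.rename_prompts ρ v, Exp.rename_prompts (liftRen ρ) e]
  | .push v e => by
      simp only [Exp.rename, Exp.prompts, Val.rename_prompts ρ v, Exp.rename_prompts ρ e]

theorem Val.rename_prompts {n m : ℕ} (ρ : Fin n → Fin m) :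
    (v : Val n) → (v.rename ρ).prompts = v.prompts
  | .var x => rfl
  | .lam e => by
      simp only [Val.rename, Val.prompts, Exp.rename_prompts (liftRen ρ) e]
  | .prompt p => rfl
  | .cont E => by
      simp only [Val.rename, Val.prompts, ECtx.rename_prompts ρ E]

theorem ECtx.rename_prompts {n m : ℕ} (ρ : Fin n → Fin m) :
    (E : ECtx n) → (E.rename ρ).prompts = E.prompts
  | .hole => rfl
  | .appL E e => by
      simp only [ECtx.rename, ECtx.prompts, ECtx.rename_prompts ρ E, Exp.rename_prompts ρ e]
  | .appR v E => by
      simp only [ECtx.rename, ECtx.prompts, Val.rename_prompts ρ v, ECtx.rename_prompts ρ E]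
  | .reset p E => by
      simp only [ECtx.rename, ECtx.prompts, ECtx.rename_prompts ρ E]

end

@[simp] theorem Val.weaken_prompts {n : ℕ} (v : Val 0) : (v.weaken : Val n).prompts = v.prompts :=
  Val.rename_prompts _ v

@[simp] theorem ECtx.weaken_prompts {n : ℕ} (E : ECtx 0) :
    (E.weaken : ECtx n).prompts = E.prompts :=
  ECtx.rename_prompts _ E

theorem liftSub_prompts_subset {n m : ℕ} {σ : Fin n → Val m} {S : Finset Prompt}
    (h : ∀ i, (σ i).prompts ⊆ S) (i : Fin (n + 1)) : (liftSub σ i).prompts ⊆ S := by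
  cases i using Fin.cases with
  | zero => simp [Val.prompts]
  | succ i => rw [liftSub_succ, Val.rename_prompts]; exact h i

theorem union_subset_union_of_subset {a b c d S : Finset Prompt}
    (h₁ : a ⊆ c ∪ S) (h₂ : b ⊆ d ∪ S) : a ∪ b ⊆ c ∪ d ∪ S := by
  grind

mutual

theorem Exp.subst_prompts_subset {n m : ℕ} {σ : Fin n → Val m} {S : Finset Prompt}
    (h : ∀ i, (σ i).prompts ⊆ S) : (e : Exp n) → (e.subst σ).prompts ⊆ e.prompts ∪ S
  | .val v => Val.subst_prompts_subset h v
  | .app e₁ e₂ => union_subset_union_of_subset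
      (Exp.subst_prompts_subset h e₁) (Exp.subst_prompts_subset h e₂)
  | .fresh e => Exp.subst_prompts_subset (liftSub_prompts_subset h) e
  | .reset v e => union_subset_union_of_subset
      (Val.subst_prompts_subset h v) (Exp.subst_prompts_subset h e)
  | .grab v e => union_subset_union_of_subset
      (Val.subst_prompts_subset h v) (Exp.subst_prompts_subset (liftSub_prompts_subset h) e)
  | .push v e => union_subset_union_of_subset
      (Val.subst_prompts_subset h v) (Exp.subst_prompts_subset h e)

theorem Val.subst_prompts_subset {n m : ℕ} {σ : Fin n → Val m} {S : Finset Prompt}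
    (h : ∀ i, (σ i).prompts ⊆ S) : (v : Val n) → (v.subst σ).prompts ⊆ v.prompts ∪ S
  | .var x => (h x).trans Finset.subset_union_right
  | .lam e => Exp.subst_prompts_subset (liftSub_prompts_subset h) e
  | .prompt _ => Finset.subset_union_left
  | .cont E => ECtx.subst_prompts_subset h E

theorem ECtx.subst_prompts_subset {n m : ℕ} {σ : Fin n → Val m} {S : Finset Prompt}
    (h : ∀ i, (σ i).prompts ⊆ S) : (E : ECtx n) → (E.subst σ).prompts ⊆ E.prompts ∪ S
  | .hole => Finset.empty_subset _
  | .appL E e => union_subset_union_of_subset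
      (ECtx.subst_prompts_subset h E) (Exp.subst_prompts_subset h e)
  | .appR v E => union_subset_union_of_subset
      (Val.subst_prompts_subset h v) (ECtx.subst_prompts_subset h E)
  | .reset _ E => union_subset_union_of_subset
      Finset.subset_union_left (ECtx.subst_prompts_subset h E)

end

theorem Exp.inst_prompts_subset {n : ℕ} (e : Exp (n + 1)) (v : Val n) :
    (e.inst v).prompts ⊆ e.prompts ∪ v.prompts :=
  Exp.subst_prompts_subset (fun i => by
    cases i using Fin.cases with
    | zero => exact subset_rfl
    | succ i => exact Finset.empty_subset _) e

@[simp] theorem ECtx.rename_succ_inst {n : ℕ} (E : ECtx n) (v : Val n) :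
    (E.rename Fin.succ).subst (Fin.cases v Val.var) = E :=
  (ECtx.subst_rename _ _ E).trans E.subst_var

theorem ECtx.rename_succ_rename {n m : ℕ} (E : ECtx n) (ρ : Fin n → Fin m) :
    (E.rename Fin.succ).rename (liftRen ρ) = (E.rename ρ).rename Fin.succ := by
  rw [ECtx.rename_rename, ECtx.rename_rename]; rfl

theorem ECtx.rename_succ_subst {n m : ℕ} (E : ECtx n) (σ : Fin n → Val m) :
    (E.rename Fin.succ).subst (liftSub σ) = (E.subst σ).rename Fin.succ := by
  rw [ECtx.subst_rename, ECtx.rename_subst]; rfl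

/-! ### Renaming of prompts -/

mutual

/-- Renaming of the prompts of an expression. -/
def Exp.mapPrompts (f : Prompt → Prompt) {n : ℕ} : Exp n → Exp n
  | .val v => .val (v.mapPrompts f)
  | .app e₁ e₂ => .app (e₁.mapPrompts f) (e₂.mapPrompts f)
  | .fresh e => .fresh (e.mapPrompts f)
  | .reset v e => .reset (v.mapPrompts f) (e.mapPrompts f)
  | .grab v e => .grab (v.mapPrompts f) (e.mapPrompts f)
  | .push v e => .push (v.mapPrompts f) (e.mapPrompts f)

/-- Renaming of the prompts of a value. -/
def Val.mapPrompts (f : Prompt → Prompt) {n : ℕ} : Val n → Val n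
  | .var x => .var x
  | .lam e => .lam (e.mapPrompts f)
  | .prompt p => .prompt (f p)
  | .cont E => .cont (E.mapPrompts f)

/-- Renaming of the prompts of an evaluation context. -/
def ECtx.mapPrompts (f : Prompt → Prompt) {n : ℕ} : ECtx n → ECtx n
  | .hole => .hole
  | .appL E e => .appL (E.mapPrompts f) (e.mapPrompts f)
  | .appR v E => .appR (v.mapPrompts f) (E.mapPrompts f)
  | .reset p E => .reset (f p) (E.mapPrompts f)

end

mutual

theorem Exp.mapPrompts_mapPrompts (f g : Prompt → Prompt) {n : ℕ} :
    (e : Exp n) → (e.mapPrompts f).mapPrompts g = e.mapPrompts (g ∘ f)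
  | .val v => by
      simp only [Exp.mapPrompts, Val.mapPrompts_mapPrompts f g v]
  | .app e₁ e₂ => by
      simp only [Exp.mapPrompts, Exp.mapPrompts_mapPrompts f g e₁, Exp.mapPrompts_mapPrompts f g e₂]
  | .fresh e => by
      simp only [Exp.mapPrompts, Exp.mapPrompts_mapPrompts f g e]
  | .reset v e => by
      simp only [Exp.mapPrompts, Val.mapPrompts_mapPrompts f g v, Exp.mapPrompts_mapPrompts f g e]
  | .grab v e => by
      simp only [Exp.mapPrompts, Val.mapPrompts_mapPrompts f g v, Exp.mapPrompts_mapPrompts f g e]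
  | .push v e => by
      simp only [Exp.mapPrompts, Val.mapPrompts_mapPrompts f g v, Exp.mapPrompts_mapPrompts f g e]

theorem Val.mapPrompts_mapPrompts (f g : Prompt → Prompt) {n : ℕ} :
    (v : Val n) → (v.mapPrompts f).mapPrompts g = v.mapPrompts (g ∘ f)
  | .var x => rfl
  | .lam e => by
      simp only [Val.mapPrompts, Exp.mapPrompts_mapPrompts f g e]
  | .prompt p => rfl
  | .cont E => by
      simp only [Val.mapPrompts, ECtx.mapPrompts_mapPrompts f g E]

theorem ECtx.mapPrompts_mapPrompts (f g : Prompt → Prompt) {n : ℕ} :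
    (E : ECtx n) → (E.mapPrompts f).mapPrompts g = E.mapPrompts (g ∘ f)
  | .hole => rfl
  | .appL E e => by
      simp only [ECtx.mapPrompts, ECtx.mapPrompts_mapPrompts f g E, Exp.mapPrompts_mapPrompts f g e]
  | .appR v E => by
      simp only [ECtx.mapPrompts, Val.mapPrompts_mapPrompts f g v, ECtx.mapPrompts_mapPrompts f g E]
  | .reset p E => by
      simp only [ECtx.mapPrompts, ECtx.mapPrompts_mapPrompts f g E, Function.comp_apply]

end

mutual

theorem Exp.mapPrompts_rename (f : Prompt → Prompt) {n m : ℕ} (ρ : Fin n → Fin m) :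
    (e : Exp n) → (e.rename ρ).mapPrompts f = (e.mapPrompts f).rename ρ
  | .val v => by
      simp only [Exp.mapPrompts, Exp.rename, Val.mapPrompts_rename f ρ v]
  | .app e₁ e₂ => by
      simp only [Exp.mapPrompts, Exp.rename, Exp.mapPrompts_rename f ρ e₁,
        Exp.mapPrompts_rename f ρ e₂]
  | .fresh e => by
      simp only [Exp.mapPrompts, Exp.rename, Exp.mapPrompts_rename f (liftRen ρ) e]
  | .reset v e => by
      simp only [Exp.mapPrompts, Exp.rename, Val.mapPrompts_rename f ρ v,
        Exp.mapPrompts_rename f ρ e]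
  | .grab v e => by
      simp only [Exp.mapPrompts, Exp.rename, Val.mapPrompts_rename f ρ v,
        Exp.mapPrompts_rename f (liftRen ρ) e]
  | .push v e => by
      simp only [Exp.mapPrompts, Exp.rename, Val.mapPrompts_rename f ρ v,
        Exp.mapPrompts_rename f ρ e]

theorem Val.mapPrompts_rename (f : Prompt → Prompt) {n m : ℕ} (ρ : Fin n → Fin m) :
    (v : Val n) → (v.rename ρ).mapPrompts f = (v.mapPrompts f).rename ρ
  | .var x => rfl
  | .lam e => by
      simp only [Val.mapPrompts, Val.rename, Exp.mapPrompts_rename f (liftRen ρ) e]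
  | .prompt p => rfl
  | .cont E => by
      simp only [Val.mapPrompts, Val.rename, ECtx.mapPrompts_rename f ρ E]

theorem ECtx.mapPrompts_rename (f : Prompt → Prompt) {n m : ℕ} (ρ : Fin n → Fin m) :
    (E : ECtx n) → (E.rename ρ).mapPrompts f = (E.mapPrompts f).rename ρ
  | .hole => rfl
  | .appL E e => by
      simp only [ECtx.mapPrompts, ECtx.rename, ECtx.mapPrompts_rename f ρ E,
        Exp.mapPrompts_rename f ρ e]
  | .appR v E => by
      simp only [ECtx.mapPrompts, ECtx.rename, Val.mapPrompts_rename f ρ v,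
        ECtx.mapPrompts_rename f ρ E]
  | .reset p E => by
      simp only [ECtx.mapPrompts, ECtx.rename, ECtx.mapPrompts_rename f ρ E]

end

theorem mapPrompts_liftSub (f : Prompt → Prompt) {n m : ℕ} (σ : Fin n → Val m) :
    (fun i => (liftSub σ i).mapPrompts f) = liftSub (fun i => (σ i).mapPrompts f) := by
  funext i
  cases i using Fin.cases with
  | zero => rfl
  | succ i => exact Val.mapPrompts_rename f Fin.succ (σ i)

mutual

theorem Exp.mapPrompts_subst (f : Prompt → Prompt) {n m : ℕ} (σ : Fin n → Val m) :
    (e : Exp n) → (e.subst σ).mapPrompts f = (e.mapPrompts f).subst (fun i => (σ i).mapPrompts f)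
  | .val v => by
      simp only [Exp.mapPrompts, Exp.subst, Val.mapPrompts_subst f σ v]
  | .app e₁ e₂ => by
      simp only [Exp.mapPrompts, Exp.subst, Exp.mapPrompts_subst f σ e₁,
        Exp.mapPrompts_subst f σ e₂]
  | .fresh e => by
      simp only [Exp.mapPrompts, Exp.subst, Exp.mapPrompts_subst f (liftSub σ) e,
        mapPrompts_liftSub]
  | .reset v e => by
      simp only [Exp.mapPrompts, Exp.subst, Val.mapPrompts_subst f σ v, Exp.mapPrompts_subst f σ e]
  | .grab v e => by
      simp only [Exp.mapPrompts, Exp.subst, Val.mapPrompts_subst f σ v,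
        Exp.mapPrompts_subst f (liftSub σ) e, mapPrompts_liftSub]
  | .push v e => by
      simp only [Exp.mapPrompts, Exp.subst, Val.mapPrompts_subst f σ v, Exp.mapPrompts_subst f σ e]

theorem Val.mapPrompts_subst (f : Prompt → Prompt) {n m : ℕ} (σ : Fin n → Val m) :
    (v : Val n) → (v.subst σ).mapPrompts f = (v.mapPrompts f).subst (fun i => (σ i).mapPrompts f)
  | .var x => rfl
  | .lam e => by
      simp only [Val.mapPrompts, Val.subst, Exp.mapPrompts_subst f (liftSub σ) e,
        mapPrompts_liftSub]
  | .prompt p => rfl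
  | .cont E => by
      simp only [Val.mapPrompts, Val.subst, ECtx.mapPrompts_subst f σ E]

theorem ECtx.mapPrompts_subst (f : Prompt → Prompt) {n m : ℕ} (σ : Fin n → Val m) :
    (E : ECtx n) → (E.subst σ).mapPrompts f = (E.mapPrompts f).subst (fun i => (σ i).mapPrompts f)
  | .hole => rfl
  | .appL E e => by
      simp only [ECtx.mapPrompts, ECtx.subst, ECtx.mapPrompts_subst f σ E,
        Exp.mapPrompts_subst f σ e]
  | .appR v E => by
      simp only [ECtx.mapPrompts, ECtx.subst, Val.mapPrompts_subst f σ v,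
        ECtx.mapPrompts_subst f σ E]
  | .reset p E => by
      simp only [ECtx.mapPrompts, ECtx.subst, ECtx.mapPrompts_subst f σ E]

end

theorem Exp.mapPrompts_inst (f : Prompt → Prompt) {n : ℕ} (e : Exp (n + 1)) (v : Val n) :
    (e.inst v).mapPrompts f = (e.mapPrompts f).inst (v.mapPrompts f) := by
  rw [Exp.inst, Exp.mapPrompts_subst, Exp.inst]
  congr 1
  funext i
  cases i using Fin.cases <;> rfl

theorem ECtx.mapPrompts_plug (f : Prompt → Prompt) {n : ℕ} (E : ECtx n) (e : Exp n) :
    (E.plug e).mapPrompts f = (E.mapPrompts f).plug (e.mapPrompts f) := by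
  match E with
  | .hole => rfl
  | .appL E _ => simp only [ECtx.plug, Exp.mapPrompts, ECtx.mapPrompts, mapPrompts_plug f E e]
  | .appR _ E =>
    simp only [ECtx.plug, Exp.mapPrompts, ECtx.mapPrompts, mapPrompts_plug f E e]
  | .reset _ E =>
    simp only [ECtx.plug, Exp.mapPrompts, Val.mapPrompts, ECtx.mapPrompts, mapPrompts_plug f E e]

theorem ECtx.mapPrompts_surr (f : Prompt → Prompt) {n : ℕ} (E : ECtx n) :
    (E.mapPrompts f).surr = E.surr.image f := by
  match E with
  | .hole => rfl
  | .appL E _ => simp only [ECtx.mapPrompts, ECtx.surr, mapPrompts_surr f E]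
  | .appR _ E => simp only [ECtx.mapPrompts, ECtx.surr, mapPrompts_surr f E]
  | .reset _ E =>
    simp only [ECtx.mapPrompts, ECtx.surr, mapPrompts_surr f E, Finset.image_union,
      Finset.image_singleton]

mutual

theorem Exp.mapPrompts_prompts (f : Prompt → Prompt) {n : ℕ} :
    (e : Exp n) → (e.mapPrompts f).prompts = e.prompts.image f
  | .val v => by
      simp only [Exp.mapPrompts, Exp.prompts, Val.mapPrompts_prompts f v]
  | .app e₁ e₂ => by
      simp only [Finset.image_union, Exp.mapPrompts, Exp.prompts, Exp.mapPrompts_prompts f e₁,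
        Exp.mapPrompts_prompts f e₂]
  | .fresh e => by
      simp only [Exp.mapPrompts, Exp.prompts, Exp.mapPrompts_prompts f e]
  | .reset v e => by
      simp only [Finset.image_union, Exp.mapPrompts, Exp.prompts, Val.mapPrompts_prompts f v,
        Exp.mapPrompts_prompts f e]
  | .grab v e => by
      simp only [Finset.image_union, Exp.mapPrompts, Exp.prompts, Val.mapPrompts_prompts f v,
        Exp.mapPrompts_prompts f e]
  | .push v e => by
      simp only [Finset.image_union, Exp.mapPrompts, Exp.prompts, Val.mapPrompts_prompts f v,
        Exp.mapPrompts_prompts f e]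

theorem Val.mapPrompts_prompts (f : Prompt → Prompt) {n : ℕ} :
    (v : Val n) → (v.mapPrompts f).prompts = v.prompts.image f
  | .var x => rfl
  | .lam e => by
      simp only [Val.mapPrompts, Val.prompts, Exp.mapPrompts_prompts f e]
  | .prompt p => rfl
  | .cont E => by
      simp only [Val.mapPrompts, Val.prompts, ECtx.mapPrompts_prompts f E]

theorem ECtx.mapPrompts_prompts (f : Prompt → Prompt) {n : ℕ} :
    (E : ECtx n) → (E.mapPrompts f).prompts = E.prompts.image f
  | .hole => rfl
  | .appL E e => by
      simp only [Finset.image_union, ECtx.mapPrompts, ECtx.prompts, ECtx.mapPrompts_prompts f E,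
        Exp.mapPrompts_prompts f e]
  | .appR v E => by
      simp only [Finset.image_union, ECtx.mapPrompts, ECtx.prompts, Val.mapPrompts_prompts f v,
        ECtx.mapPrompts_prompts f E]
  | .reset p E => by
      simp only [Finset.image_union, Finset.image_singleton, ECtx.mapPrompts, ECtx.prompts,
        ECtx.mapPrompts_prompts f E]

end

mutual

theorem Exp.mapPrompts_eq_self {f : Prompt → Prompt} {n : ℕ} :
    (e : Exp n) → (∀ p ∈ e.prompts, f p = p) → e.mapPrompts f = e
  | .val v, h => congrArg Exp.val (Val.mapPrompts_eq_self v h)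
  | .app e₁ e₂, h => congrArg₂ Exp.app
      (Exp.mapPrompts_eq_self e₁ fun p hp => h p (Finset.mem_union_left _ hp))
      (Exp.mapPrompts_eq_self e₂ fun p hp => h p (Finset.mem_union_right _ hp))
  | .fresh e, h => congrArg Exp.fresh (Exp.mapPrompts_eq_self e h)
  | .reset v e, h => congrArg₂ Exp.reset
      (Val.mapPrompts_eq_self v fun p hp => h p (Finset.mem_union_left _ hp))
      (Exp.mapPrompts_eq_self e fun p hp => h p (Finset.mem_union_right _ hp))
  | .grab v e, h => congrArg₂ Exp.grab
      (Val.mapPrompts_eq_self v fun p hp => h p (Finset.mem_union_left _ hp))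
      (Exp.mapPrompts_eq_self e fun p hp => h p (Finset.mem_union_right _ hp))
  | .push v e, h => congrArg₂ Exp.push
      (Val.mapPrompts_eq_self v fun p hp => h p (Finset.mem_union_left _ hp))
      (Exp.mapPrompts_eq_self e fun p hp => h p (Finset.mem_union_right _ hp))

theorem Val.mapPrompts_eq_self {f : Prompt → Prompt} {n : ℕ} :
    (v : Val n) → (∀ p ∈ v.prompts, f p = p) → v.mapPrompts f = v
  | .var _, _ => rfl
  | .lam e, h => congrArg Val.lam (Exp.mapPrompts_eq_self e h)
  | .prompt p, h => congrArg Val.prompt (h p (Finset.mem_singleton_self p))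
  | .cont E, h => congrArg Val.cont (ECtx.mapPrompts_eq_self E h)

theorem ECtx.mapPrompts_eq_self {f : Prompt → Prompt} {n : ℕ} :
    (E : ECtx n) → (∀ p ∈ E.prompts, f p = p) → E.mapPrompts f = E
  | .hole, _ => rfl
  | .appL E e, h => congrArg₂ ECtx.appL
      (ECtx.mapPrompts_eq_self E fun p hp => h p (Finset.mem_union_left _ hp))
      (Exp.mapPrompts_eq_self e fun p hp => h p (Finset.mem_union_right _ hp))
  | .appR v E, h => congrArg₂ ECtx.appR
      (Val.mapPrompts_eq_self v fun p hp => h p (Finset.mem_union_left _ hp))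
      (ECtx.mapPrompts_eq_self E fun p hp => h p (Finset.mem_union_right _ hp))
  | .reset p E, h => congrArg₂ ECtx.reset
      (h p (Finset.mem_union_left _ (Finset.mem_singleton_self p)))
      (ECtx.mapPrompts_eq_self E fun p hp => h p (Finset.mem_union_right _ hp))

end

theorem Exp.mapPrompts_isValue (f : Prompt → Prompt) {n : ℕ} {e : Exp n} (h : e.IsValue) :
    (e.mapPrompts f).IsValue := by
  cases e <;> exact h

theorem FreshFor.image {f : Prompt → Prompt} (hf : Function.Injective f)
    {a b c : Finset Prompt} (h : FreshFor a b c) :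
    FreshFor (a.image f) (b.image f) (c.image f) := by
  rw [FreshFor, ← Finset.image_sdiff _ _ hf, ← Finset.image_inter _ _ hf]
  exact (congrArg _ h).trans (Finset.image_empty f)

theorem Red.mapPrompts {f : Prompt → Prompt} (hf : Function.Injective f) {e e' : Exp 0}
    (h : Red e e') : Red (e.mapPrompts f) (e'.mapPrompts f) := by
  induction h with
  | beta e v => rw [Exp.mapPrompts_inst]; exact .beta _ _
  | ret p v => exact .ret _ _
  | capture p E e hp =>
    rw [Exp.mapPrompts_inst]
    simp only [Exp.mapPrompts, ECtx.mapPrompts_plug, Val.mapPrompts]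
    refine .capture _ _ _ ?_
    rw [ECtx.mapPrompts_surr]
    exact fun h => hp ((hf.mem_finset_image).1 h)
  | throw E e =>
    rw [ECtx.mapPrompts_plug]; exact .throw _ _
  | gen p e hp =>
    rw [Exp.mapPrompts_inst]
    refine .gen _ _ ?_
    rw [Exp.mapPrompts_prompts]
    exact fun h => hp ((hf.mem_finset_image).1 h)
  | compat E e₁ e₂ _ hE ih =>
    rw [ECtx.mapPrompts_plug, ECtx.mapPrompts_plug]
    refine .compat _ _ _ ih ?_
    rw [Exp.mapPrompts_prompts, Exp.mapPrompts_prompts, ECtx.mapPrompts_prompts]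
    exact hE.image hf

theorem IsStuck.mapPrompts {f : Prompt → Prompt} (hf : Function.Injective f) {e : Exp 0}
    (h : IsStuck e) : IsStuck (e.mapPrompts f) := by
  obtain ⟨E, p, b, hp, rfl⟩ := h
  refine ⟨E.mapPrompts f, f p, b.mapPrompts f, ?_, ?_⟩
  · rw [ECtx.mapPrompts_surr]
    exact fun h => hp ((hf.mem_finset_image).1 h)
  · rw [ECtx.mapPrompts_plug]; rfl

/-! ### Unique decomposition and determinism up to the choice of new prompts -/

/-- The expressions that evaluation can focus on: those that are not values and that do not
decompose further. They are either redexes, grabs, or errors. -/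
inductive IsFocus : Exp 0 → Prop
  | app (v w : Val 0) : IsFocus (.app (.val v) (.val w))
  | fresh (e : Exp 1) : IsFocus (.fresh e)
  | ret (p : Prompt) (v : Val 0) : IsFocus (.reset (.prompt p) (.val v))
  | badReset (v : Val 0) (e : Exp 0) (h : ∀ p, v ≠ .prompt p) : IsFocus (.reset v e)
  | grab (v : Val 0) (e : Exp 1) : IsFocus (.grab v e)
  | push (v : Val 0) (e : Exp 0) : IsFocus (.push v e)

theorem IsFocus.plug_ne_val {a : Exp 0} (ha : IsFocus a) (E : ECtx 0) (v : Val 0) :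
    E.plug a ≠ .val v := by
  cases E <;> simp only [ECtx.plug, ne_eq, reduceCtorEq, not_false_eq_true]
  cases ha <;> simp

/-- Unique decomposition into an evaluation context and a focus. -/
theorem IsFocus.decomp_unique {a b : Exp 0} (ha : IsFocus a) (hb : IsFocus b) (E E' : ECtx 0)
    (h : E.plug a = E'.plug b) : E = E' ∧ a = b := by
  match E, E' with
  | .hole, .hole => exact ⟨rfl, h⟩
  | .hole, .appL E' e =>
    obtain rfl : a = _ := h
    simp only [ECtx.plug] at ha
    generalize hc : E'.plug b = c at ha
    cases ha
    exact absurd hc (hb.plug_ne_val _ _)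
  | .hole, .appR v E' =>
    obtain rfl : a = _ := h
    simp only [ECtx.plug] at ha
    generalize hc : E'.plug b = c at ha
    cases ha
    exact absurd hc (hb.plug_ne_val _ _)
  | .hole, .reset p E' =>
    obtain rfl : a = _ := h
    simp only [ECtx.plug] at ha
    generalize hc : E'.plug b = c at ha
    cases ha with
    | ret => exact absurd hc (hb.plug_ne_val _ _)
    | badReset _ _ h => exact absurd rfl (h p)
  | .appL E e, .hole =>
    obtain rfl : _ = b := h
    simp only [ECtx.plug] at hb
    generalize hc : E.plug a = c at hb
    cases hb
    exact absurd hc (ha.plug_ne_val _ _)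
  | .appR v E, .hole =>
    obtain rfl : _ = b := h
    simp only [ECtx.plug] at hb
    generalize hc : E.plug a = c at hb
    cases hb
    exact absurd hc (ha.plug_ne_val _ _)
  | .reset p E, .hole =>
    obtain rfl : _ = b := h
    simp only [ECtx.plug] at hb
    generalize hc : E.plug a = c at hb
    cases hb with
    | ret => exact absurd hc (ha.plug_ne_val _ _)
    | badReset _ _ h => exact absurd rfl (h p)
  | .appL E e, .appL E' e' =>
    simp only [ECtx.plug, Exp.app.injEq] at h
    obtain ⟨rfl, rfl⟩ := ha.decomp_unique hb E E' h.1
    exact ⟨by rw [h.2], rfl⟩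
  | .appL E e, .appR v E' =>
    simp only [ECtx.plug, Exp.app.injEq] at h
    exact absurd h.1 (ha.plug_ne_val _ _)
  | .appL E e, .reset p E' => simp [ECtx.plug] at h
  | .appR v E, .appL E' e =>
    simp only [ECtx.plug, Exp.app.injEq] at h
    exact absurd h.1.symm (hb.plug_ne_val _ _)
  | .appR v E, .appR v' E' =>
    simp only [ECtx.plug, Exp.app.injEq, Exp.val.injEq] at h
    obtain ⟨rfl, rfl⟩ := ha.decomp_unique hb E E' h.2
    exact ⟨by rw [h.1], rfl⟩
  | .appR v E, .reset p E' => simp [ECtx.plug] at h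
  | .reset p E, .appL E' e => simp [ECtx.plug] at h
  | .reset p E, .appR v E' => simp [ECtx.plug] at h
  | .reset p E, .reset p' E' =>
    simp only [ECtx.plug, Exp.reset.injEq, Val.prompt.injEq] at h
    obtain ⟨rfl, rfl⟩ := ha.decomp_unique hb E E' h.2
    exact ⟨by rw [h.1], rfl⟩

/-- The innermost delimiter with a given prompt is unique, so that captures are deterministic. -/
theorem ECtx.comp_reset_inj {p : Prompt} (E₁ E₂ E₁' E₂' : ECtx 0) (h₂ : p ∉ E₂.surr)
    (h₂' : p ∉ E₂'.surr) (h : E₁.comp (.reset p E₂) = E₁'.comp (.reset p E₂')) :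
    E₁ = E₁' ∧ E₂ = E₂' := by
  match E₁, E₁' with
  | .hole, .hole => simpa [ECtx.comp] using h
  | .hole, .appL _ _ => simp [ECtx.comp] at h
  | .hole, .appR _ _ => simp [ECtx.comp] at h
  | .hole, .reset q E' =>
    simp only [ECtx.comp, ECtx.reset.injEq] at h
    rw [h.2, ECtx.comp_surr] at h₂
    simp [ECtx.surr] at h₂
  | .appL _ _, .hole => simp [ECtx.comp] at h
  | .appL E e, .appL E' e' =>
    simp only [ECtx.comp, ECtx.appL.injEq] at h
    obtain ⟨rfl, rfl⟩ := comp_reset_inj E E₂ E' E₂' h₂ h₂' h.1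
    exact ⟨by rw [h.2], rfl⟩
  | .appL _ _, .appR _ _ => simp [ECtx.comp] at h
  | .appL _ _, .reset _ _ => simp [ECtx.comp] at h
  | .appR _ _, .hole => simp [ECtx.comp] at h
  | .appR _ _, .appL _ _ => simp [ECtx.comp] at h
  | .appR v E, .appR v' E' =>
    simp only [ECtx.comp, ECtx.appR.injEq] at h
    obtain ⟨rfl, rfl⟩ := comp_reset_inj E E₂ E' E₂' h₂ h₂' h.2
    exact ⟨by rw [h.1], rfl⟩
  | .appR _ _, .reset _ _ => simp [ECtx.comp] at h
  | .reset q E, .hole =>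
    simp only [ECtx.comp, ECtx.reset.injEq] at h
    rw [← h.2, ECtx.comp_surr] at h₂'
    simp [ECtx.surr] at h₂'
  | .reset _ _, .appL _ _ => simp [ECtx.comp] at h
  | .reset _ _, .appR _ _ => simp [ECtx.comp] at h
  | .reset q E, .reset q' E' =>
    simp only [ECtx.comp, ECtx.reset.injEq] at h
    obtain ⟨rfl, rfl⟩ := comp_reset_inj E E₂ E' E₂' h₂ h₂' h.2
    exact ⟨by rw [h.1], rfl⟩

/-- `Contract E a e` says that the focus `a` reduces in the evaluation context `E`, with
result `e`. Contexts are merged into a single one, so that reduction becomes non-recursive. -/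
inductive Contract : ECtx 0 → Exp 0 → Exp 0 → Prop
  | beta (E : ECtx 0) (b : Exp 1) (v : Val 0) :
      Contract E (.app (.val (.lam b)) (.val v)) (E.plug (b.inst v))
  | ret (E : ECtx 0) (p : Prompt) (v : Val 0) :
      Contract E (.reset (.prompt p) (.val v)) (E.plug (.val v))
  | capture (E₁ E₂ : ECtx 0) (p : Prompt) (b : Exp 1) (hp : p ∉ E₂.surr) :
      Contract (E₁.comp (.reset p E₂)) (.grab (.prompt p) b) (E₁.plug (b.inst (.cont E₂)))
  | throw (E E' : ECtx 0) (e : Exp 0) : Contract E (.push (.cont E') e) (E.plug (E'.plug e))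
  | gen (E : ECtx 0) (p : Prompt) (b : Exp 1) (hp : p ∉ b.prompts)
      (hE : FreshFor (b.inst (.prompt p)).prompts b.prompts E.prompts) :
      Contract E (.fresh b) (E.plug (b.inst (.prompt p)))

theorem Contract.isFocus {E : ECtx 0} {a e : Exp 0} (h : Contract E a e) : IsFocus a := by
  cases h <;> constructor

theorem Contract.comp {E : ECtx 0} {a e : Exp 0} (h : Contract E a e) (E' : ECtx 0)
    (hf : FreshFor e.prompts (E.plug a).prompts E'.prompts) :
    Contract (E'.comp E) a (E'.plug e) := by
  cases h with
  | capture E₁ E₂ p b hp =>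
    rw [← ECtx.comp_assoc, ← ECtx.comp_plug]; exact .capture _ _ _ _ hp
  | gen _ p b hp hE =>
    rw [← ECtx.comp_plug]
    refine .gen _ _ _ hp ?_
    simp only [FreshFor, ECtx.comp_prompts, ECtx.plug_prompts, Exp.prompts] at *
    grind
  | _ => rw [← ECtx.comp_plug]; constructor

theorem capture_prompts_subset (E : ECtx 0) (p : Prompt) (b : Exp 1) :
    (b.inst (.cont E)).prompts ⊆ (Exp.reset (.prompt p) (E.plug (.grab (.prompt p) b))).prompts := by
  refine (Exp.inst_prompts_subset _ _).trans ?_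
  simp only [Exp.prompts, ECtx.plug_prompts, Val.prompts]
  grind

theorem FreshFor.of_subset {a b : Finset Prompt} (c : Finset Prompt) (h : a ⊆ b) :
    FreshFor a b c := by
  rw [FreshFor, Finset.sdiff_eq_empty_iff_subset.2 h, Finset.empty_inter]

/-- Nested uses of the congruence rule can be merged into one. -/
theorem red_iff_contract {e e' : Exp 0} :
    Red e e' ↔ ∃ E a, e = E.plug a ∧ Contract E a e' := by
  constructor
  · intro h
    induction h with
    | beta b v => exact ⟨.hole, _, rfl, .beta .hole b v⟩
    | ret p v => exact ⟨.hole, _, rfl, .ret .hole p v⟩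
    | capture p E b hp => exact ⟨.reset p E, _, rfl, .capture .hole E p b hp⟩
    | throw E e => exact ⟨.hole, _, rfl, .throw .hole E e⟩
    | gen p b hp => exact ⟨.hole, _, rfl, .gen .hole p b hp (by simp [FreshFor, ECtx.prompts])⟩
    | compat E' e₁ e₂ _ hE ih =>
      obtain ⟨E, a, rfl, h⟩ := ih
      exact ⟨E'.comp E, a, (ECtx.comp_plug _ _ _).symm, h.comp E' hE⟩
  · rintro ⟨E, a, rfl, h⟩
    cases h with
    | beta _ b v =>
      refine .compat _ _ _ (.beta b v) (.of_subset _ ?_)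
      exact Exp.inst_prompts_subset b v
    | ret _ p v => exact .compat _ _ _ (.ret p v) (.of_subset _ Finset.subset_union_right)
    | capture E₁ E₂ p b hp =>
      rw [ECtx.comp_plug]
      exact .compat _ _ _ (.capture p E₂ b hp) (.of_subset _ (capture_prompts_subset E₂ p b))
    | throw _ E' e =>
      refine .compat _ _ _ (.throw E' e) (.of_subset _ ?_)
      rw [ECtx.plug_prompts]; exact subset_rfl
    | gen _ p b hp hE => exact .compat _ _ _ (.gen p b hp) hE

theorem Contract.red {E : ECtx 0} {a e : Exp 0} (h : Contract E a e) : Red (E.plug a) e :=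
  red_iff_contract.2 ⟨E, a, rfl, h⟩

theorem Red.contract {E : ECtx 0} {a e : Exp 0} (ha : IsFocus a) (h : Red (E.plug a) e) :
    Contract E a e := by
  obtain ⟨E', a', h₁, h₂⟩ := red_iff_contract.1 h
  obtain ⟨rfl, rfl⟩ := ha.decomp_unique h₂.isFocus _ _ h₁
  exact h₂

theorem exists_prompt_notMem (S : Finset Prompt) : ∃ p, p ∉ S := Infinite.exists_notMem_finset S

theorem swap_eq_self {p q r : Prompt} {S : Finset Prompt} (hp : p ∉ S) (hq : q ∉ S) (hr : r ∈ S) :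
    Equiv.swap p q r = r :=
  Equiv.swap_apply_of_ne_of_ne (fun h => hp (h ▸ hr)) (fun h => hq (h ▸ hr))

/-- The result of generating a prompt agrees, up to a permutation, with the result for almost
every other choice of prompt. -/
theorem gen_mapPrompts {E : ECtx 0} {p : Prompt} {b : Exp 1} (hp : p ∉ b.prompts)
    (hE : FreshFor (b.inst (.prompt p)).prompts b.prompts E.prompts) {r : Prompt}
    (hrb : r ∉ b.prompts) (hri : r ∉ (b.inst (.prompt p)).prompts) (hrE : r ∉ E.prompts) :
    ∃ π : Equiv.Perm Prompt,
      E.plug (b.inst (.prompt r)) = (E.plug (b.inst (.prompt p))).mapPrompts π := by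
  have hswap : (b.inst (.prompt p)).mapPrompts (Equiv.swap p r) = b.inst (.prompt r) := by
    rw [Exp.mapPrompts_inst, Exp.mapPrompts_eq_self b fun q hq => swap_eq_self hp hrb hq]
    simp [Val.mapPrompts]
  by_cases hpE : p ∈ E.prompts
  · -- the bound variable does not occur, and the choice of the prompt is irrelevant
    have hpi : p ∉ (b.inst (.prompt p)).prompts := by
      intro hpi
      have : p ∈ ((b.inst (.prompt p)).prompts \ b.prompts) ∩ E.prompts := by
        simp [hpi, hp, hpE]
      rw [hE] at this
      simp at this
    rw [Exp.mapPrompts_eq_self _ fun q hq => swap_eq_self hpi hri hq] at hswap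
    exact ⟨1, by rw [← hswap, Exp.mapPrompts_eq_self]; intros; rfl⟩
  · refine ⟨Equiv.swap p r, ?_⟩
    rw [ECtx.mapPrompts_plug, hswap,
      ECtx.mapPrompts_eq_self E fun q hq => swap_eq_self hpE hrE hq]

theorem Contract.unique {E : ECtx 0} {a e₁ e₂ : Exp 0} (h₁ : Contract E a e₁)
    (h₂ : Contract E a e₂) : ∃ π : Equiv.Perm Prompt, e₂ = e₁.mapPrompts π := by
  have hrefl : ∀ e : Exp 0, ∃ π : Equiv.Perm Prompt, e = e.mapPrompts π :=
    fun e => ⟨1, (Exp.mapPrompts_eq_self e fun _ _ => rfl).symm⟩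
  cases h₁ with
  | beta _ b v => cases h₂; exact hrefl _
  | ret _ p v => cases h₂; exact hrefl _
  | throw _ E' e => cases h₂; exact hrefl _
  | capture E₁ E₂ p b hp =>
    generalize hE : E₁.comp (.reset p E₂) = E at h₂
    cases h₂ with
    | capture E₁' E₂' _ _ hp' =>
      obtain ⟨rfl, rfl⟩ := ECtx.comp_reset_inj _ _ _ _ hp hp' hE
      exact hrefl _
  | gen _ p b hp hE =>
    cases h₂ with
    | gen _ q _ hq hE' =>
      obtain ⟨r, hr⟩ := exists_prompt_notMem (b.prompts ∪ (b.inst (.prompt p)).prompts ∪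
        (b.inst (.prompt q)).prompts ∪ E.prompts)
      simp only [Finset.mem_union, not_or] at hr
      obtain ⟨⟨⟨hr₁, hr₂⟩, hr₃⟩, hr₄⟩ := hr
      obtain ⟨π, hπ⟩ := gen_mapPrompts hp hE hr₁ hr₂ hr₄
      obtain ⟨π', hπ'⟩ := gen_mapPrompts hq hE' hr₁ hr₃ hr₄
      refine ⟨π'⁻¹ * π, ?_⟩
      have := congrArg (Exp.mapPrompts (π'⁻¹ : Equiv.Perm Prompt)) (hπ'.symm.trans hπ)
      rw [Exp.mapPrompts_mapPrompts, Exp.mapPrompts_mapPrompts, Exp.mapPrompts_eq_self] at this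
      · exact this
      · intro p _; simp

/-- Reduction is deterministic up to a permutation of prompts. -/
theorem Red.unique {e e₁ e₂ : Exp 0} (h₁ : Red e e₁) (h₂ : Red e e₂) :
    ∃ π : Equiv.Perm Prompt, e₂ = e₁.mapPrompts π := by
  obtain ⟨E, a, rfl, h⟩ := red_iff_contract.1 h₁
  exact h.unique (h₂.contract h.isFocus)

theorem exists_focus_or_value (e : Exp 0) :
    (∃ v, e = .val v) ∨ ∃ (E : ECtx 0) (a : Exp 0), IsFocus a ∧ e = E.plug a := by
  match e with
  | .val v => exact .inl ⟨v, rfl⟩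
  | .app e₁ e₂ =>
    rcases exists_focus_or_value e₁ with ⟨v, rfl⟩ | ⟨E, a, ha, rfl⟩
    · rcases exists_focus_or_value e₂ with ⟨w, rfl⟩ | ⟨E, a, ha, rfl⟩
      · exact .inr ⟨.hole, _, .app v w, rfl⟩
      · exact .inr ⟨.appR v E, a, ha, rfl⟩
    · exact .inr ⟨.appL E e₂, a, ha, rfl⟩
  | .fresh e => exact .inr ⟨.hole, _, .fresh e, rfl⟩
  | .reset (.prompt p) e =>
    rcases exists_focus_or_value e with ⟨v, rfl⟩ | ⟨E, a, ha, rfl⟩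
    · exact .inr ⟨.hole, _, .ret p v, rfl⟩
    · exact .inr ⟨.reset p E, a, ha, rfl⟩
  | .reset (.var x) _ => exact x.elim0
  | .reset (.lam _) e => exact .inr ⟨.hole, _, .badReset _ e (by simp), rfl⟩
  | .reset (.cont _) e => exact .inr ⟨.hole, _, .badReset _ e (by simp), rfl⟩
  | .grab v e => exact .inr ⟨.hole, _, .grab v e, rfl⟩
  | .push v e => exact .inr ⟨.hole, _, .push v e, rfl⟩

/-! ### Observables -/

/-- A property of closed expressions that can be observed at the end of an evaluation: it is
invariant under injective renamings of prompts, and it holds of normal forms only. -/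
structure Observable (P : Exp 0 → Prop) : Prop where
  mapPrompts : ∀ {f : Prompt → Prompt}, Function.Injective f → ∀ {e}, P e → P (e.mapPrompts f)
  isNormal : ∀ {e}, P e → IsNormal e

theorem observable_isValue : Observable (Exp.IsValue (n := 0)) where
  mapPrompts _ _ h := Exp.mapPrompts_isValue _ h
  isNormal := by
    intro e he e' h
    obtain ⟨E, a, rfl, hc⟩ := red_iff_contract.1 h
    match hE : E.plug a, he with
    | .val v, _ => exact hc.isFocus.plug_ne_val _ _ hE

theorem observable_isStuck : Observable IsStuck where
  mapPrompts hf _ h := h.mapPrompts hf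
  isNormal := by
    rintro _ ⟨E, p, b, hp, rfl⟩ e' h
    generalize hE : E = E' at h
    cases h.contract (.grab _ _) with
    | capture E₁ E₂ =>
      rw [hE, ECtx.comp_surr] at hp
      simp [ECtx.surr] at hp

theorem Exp.IsValue.exists_eq {n : ℕ} {e : Exp n} (h : e.IsValue) : ∃ v, e = .val v := by
  cases e with
  | val v => exact ⟨v, rfl⟩
  | _ => exact h.elim

theorem IsFocus.not_isValue_plug {a : Exp 0} (ha : IsFocus a) (E : ECtx 0) :
    ¬ (E.plug a).IsValue := fun h => by
  obtain ⟨v, hv⟩ := h.exists_eq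
  exact ha.plug_ne_val _ _ hv

theorem IsStuck.not_isValue {e : Exp 0} (h : IsStuck e) : ¬ e.IsValue := by
  obtain ⟨E, p, b, -, rfl⟩ := h
  exact IsFocus.not_isValue_plug (.grab _ _) E

/-- `ReachN P n e`: some reduction sequence of length `n` from `e` ends in `P`. -/
def ReachN (P : Exp 0 → Prop) : ℕ → Exp 0 → Prop
  | 0, e => P e
  | n + 1, e => ∃ e', Red e e' ∧ ReachN P n e'

/-- Some reduction sequence from `e` ends in `P`. -/
def Reach (P : Exp 0 → Prop) (e : Exp 0) : Prop := ∃ n, ReachN P n e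

section Reach

variable {P : Exp 0 → Prop}

theorem reach_iff {e : Exp 0} : Reach P e ↔ ∃ e', RedStar e e' ∧ P e' := by
  constructor
  · rintro ⟨n, h⟩
    induction n generalizing e with
    | zero => exact ⟨e, .refl, h⟩
    | succ n ih =>
      obtain ⟨e', h₁, h₂⟩ := h
      obtain ⟨e'', h₃, h₄⟩ := ih h₂
      exact ⟨e'', .head h₁ h₃, h₄⟩
  · rintro ⟨e', h₁, h₂⟩
    induction h₁ using Relation.ReflTransGen.head_induction_on with
    | refl => exact ⟨0, h₂⟩
    | head h₁ _ ih => exact ih.elim fun n hn => ⟨n + 1, _, h₁, hn⟩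

theorem ReachN.mapPrompts (hP : Observable P) {n : ℕ} {e : Exp 0} (h : ReachN P n e)
    {f : Prompt → Prompt} (hf : Function.Injective f) : ReachN P n (e.mapPrompts f) := by
  induction n generalizing e with
  | zero => exact hP.mapPrompts hf h
  | succ n ih =>
    obtain ⟨e', h₁, h₂⟩ := h
    exact ⟨_, h₁.mapPrompts hf, ih h₂⟩

/-- A reduct reaches an observable in fewer steps, by whichever reduction it arises: the
reduct on the way to the observable differs only by a permutation of prompts. -/
theorem ReachN.of_red (hP : Observable P) {n : ℕ} {e e' : Exp 0} (hr : Red e e')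
    (h : ReachN P n e) : ∃ m < n, ReachN P m e' := by
  cases n with
  | zero => exact absurd hr (hP.isNormal h e')
  | succ n =>
    obtain ⟨e'', h₁, h₂⟩ := h
    obtain ⟨π, rfl⟩ := h₁.unique hr
    exact ⟨n, n.lt_succ_self, h₂.mapPrompts hP π.injective⟩

theorem ReachN.of_transGen (hP : Observable P) {n : ℕ} {e e' : Exp 0}
    (hr : Relation.TransGen Red e e') (h : ReachN P n e) : ∃ m < n, ReachN P m e' := by
  induction hr with
  | single hr => exact h.of_red hP hr
  | tail _ hr ih =>
    obtain ⟨m, hm, h'⟩ := ih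
    obtain ⟨k, hk, h''⟩ := h'.of_red hP hr
    exact ⟨k, hk.trans hm, h''⟩

/-- Observables do not change along reduction. -/
theorem Red.reach_iff (hP : Observable P) {e e' : Exp 0} (hr : Red e e') :
    Reach P e ↔ Reach P e' :=
  ⟨fun ⟨_, h⟩ => (h.of_red hP hr).imp fun _ => And.right, fun ⟨n, h⟩ => ⟨n + 1, e', hr, h⟩⟩

theorem RedStar.reach_iff (hP : Observable P) {e e' : Exp 0} (hr : RedStar e e') :
    Reach P e ↔ Reach P e' := by
  induction hr with
  | refl => rfl
  | tail _ hr ih => exact ih.trans (hr.reach_iff hP)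

theorem Reach.of_isNormal {e : Exp 0} (he : IsNormal e) (h : Reach P e) : P e := by
  obtain ⟨n, h⟩ := h
  cases n with
  | zero => exact h
  | succ n =>
    obtain ⟨e', h, -⟩ := h
    exact absurd h (he e')

theorem Reach.not_diverges (hP : Observable P) {e : Exp 0} (h : Reach P e) : ¬ Diverges e := by
  rintro ⟨f, rfl, hf⟩
  obtain ⟨n, h⟩ := h
  have key : ∀ n k, ¬ ReachN P n (f k) := by
    intro n
    induction n using Nat.strong_induction_on with
    | _ n ih =>
      intro k h
      obtain ⟨m, hm, h'⟩ := h.of_red hP (hf k)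
      exact ih m hm _ h'
  exact key n 0 h

end Reach

theorem IsError.not_reach_isValue {e : Exp 0} (h : IsError e) : ¬ Reach Exp.IsValue e :=
  fun h' => h.2.1 (h'.of_isNormal h.1)

theorem IsError.not_reach_isStuck {e : Exp 0} (h : IsError e) : ¬ Reach IsStuck e :=
  fun h' => h.2.2 (h'.of_isNormal h.1)

/-- Evaluation ends in a value, ends in a control-stuck expression, or fails, and these cases
exclude each other. -/
theorem divOrErr_iff {e : Exp 0} :
    DivOrErr e ↔ ¬ Reach Exp.IsValue e ∧ ¬ Reach IsStuck e := by
  constructor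
  · rintro (h | ⟨e', h, he'⟩)
    · exact ⟨fun h' => h'.not_diverges observable_isValue h,
        fun h' => h'.not_diverges observable_isStuck h⟩
    · rw [h.reach_iff observable_isValue, h.reach_iff observable_isStuck]
      exact ⟨he'.not_reach_isValue, he'.not_reach_isStuck⟩
  · rintro ⟨h₁, h₂⟩
    -- without a normal form among the reducts, every reduct can be reduced further
    by_cases hn : ∃ e', RedStar e e' ∧ IsNormal e'
    · obtain ⟨e', hr, hn⟩ := hn
      exact .inr ⟨e', hr, hn, fun h => h₁ (reach_iff.2 ⟨e', hr, h⟩),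
        fun h => h₂ (reach_iff.2 ⟨e', hr, h⟩)⟩
    · have hstep : ∀ x : {e' // RedStar e e'}, ∃ y : {e' // RedStar e e'}, Red x.1 y.1 := by
        rintro ⟨x, hx⟩
        have : ¬ IsNormal x := fun h => hn ⟨x, hx, h⟩
        simp only [IsNormal, not_forall, not_not] at this
        exact this.elim fun y hy => ⟨⟨y, hx.tail hy⟩, hy⟩
      choose next hnext using hstep
      refine .inl ⟨fun k => (next^[k] ⟨e, .refl⟩).1, rfl, fun k => ?_⟩
      simp only [Function.iterate_succ_apply']
      exact hnext _

/-- Equality of the observables; failure is the remaining case. -/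
def SameObs (e₁ e₂ : Exp 0) : Prop :=
  ∀ P, (P = Exp.IsValue ∨ P = IsStuck) → (Reach P e₁ ↔ Reach P e₂)

theorem observable_of_eq {P : Exp 0 → Prop} (h : P = Exp.IsValue ∨ P = IsStuck) :
    Observable P := by
  rcases h with rfl | rfl
  · exact observable_isValue
  · exact observable_isStuck

/-- The third clause of the equivalence of observable actions is implied by the other two. -/
theorem obsEq_iff {e₁ e₂ : Exp 0} : ObsEq e₁ e₂ ↔ SameObs e₁ e₂ := by
  have hval : ∀ e : Exp 0, (∃ v, RedStar e (.val v)) ↔ Reach Exp.IsValue e := fun e => by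
    rw [reach_iff]
    constructor
    · rintro ⟨v, hv⟩; exact ⟨_, hv, trivial⟩
    · rintro ⟨e', h, he'⟩
      obtain ⟨v, rfl⟩ := he'.exists_eq
      exact ⟨v, h⟩
  simp only [ObsEq, hval, ← reach_iff, divOrErr_iff]
  constructor
  · rintro ⟨h₁, h₂, -⟩ P (rfl | rfl)
    · exact h₁
    · exact h₂
  · intro h
    rw [h _ (.inl rfl), h _ (.inr rfl)]
    exact ⟨Iff.rfl, Iff.rfl, Iff.rfl⟩

theorem SameObs.refl (e : Exp 0) : SameObs e e := fun _ _ => Iff.rfl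

theorem SameObs.symm {e₁ e₂ : Exp 0} (h : SameObs e₁ e₂) : SameObs e₂ e₁ :=
  fun P hP => (h P hP).symm

theorem SameObs.trans {e₁ e₂ e₃ : Exp 0} (h : SameObs e₁ e₂) (h' : SameObs e₂ e₃) :
    SameObs e₁ e₃ :=
  fun P hP => (h P hP).trans (h' P hP)

theorem RedStar.sameObs {e₁ e₂ : Exp 0} (h : RedStar e₁ e₂) : SameObs e₁ e₂ :=
  fun _ hP => h.reach_iff (observable_of_eq hP)

theorem Red.sameObs {e₁ e₂ : Exp 0} (h : Red e₁ e₂) : SameObs e₁ e₂ :=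
  RedStar.sameObs (.single h)

/-- The foci that do not reduce in any context and are not grabs at a prompt. -/
def IsBad (a : Exp 0) : Prop :=
  IsFocus a ∧ (∀ E e, ¬ Contract E a e) ∧ ∀ p b, a ≠ .grab (.prompt p) b

theorem IsBad.isError {a : Exp 0} (h : IsBad a) (E : ECtx 0) : IsError (E.plug a) := by
  refine ⟨fun e he => h.2.1 _ _ (he.contract h.1), h.1.not_isValue_plug E, ?_⟩
  rintro ⟨E', p, b, -, he⟩
  exact h.2.2 p b (h.1.decomp_unique (.grab _ _) _ _ he).2

theorem isBad_app {v w : Val 0} (h : ∀ b, v ≠ .lam b) : IsBad (.app (.val v) (.val w)) :=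
  ⟨.app v w, fun _ _ hc => by cases hc; exact h _ rfl, by simp⟩

theorem isBad_reset {v : Val 0} {e : Exp 0} (h : ∀ p, v ≠ .prompt p) : IsBad (.reset v e) :=
  ⟨.badReset v e h, fun _ _ hc => by cases hc; exact h _ rfl, by simp⟩

theorem isBad_grab {v : Val 0} {e : Exp 1} (h : ∀ p, v ≠ .prompt p) : IsBad (.grab v e) :=
  ⟨.grab v e, fun _ _ hc => by cases hc; exact h _ rfl, fun p b he => by
    cases he; exact h p rfl⟩

theorem isBad_push {v : Val 0} {e : Exp 0} (h : ∀ E, v ≠ .cont E) : IsBad (.push v e) :=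
  ⟨.push v e, fun _ _ hc => by cases hc; exact h _ rfl, by simp⟩

/-! ### Reduction avoiding a set of prompts -/

/-- Reduction where the prompt generated, if any, is not in `S`. -/
def RedFresh (S : Finset Prompt) (e e' : Exp 0) : Prop :=
  Red e e' ∧ FreshFor e'.prompts e.prompts S

/-- Many-step reduction where the prompts generated are not in `S`. -/
abbrev RedsFresh (S : Finset Prompt) : Exp 0 → Exp 0 → Prop := Relation.ReflTransGen (RedFresh S)

theorem FreshFor.mono {a b c c' : Finset Prompt} (h : FreshFor a b c) (hc : c' ⊆ c) :
    FreshFor a b c' := by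
  simp only [FreshFor] at *
  grind

theorem RedsFresh.mono {S S' : Finset Prompt} (hS : S ⊆ S') {e e' : Exp 0}
    (h : RedsFresh S' e e') : RedsFresh S e e' :=
  Relation.ReflTransGen.mono (fun _ _ (h : RedFresh S' _ _) => ⟨h.1, h.2.mono hS⟩) _ _ h

theorem RedsFresh.redStar {S : Finset Prompt} {e e' : Exp 0} (h : RedsFresh S e e') :
    RedStar e e' :=
  Relation.ReflTransGen.mono (fun _ _ (h : RedFresh S _ _) => h.1) _ _ h

theorem RedFresh.plug {S : Finset Prompt} {e e' : Exp 0} (h : RedFresh S e e') {E : ECtx 0}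
    (hE : E.prompts ⊆ S) : RedFresh S (E.plug e) (E.plug e') := by
  refine ⟨.compat _ _ _ h.1 (h.2.mono hE), ?_⟩
  have := h.2
  simp only [FreshFor, ECtx.plug_prompts] at *
  grind

theorem RedsFresh.plug {S : Finset Prompt} {e e' : Exp 0} (h : RedsFresh S e e') {E : ECtx 0}
    (hE : E.prompts ⊆ S) : RedsFresh S (E.plug e) (E.plug e') :=
  Relation.ReflTransGen.lift E.plug (fun _ _ (h : RedFresh S _ _) => h.plug hE) _ _ h

theorem freshFor_inst {p : Prompt} (b : Exp 1) {S : Finset Prompt}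
    (hp : p ∉ S) : FreshFor (b.inst (.prompt p)).prompts b.prompts S := by
  have := b.inst_prompts_subset (.prompt p)
  simp only [FreshFor, Val.prompts] at *
  grind

/-- Every reducible expression has a reduct whose new prompts avoid a given finite set. -/
theorem Red.exists_redFresh {e e' : Exp 0} (h : Red e e') (S : Finset Prompt) :
    ∃ e'', RedFresh S e e'' := by
  obtain ⟨E, a, rfl, hc⟩ := red_iff_contract.1 h
  have key : ∀ {e : Exp 0}, Contract E a e → e.prompts ⊆ E.prompts ∪ a.prompts →
      ∃ e'', RedFresh S (E.plug a) e'' := fun {e} h hs =>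
    ⟨e, h.red, .of_subset _ (by rwa [ECtx.plug_prompts])⟩
  cases hc with
  | beta _ b v =>
    refine key (.beta _ b v) ?_
    rw [ECtx.plug_prompts]
    exact Finset.union_subset_union_right (b.inst_prompts_subset v)
  | ret _ p v =>
    refine key (.ret _ p v) ?_
    rw [ECtx.plug_prompts]
    exact Finset.union_subset_union_right Finset.subset_union_right
  | capture E₁ E₂ p b hp =>
    refine key (.capture _ _ p b hp) ?_
    have := capture_prompts_subset E₂ p b
    simp only [ECtx.plug_prompts, ECtx.comp_prompts, ECtx.prompts, Exp.prompts, Val.prompts] at *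
    grind
  | throw _ E' e =>
    refine key (.throw _ E' e) ?_
    rw [ECtx.plug_prompts, ECtx.plug_prompts]
    exact subset_rfl
  | gen _ p b hp hE =>
    obtain ⟨q, hq⟩ := exists_prompt_notMem (b.prompts ∪ E.prompts ∪ S)
    simp only [Finset.mem_union, not_or] at hq
    refine ⟨_, (Contract.gen E q b hq.1.1 (freshFor_inst b hq.1.2)).red, ?_⟩
    have := freshFor_inst b hq.2
    simp only [FreshFor, ECtx.plug_prompts, Exp.prompts] at *
    grind

theorem Reach.exists_redsFresh {P : Exp 0 → Prop} (hP : Observable P) {e : Exp 0}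
    (h : Reach P e) (S : Finset Prompt) : ∃ e', RedsFresh S e e' ∧ P e' := by
  obtain ⟨n, h⟩ := h
  induction n using Nat.strong_induction_on generalizing e with
  | _ n ih =>
    cases n with
    | zero => exact ⟨e, .refl, h⟩
    | succ n =>
      have h' := h
      obtain ⟨e', hr, -⟩ := h'
      obtain ⟨e'', hr'⟩ := hr.exists_redFresh S
      obtain ⟨m, hm, h''⟩ := h.of_red hP hr'.1
      obtain ⟨e₁, h₁, h₂⟩ := ih m hm h''
      exact ⟨e₁, .head hr' h₁, h₂⟩

/-! ### The context closure of a relation on closed values -/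

/-- Values that are syntactically a λ-abstraction or a continuation; unlike variables, they
cannot become prompts by substitution. -/
def Val.IsInert {n : ℕ} : Val n → Prop
  | .var _ => False
  | .lam _ => True
  | .prompt _ => False
  | .cont _ => True

theorem Val.IsInert.rename {n m : ℕ} {v : Val n} (h : v.IsInert) (ρ : Fin n → Fin m) :
    (v.rename ρ).IsInert := by
  cases v <;> exact h

theorem Val.IsInert.subst {n m : ℕ} {v : Val n} (h : v.IsInert) (σ : Fin n → Val m) :
    (v.subst σ).IsInert := by
  cases v <;> first | exact h | exact h.elim

theorem Val.IsInert.ne_prompt {n : ℕ} {v : Val n} (h : v.IsInert) (p : Prompt) :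
    v ≠ .prompt p := by
  rintro rfl; exact h

/-- An expression that evaluates to `⌜E⌝` by capturing `E` up to a new prompt. -/
def ECtx.reify {n : ℕ} (E : ECtx n) : Exp n :=
  .fresh (.reset (.var 0) ((E.rename Fin.succ).plug (.grab (.var 0) (.val (.var 0)))))

theorem ECtx.reify_rename {n m : ℕ} (E : ECtx n) (ρ : Fin n → Fin m) :
    E.reify.rename ρ = (E.rename ρ).reify := by
  simp only [ECtx.reify, Exp.rename, Val.rename, ECtx.plug_rename, ECtx.rename_succ_rename,
    liftRen_zero]

theorem ECtx.reify_subst {n m : ℕ} (E : ECtx n) (σ : Fin n → Val m) :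
    E.reify.subst σ = (E.subst σ).reify := by
  simp only [ECtx.reify, Exp.subst, Val.subst, ECtx.plug_subst, ECtx.rename_succ_subst,
    liftSub_zero]

mutual

/-- The context closure of a relation `H` on closed values: two expressions are related if they
arise from one promptless multi-hole context by filling its holes with pairs in `H`, where
related continuations may also be plugged, and related prompts may also delimit.

With the flag `adm`, expressions are moreover identified with their reducts for two kinds of
redexes that terminate without any interaction with the surrounding context (`push ⌜E⌝ e` and
`reify E`), and so are delimiters, respectively grabs, at values that can never be prompts. -/
inductive CongExp (adm : Prop) (H : Val 0 → Val 0 → Prop) : {n : ℕ} → Exp n → Exp n → Prop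
  | val {n : ℕ} {v w : Val n} (hv : CongVal adm H v w) : CongExp adm H (.val v) (.val w)
  | app {n : ℕ} {e₁ e₂ f₁ f₂ : Exp n} (h₁ : CongExp adm H e₁ f₁) (h₂ : CongExp adm H e₂ f₂) :
      CongExp adm H (.app e₁ e₂) (.app f₁ f₂)
  | fresh {n : ℕ} {e f : Exp (n + 1)} (h : CongExp adm H e f) :
      CongExp adm H (.fresh e) (.fresh f)
  | reset {n : ℕ} {v w : Val n} {e f : Exp n} (hv : CongVal adm H v w) (h : CongExp adm H e f) :
      CongExp adm H (.reset v e) (.reset w f)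
  | grab {n : ℕ} {v w : Val n} {e f : Exp (n + 1)} (hv : CongVal adm H v w)
      (h : CongExp adm H e f) : CongExp adm H (.grab v e) (.grab w f)
  | push {n : ℕ} {v w : Val n} {e f : Exp n} (hv : CongVal adm H v w) (h : CongExp adm H e f) :
      CongExp adm H (.push v e) (.push w f)
  | star {n : ℕ} {E F : ECtx 0} {e f : Exp n} (hE : H (.cont E) (.cont F))
      (h : CongExp adm H e f) : CongExp adm H (E.weaken.plug e) (F.weaken.plug f)
  | throwL {n : ℕ} {E F : ECtx n} {e f : Exp n} (ha : adm) (hE : CongCtx adm H E F)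
      (h : CongExp adm H e f) : CongExp adm H (.push (.cont E) e) (F.plug f)
  | throwR {n : ℕ} {E F : ECtx n} {e f : Exp n} (ha : adm) (hE : CongCtx adm H E F)
      (h : CongExp adm H e f) : CongExp adm H (E.plug e) (.push (.cont F) f)
  | reifyL {n : ℕ} {E F : ECtx n} (ha : adm) (hE : CongCtx adm H E F) :
      CongExp adm H E.reify (.val (.cont F))
  | reifyR {n : ℕ} {E F : ECtx n} (ha : adm) (hE : CongCtx adm H E F) :
      CongExp adm H (.val (.cont E)) F.reify
  | badReset {n : ℕ} {v w : Val n} {e f : Exp n} (ha : adm) (hv : v.IsInert) (hw : w.IsInert) :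
      CongExp adm H (.reset v e) (.reset w f)
  | badGrab {n : ℕ} {v w : Val n} {e f : Exp (n + 1)} (ha : adm) (hv : v.IsInert)
      (hw : w.IsInert) : CongExp adm H (.grab v e) (.grab w f)

/-- The context closure on values. -/
inductive CongVal (adm : Prop) (H : Val 0 → Val 0 → Prop) : {n : ℕ} → Val n → Val n → Prop
  | var {n : ℕ} (x : Fin n) : CongVal adm H (.var x) (.var x)
  | lam {n : ℕ} {e f : Exp (n + 1)} (h : CongExp adm H e f) : CongVal adm H (.lam e) (.lam f)
  | cont {n : ℕ} {E F : ECtx n} (hE : CongCtx adm H E F) : CongVal adm H (.cont E) (.cont F)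
  | hole {n : ℕ} {v w : Val 0} (h : H v w) : CongVal adm H (v.weaken : Val n) w.weaken

/-- The context closure on evaluation contexts. -/
inductive CongCtx (adm : Prop) (H : Val 0 → Val 0 → Prop) : {n : ℕ} → ECtx n → ECtx n → Prop
  | hole {n : ℕ} : CongCtx adm H (.hole : ECtx n) .hole
  | appL {n : ℕ} {E F : ECtx n} {e f : Exp n} (hE : CongCtx adm H E F) (h : CongExp adm H e f) :
      CongCtx adm H (.appL E e) (.appL F f)
  | appR {n : ℕ} {v w : Val n} {E F : ECtx n} (hv : CongVal adm H v w) (hE : CongCtx adm H E F) :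
      CongCtx adm H (.appR v E) (.appR w F)
  | reset {n : ℕ} {p q : Prompt} {E F : ECtx n} (hp : H (.prompt p) (.prompt q))
      (hE : CongCtx adm H E F) : CongCtx adm H (.reset p E) (.reset q F)
  | star {n : ℕ} {E₀ F₀ : ECtx 0} {E F : ECtx n} (h₀ : H (.cont E₀) (.cont F₀))
      (hE : CongCtx adm H E F) : CongCtx adm H (E₀.weaken.comp E) (F₀.weaken.comp F)

end

section Congruence

variable {adm : Prop} {H H' : Val 0 → Val 0 → Prop}

mutual

theorem CongExp.rename : ∀ {n m : ℕ} (ρ : Fin n → Fin m) {e f : Exp n}, CongExp adm H e f →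
    CongExp adm H (e.rename ρ) (f.rename ρ)
  | _, _, ρ, _, _, .val hv => .val (hv.rename ρ)
  | _, _, ρ, _, _, .app h₁ h₂ => .app (h₁.rename ρ) (h₂.rename ρ)
  | _, _, ρ, _, _, .fresh h => .fresh (h.rename (liftRen ρ))
  | _, _, ρ, _, _, .reset hv h => .reset (hv.rename ρ) (h.rename ρ)
  | _, _, ρ, _, _, .grab hv h => .grab (hv.rename ρ) (h.rename (liftRen ρ))
  | _, _, ρ, _, _, .push hv h => .push (hv.rename ρ) (h.rename ρ)
  | _, _, ρ, _, _, .star hE h => by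
    rw [ECtx.plug_rename, ECtx.plug_rename, ECtx.weaken_rename, ECtx.weaken_rename]
    exact .star hE (h.rename ρ)
  | _, _, ρ, _, _, .throwL ha hE h => by
    rw [ECtx.plug_rename]; exact .throwL ha (hE.rename ρ) (h.rename ρ)
  | _, _, ρ, _, _, .throwR ha hE h => by
    rw [ECtx.plug_rename]; exact .throwR ha (hE.rename ρ) (h.rename ρ)
  | _, _, ρ, _, _, .reifyL ha hE => by
    rw [ECtx.reify_rename]; exact .reifyL ha (hE.rename ρ)
  | _, _, ρ, _, _, .reifyR ha hE => by
    rw [ECtx.reify_rename]; exact .reifyR ha (hE.rename ρ)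
  | _, _, ρ, _, _, .badReset ha hv hw => .badReset ha (hv.rename ρ) (hw.rename ρ)
  | _, _, ρ, _, _, .badGrab ha hv hw => .badGrab ha (hv.rename ρ) (hw.rename ρ)

theorem CongVal.rename : ∀ {n m : ℕ} (ρ : Fin n → Fin m) {v w : Val n}, CongVal adm H v w →
    CongVal adm H (v.rename ρ) (w.rename ρ)
  | _, _, ρ, _, _, .var x => .var (ρ x)
  | _, _, ρ, _, _, .lam h => .lam (h.rename (liftRen ρ))
  | _, _, ρ, _, _, .cont hE => .cont (hE.rename ρ)
  | _, _, ρ, _, _, .hole h => by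
    rw [Val.weaken_rename, Val.weaken_rename]; exact .hole h

theorem CongCtx.rename : ∀ {n m : ℕ} (ρ : Fin n → Fin m) {E F : ECtx n}, CongCtx adm H E F →
    CongCtx adm H (E.rename ρ) (F.rename ρ)
  | _, _, _, _, _, .hole => .hole
  | _, _, ρ, _, _, .appL hE h => .appL (hE.rename ρ) (h.rename ρ)
  | _, _, ρ, _, _, .appR hv hE => .appR (hv.rename ρ) (hE.rename ρ)
  | _, _, ρ, _, _, .reset hp hE => .reset hp (hE.rename ρ)
  | _, _, ρ, _, _, .star h₀ hE => by
    rw [ECtx.comp_rename, ECtx.comp_rename, ECtx.weaken_rename, ECtx.weaken_rename]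
    exact .star h₀ (hE.rename ρ)

end

theorem CongVal.liftSub {n m : ℕ} {σ τ : Fin n → Val m} (h : ∀ i, CongVal adm H (σ i) (τ i))
    (i : Fin (n + 1)) : CongVal adm H (liftSub σ i) (liftSub τ i) := by
  cases i using Fin.cases with
  | zero => exact .var 0
  | succ i => exact (h i).rename Fin.succ

mutual

theorem CongExp.subst : ∀ {n m : ℕ} {σ τ : Fin n → Val m} {e f : Exp n}, CongExp adm H e f →
    (∀ i, CongVal adm H (σ i) (τ i)) → CongExp adm H (e.subst σ) (f.subst τ)
  | _, _, _, _, _, _, .val hv, hσ => .val (hv.subst hσ)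
  | _, _, _, _, _, _, .app h₁ h₂, hσ => .app (h₁.subst hσ) (h₂.subst hσ)
  | _, _, _, _, _, _, .fresh h, hσ => .fresh (h.subst (CongVal.liftSub hσ))
  | _, _, _, _, _, _, .reset hv h, hσ => .reset (hv.subst hσ) (h.subst hσ)
  | _, _, _, _, _, _, .grab hv h, hσ => .grab (hv.subst hσ) (h.subst (CongVal.liftSub hσ))
  | _, _, _, _, _, _, .push hv h, hσ => .push (hv.subst hσ) (h.subst hσ)
  | _, _, _, _, _, _, .star hE h, hσ => by
    rw [ECtx.plug_subst, ECtx.plug_subst, ECtx.weaken_subst, ECtx.weaken_subst]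
    exact .star hE (h.subst hσ)
  | _, _, _, _, _, _, .throwL ha hE h, hσ => by
    rw [ECtx.plug_subst]; exact .throwL ha (hE.subst hσ) (h.subst hσ)
  | _, _, _, _, _, _, .throwR ha hE h, hσ => by
    rw [ECtx.plug_subst]; exact .throwR ha (hE.subst hσ) (h.subst hσ)
  | _, _, _, _, _, _, .reifyL ha hE, hσ => by
    rw [ECtx.reify_subst]; exact .reifyL ha (hE.subst hσ)
  | _, _, _, _, _, _, .reifyR ha hE, hσ => by
    rw [ECtx.reify_subst]; exact .reifyR ha (hE.subst hσ)
  | _, _, _, _, _, _, .badReset ha hv hw, _ => .badReset ha (hv.subst _) (hw.subst _)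
  | _, _, _, _, _, _, .badGrab ha hv hw, _ => .badGrab ha (hv.subst _) (hw.subst _)

theorem CongVal.subst : ∀ {n m : ℕ} {σ τ : Fin n → Val m} {v w : Val n}, CongVal adm H v w →
    (∀ i, CongVal adm H (σ i) (τ i)) → CongVal adm H (v.subst σ) (w.subst τ)
  | _, _, _, _, _, _, .var x, hσ => hσ x
  | _, _, _, _, _, _, .lam h, hσ => .lam (h.subst (CongVal.liftSub hσ))
  | _, _, _, _, _, _, .cont hE, hσ => .cont (hE.subst hσ)
  | _, _, _, _, _, _, .hole h, _ => by
    rw [Val.weaken_subst, Val.weaken_subst]; exact .hole h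

theorem CongCtx.subst : ∀ {n m : ℕ} {σ τ : Fin n → Val m} {E F : ECtx n}, CongCtx adm H E F →
    (∀ i, CongVal adm H (σ i) (τ i)) → CongCtx adm H (E.subst σ) (F.subst τ)
  | _, _, _, _, _, _, .hole, _ => .hole
  | _, _, _, _, _, _, .appL hE h, hσ => .appL (hE.subst hσ) (h.subst hσ)
  | _, _, _, _, _, _, .appR hv hE, hσ => .appR (hv.subst hσ) (hE.subst hσ)
  | _, _, _, _, _, _, .reset hp hE, hσ => .reset hp (hE.subst hσ)
  | _, _, _, _, _, _, .star h₀ hE, hσ => by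
    rw [ECtx.comp_subst, ECtx.comp_subst, ECtx.weaken_subst, ECtx.weaken_subst]
    exact .star h₀ (hE.subst hσ)

end

theorem CongExp.inst {n : ℕ} {e f : Exp (n + 1)} {v w : Val n} (h : CongExp adm H e f)
    (hv : CongVal adm H v w) : CongExp adm H (e.inst v) (f.inst w) :=
  h.subst fun i => by
    cases i using Fin.cases with
    | zero => exact hv
    | succ i => exact .var i

theorem CongVal.prompt {n : ℕ} {p q : Prompt} (h : H (.prompt p) (.prompt q)) :
    CongVal adm H (.prompt p : Val n) (.prompt q) :=
  CongVal.hole h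

theorem CongCtx.plug : ∀ {n : ℕ} {E F : ECtx n} {e f : Exp n}, CongCtx adm H E F →
    CongExp adm H e f → CongExp adm H (E.plug e) (F.plug f)
  | _, _, _, _, _, .hole, h => h
  | _, _, _, _, _, .appL hE h', h => .app (hE.plug h) h'
  | _, _, _, _, _, .appR hv hE, h => .app (.val hv) (hE.plug h)
  | _, _, _, _, _, .reset hp hE, h => .reset (.prompt hp) (hE.plug h)
  | _, _, _, _, _, .star h₀ hE, h => by
    rw [ECtx.comp_plug, ECtx.comp_plug]
    exact .star h₀ (hE.plug h)

theorem CongCtx.comp : ∀ {n : ℕ} {E F E' F' : ECtx n}, CongCtx adm H E F →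
    CongCtx adm H E' F' → CongCtx adm H (E.comp E') (F.comp F')
  | _, _, _, _, _, .hole, h => h
  | _, _, _, _, _, .appL hE h', h => .appL (hE.comp h) h'
  | _, _, _, _, _, .appR hv hE, h => .appR hv (hE.comp h)
  | _, _, _, _, _, .reset hp hE, h => .reset hp (hE.comp h)
  | _, _, _, _, _, .star h₀ hE, h => by
    rw [ECtx.comp_assoc, ECtx.comp_assoc]
    exact .star h₀ (hE.comp h)

mutual

theorem CongExp.mono (hH : ∀ v w, H v w → H' v w) : ∀ {n : ℕ} {e f : Exp n},
    CongExp adm H e f → CongExp adm H' e f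
  | _, _, _, .val hv => .val (hv.mono hH)
  | _, _, _, .app h₁ h₂ => .app (h₁.mono hH) (h₂.mono hH)
  | _, _, _, .fresh h => .fresh (h.mono hH)
  | _, _, _, .reset hv h => .reset (hv.mono hH) (h.mono hH)
  | _, _, _, .grab hv h => .grab (hv.mono hH) (h.mono hH)
  | _, _, _, .push hv h => .push (hv.mono hH) (h.mono hH)
  | _, _, _, .star hE h => .star (hH _ _ hE) (h.mono hH)
  | _, _, _, .throwL ha hE h => .throwL ha (hE.mono hH) (h.mono hH)
  | _, _, _, .throwR ha hE h => .throwR ha (hE.mono hH) (h.mono hH)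
  | _, _, _, .reifyL ha hE => .reifyL ha (hE.mono hH)
  | _, _, _, .reifyR ha hE => .reifyR ha (hE.mono hH)
  | _, _, _, .badReset ha hv hw => .badReset ha hv hw
  | _, _, _, .badGrab ha hv hw => .badGrab ha hv hw

theorem CongVal.mono (hH : ∀ v w, H v w → H' v w) : ∀ {n : ℕ} {v w : Val n},
    CongVal adm H v w → CongVal adm H' v w
  | _, _, _, .var x => .var x
  | _, _, _, .lam h => .lam (h.mono hH)
  | _, _, _, .cont hE => .cont (hE.mono hH)
  | _, _, _, .hole h => .hole (hH _ _ h)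

theorem CongCtx.mono (hH : ∀ v w, H v w → H' v w) : ∀ {n : ℕ} {E F : ECtx n},
    CongCtx adm H E F → CongCtx adm H' E F
  | _, _, _, .hole => .hole
  | _, _, _, .appL hE h => .appL (hE.mono hH) (h.mono hH)
  | _, _, _, .appR hv hE => .appR (hv.mono hH) (hE.mono hH)
  | _, _, _, .reset hp hE => .reset (hH _ _ hp) (hE.mono hH)
  | _, _, _, .star h₀ hE => .star (hH _ _ h₀) (hE.mono hH)

end

mutual

theorem CongExp.symm (hH : ∀ v w, H v w → H' w v) : ∀ {n : ℕ} {e f : Exp n},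
    CongExp adm H e f → CongExp adm H' f e
  | _, _, _, .val hv => .val (hv.symm hH)
  | _, _, _, .app h₁ h₂ => .app (h₁.symm hH) (h₂.symm hH)
  | _, _, _, .fresh h => .fresh (h.symm hH)
  | _, _, _, .reset hv h => .reset (hv.symm hH) (h.symm hH)
  | _, _, _, .grab hv h => .grab (hv.symm hH) (h.symm hH)
  | _, _, _, .push hv h => .push (hv.symm hH) (h.symm hH)
  | _, _, _, .star hE h => .star (hH _ _ hE) (h.symm hH)
  | _, _, _, .throwL ha hE h => .throwR ha (hE.symm hH) (h.symm hH)
  | _, _, _, .throwR ha hE h => .throwL ha (hE.symm hH) (h.symm hH)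
  | _, _, _, .reifyL ha hE => .reifyR ha (hE.symm hH)
  | _, _, _, .reifyR ha hE => .reifyL ha (hE.symm hH)
  | _, _, _, .badReset ha hv hw => .badReset ha hw hv
  | _, _, _, .badGrab ha hv hw => .badGrab ha hw hv

theorem CongVal.symm (hH : ∀ v w, H v w → H' w v) : ∀ {n : ℕ} {v w : Val n},
    CongVal adm H v w → CongVal adm H' w v
  | _, _, _, .var x => .var x
  | _, _, _, .lam h => .lam (h.symm hH)
  | _, _, _, .cont hE => .cont (hE.symm hH)
  | _, _, _, .hole h => .hole (hH _ _ h)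

theorem CongCtx.symm (hH : ∀ v w, H v w → H' w v) : ∀ {n : ℕ} {E F : ECtx n},
    CongCtx adm H E F → CongCtx adm H' F E
  | _, _, _, .hole => .hole
  | _, _, _, .appL hE h => .appL (hE.symm hH) (h.symm hH)
  | _, _, _, .appR hv hE => .appR (hv.symm hH) (hE.symm hH)
  | _, _, _, .reset hp hE => .reset (hH _ _ hp) (hE.symm hH)
  | _, _, _, .star h₀ hE => .star (hH _ _ h₀) (hE.symm hH)

end

mutual

theorem CongExp.refl {n : ℕ} : (e : Exp n) → (∀ p ∈ e.prompts, H (.prompt p) (.prompt p)) →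
    CongExp adm H e e
  | .val v, h => .val (CongVal.refl v h)
  | .app e₁ e₂, h => .app (CongExp.refl e₁ fun p hp => h p (Finset.mem_union_left _ hp))
      (CongExp.refl e₂ fun p hp => h p (Finset.mem_union_right _ hp))
  | .fresh e, h => .fresh (CongExp.refl e h)
  | .reset v e, h => .reset (CongVal.refl v fun p hp => h p (Finset.mem_union_left _ hp))
      (CongExp.refl e fun p hp => h p (Finset.mem_union_right _ hp))
  | .grab v e, h => .grab (CongVal.refl v fun p hp => h p (Finset.mem_union_left _ hp))
      (CongExp.refl e fun p hp => h p (Finset.mem_union_right _ hp))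
  | .push v e, h => .push (CongVal.refl v fun p hp => h p (Finset.mem_union_left _ hp))
      (CongExp.refl e fun p hp => h p (Finset.mem_union_right _ hp))

theorem CongVal.refl {n : ℕ} : (v : Val n) → (∀ p ∈ v.prompts, H (.prompt p) (.prompt p)) →
    CongVal adm H v v
  | .var x, _ => .var x
  | .lam e, h => .lam (CongExp.refl e h)
  | .prompt p, h => .prompt (h p (Finset.mem_singleton_self p))
  | .cont E, h => .cont (CongCtx.refl E h)

theorem CongCtx.refl {n : ℕ} : (E : ECtx n) → (∀ p ∈ E.prompts, H (.prompt p) (.prompt p)) →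
    CongCtx adm H E E
  | .hole, _ => .hole
  | .appL E e, h => .appL (CongCtx.refl E fun p hp => h p (Finset.mem_union_left _ hp))
      (CongExp.refl e fun p hp => h p (Finset.mem_union_right _ hp))
  | .appR v E, h => .appR (CongVal.refl v fun p hp => h p (Finset.mem_union_left _ hp))
      (CongCtx.refl E fun p hp => h p (Finset.mem_union_right _ hp))
  | .reset p E, h => .reset (h p (Finset.mem_union_left _ (Finset.mem_singleton_self p)))
      (CongCtx.refl E fun p hp => h p (Finset.mem_union_right _ hp))

end

mutual

theorem CongExp.prompts_subset {S : Finset Prompt} (hS : ∀ v w, H v w → v.prompts ⊆ S) :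
    ∀ {n : ℕ} {e f : Exp n}, CongExp False H e f → e.prompts ⊆ S
  | _, _, _, .val hv => hv.prompts_subset hS
  | _, _, _, .app h₁ h₂ => Finset.union_subset (h₁.prompts_subset hS) (h₂.prompts_subset hS)
  | _, _, _, .fresh h => h.prompts_subset hS
  | _, _, _, .reset hv h => Finset.union_subset (hv.prompts_subset hS) (h.prompts_subset hS)
  | _, _, _, .grab hv h => Finset.union_subset (hv.prompts_subset hS) (h.prompts_subset hS)
  | _, _, _, .push hv h => Finset.union_subset (hv.prompts_subset hS) (h.prompts_subset hS)
  | _, _, _, .star hE h => by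
    rw [ECtx.plug_prompts, ECtx.weaken_prompts]
    exact Finset.union_subset (hS _ _ hE) (h.prompts_subset hS)

theorem CongVal.prompts_subset {S : Finset Prompt} (hS : ∀ v w, H v w → v.prompts ⊆ S) :
    ∀ {n : ℕ} {v w : Val n}, CongVal False H v w → v.prompts ⊆ S
  | _, _, _, .var x => Finset.empty_subset _
  | _, _, _, .lam h => h.prompts_subset hS
  | _, _, _, .cont hE => hE.prompts_subset hS
  | _, _, _, .hole h => by rw [Val.weaken_prompts]; exact hS _ _ h

theorem CongCtx.prompts_subset {S : Finset Prompt} (hS : ∀ v w, H v w → v.prompts ⊆ S) :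
    ∀ {n : ℕ} {E F : ECtx n}, CongCtx False H E F → E.prompts ⊆ S
  | _, _, _, .hole => Finset.empty_subset _
  | _, _, _, .appL hE h => Finset.union_subset (hE.prompts_subset hS) (h.prompts_subset hS)
  | _, _, _, .appR hv hE => Finset.union_subset (hv.prompts_subset hS) (hE.prompts_subset hS)
  | _, _, _, .reset hp hE => Finset.union_subset (hS _ _ hp) (hE.prompts_subset hS)
  | _, _, _, .star h₀ hE => by
    rw [ECtx.comp_prompts, ECtx.weaken_prompts]
    exact Finset.union_subset (hS _ _ h₀) (hE.prompts_subset hS)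

end

/-- A closed instance of the closure on values is a pair of the base relation, or is built by a
value former. -/
theorem CongVal.closed_cases {v w : Val 0} (h : CongVal adm H v w) :
    (∃ b c, v = .lam b ∧ w = .lam c ∧ CongExp adm H b c) ∨
      (∃ E F, v = .cont E ∧ w = .cont F ∧ CongCtx adm H E F) ∨ H v w := by
  cases h with
  | var x => exact x.elim0
  | lam h => exact .inl ⟨_, _, rfl, rfl, h⟩
  | cont hE => exact .inr (.inl ⟨_, _, rfl, rfl, hE⟩)
  | hole h =>
    rw [Val.weaken_self, Val.weaken_self]
    exact .inr (.inr h)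

end Congruence

/-! ### Pairs of environments -/

/-- The relation between the values at equal positions of two environments. -/
def Env.Paired (Γ Δ : Env) (v w : Val 0) : Prop := ∃ i : ℕ, Γ[i]? = some v ∧ Δ[i]? = some w

theorem Env.Paired.append {Γ Δ : Env} {v w : Val 0} (h : Env.Paired Γ Δ v w) (Γ' Δ' : Env) :
    Env.Paired (Γ ++ Γ') (Δ ++ Δ') v w := by
  obtain ⟨i, h₁, h₂⟩ := h
  exact ⟨i, by rw [List.getElem?_append_left (List.getElem?_eq_some_iff.1 h₁).1, h₁],
    by rw [List.getElem?_append_left (List.getElem?_eq_some_iff.1 h₂).1, h₂]⟩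

theorem Env.Paired.symm {Γ Δ : Env} {v w : Val 0} (h : Env.Paired Γ Δ v w) :
    Env.Paired Δ Γ w v :=
  h.imp fun _ => And.symm

theorem Env.mem_prompts {Γ : Env} {p : Prompt} : p ∈ Γ.prompts ↔ ∃ v ∈ Γ, p ∈ v.prompts := by
  induction Γ with
  | nil => simp [Env.prompts]
  | cons v Γ ih =>
    rw [show Env.prompts (v :: Γ) = v.prompts ∪ Env.prompts Γ from rfl]
    simp [ih]

theorem Env.prompts_append (Γ Γ' : Env) : Env.prompts (Γ ++ Γ') = Γ.prompts ∪ Γ'.prompts := by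
  ext p
  simp only [Env.mem_prompts, Finset.mem_union, List.mem_append, or_and_right, exists_or]

theorem Env.Paired.prompts_subset {Γ Δ : Env} {v w : Val 0} (h : Env.Paired Γ Δ v w) :
    v.prompts ⊆ Γ.prompts := by
  obtain ⟨i, h, -⟩ := h
  exact fun p hp => Env.mem_prompts.2 ⟨v, List.mem_of_getElem? h, hp⟩

theorem Env.promptAt_eq_some {Γ : Env} {i : ℕ} {p : Prompt} :
    Γ.promptAt i = some p ↔ Γ[i]? = some (.prompt p) := by
  unfold Env.promptAt
  split <;> simp_all

theorem Env.contAt_eq_some {Γ : Env} {i : ℕ} {E : ECtx 0} :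
    Γ.contAt i = some E ↔ Γ[i]? = some (.cont E) := by
  unfold Env.contAt
  split <;> simp_all

mutual

/-- Related expressions over a pair of environments are the fillings of one context. -/
theorem CongExp.exists_fill {Γ Δ : Env} : ∀ {n : ℕ} {e f : Exp n},
    CongExp False (Env.Paired Γ Δ) e f → ∃ C : MCtx n, C.fill Γ = some e ∧ C.fill Δ = some f
  | _, _, _, .val hv => by
    obtain ⟨V, h₁, h₂⟩ := hv.exists_fill
    exact ⟨.val V, by simp [MCtx.fill, h₁], by simp [MCtx.fill, h₂]⟩
  | _, _, _, .app h h' => by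
    obtain ⟨C, h₁, h₂⟩ := h.exists_fill
    obtain ⟨C', h₁', h₂'⟩ := h'.exists_fill
    exact ⟨.app C C', by simp [MCtx.fill, h₁, h₁'], by simp [MCtx.fill, h₂, h₂']⟩
  | _, _, _, .fresh h => by
    obtain ⟨C, h₁, h₂⟩ := h.exists_fill
    exact ⟨.fresh C, by simp [MCtx.fill, h₁], by simp [MCtx.fill, h₂]⟩
  | _, _, _, .reset hv h => by
    obtain ⟨V, h₁, h₂⟩ := hv.exists_fill
    obtain ⟨C, h₁', h₂'⟩ := h.exists_fill
    exact ⟨.reset V C, by simp [MCtx.fill, h₁, h₁'], by simp [MCtx.fill, h₂, h₂']⟩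
  | _, _, _, .grab hv h => by
    obtain ⟨V, h₁, h₂⟩ := hv.exists_fill
    obtain ⟨C, h₁', h₂'⟩ := h.exists_fill
    exact ⟨.grab V C, by simp [MCtx.fill, h₁, h₁'], by simp [MCtx.fill, h₂, h₂']⟩
  | _, _, _, .push hv h => by
    obtain ⟨V, h₁, h₂⟩ := hv.exists_fill
    obtain ⟨C, h₁', h₂'⟩ := h.exists_fill
    exact ⟨.push V C, by simp [MCtx.fill, h₁, h₁'], by simp [MCtx.fill, h₂, h₂']⟩
  | _, _, _, .star ⟨i, hΓ, hΔ⟩ h => by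
    obtain ⟨C, h₁, h₂⟩ := h.exists_fill
    exact ⟨.star i C, by simp [MCtx.fill, h₁, Env.contAt_eq_some.2 hΓ],
      by simp [MCtx.fill, h₂, Env.contAt_eq_some.2 hΔ]⟩

theorem CongVal.exists_fill {Γ Δ : Env} : ∀ {n : ℕ} {v w : Val n},
    CongVal False (Env.Paired Γ Δ) v w → ∃ V : MVal n, V.fill Γ = some v ∧ V.fill Δ = some w
  | _, _, _, .var x => ⟨.var x, rfl, rfl⟩
  | _, _, _, .lam h => by
    obtain ⟨C, h₁, h₂⟩ := h.exists_fill
    exact ⟨.lam C, by simp [MVal.fill, h₁], by simp [MVal.fill, h₂]⟩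
  | _, _, _, .cont hE => by
    obtain ⟨F, h₁, h₂⟩ := hE.exists_fill
    exact ⟨.cont F, by simp [MVal.fill, h₁], by simp [MVal.fill, h₂]⟩
  | _, _, _, .hole ⟨i, hΓ, hΔ⟩ =>
    ⟨.hole i, by simp [MVal.fill, hΓ], by simp [MVal.fill, hΔ]⟩

theorem CongCtx.exists_fill {Γ Δ : Env} : ∀ {n : ℕ} {E F : ECtx n},
    CongCtx False (Env.Paired Γ Δ) E F → ∃ F' : MECtx n, F'.fill Γ = some E ∧ F'.fill Δ = some F
  | _, _, _, .hole => ⟨.hole, rfl, rfl⟩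
  | _, _, _, .appL hE h => by
    obtain ⟨F, h₁, h₂⟩ := hE.exists_fill
    obtain ⟨C, h₁', h₂'⟩ := h.exists_fill
    exact ⟨.appL F C, by simp [MECtx.fill, h₁, h₁'], by simp [MECtx.fill, h₂, h₂']⟩
  | _, _, _, .appR hv hE => by
    obtain ⟨V, h₁, h₂⟩ := hv.exists_fill
    obtain ⟨F, h₁', h₂'⟩ := hE.exists_fill
    exact ⟨.appR V F, by simp [MECtx.fill, h₁, h₁'], by simp [MECtx.fill, h₂, h₂']⟩
  | _, _, _, .reset ⟨i, hΓ, hΔ⟩ hE => by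
    obtain ⟨F, h₁, h₂⟩ := hE.exists_fill
    exact ⟨.reset i F, by simp [MECtx.fill, h₁, Env.promptAt_eq_some.2 hΓ],
      by simp [MECtx.fill, h₂, Env.promptAt_eq_some.2 hΔ]⟩
  | _, _, _, .star ⟨i, hΓ, hΔ⟩ hE => by
    obtain ⟨F, h₁, h₂⟩ := hE.exists_fill
    exact ⟨.star i F, by simp [MECtx.fill, h₁, Env.contAt_eq_some.2 hΓ],
      by simp [MECtx.fill, h₂, Env.contAt_eq_some.2 hΔ]⟩

end

/-! ### Auxiliary facts on reduction -/

theorem ECtx.surr_subset_prompts {n : ℕ} (E : ECtx n) : E.surr ⊆ E.prompts := by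
  match E with
  | .hole => exact subset_rfl
  | .appL E _ => exact (surr_subset_prompts E).trans Finset.subset_union_left
  | .appR _ E => exact (surr_subset_prompts E).trans Finset.subset_union_right
  | .reset _ E => exact Finset.union_subset_union_right (surr_subset_prompts E)

theorem ECtx.surr_rename {n m : ℕ} (ρ : Fin n → Fin m) (E : ECtx n) :
    (E.rename ρ).surr = E.surr := by
  match E with
  | .hole => rfl
  | .appL E _ => exact surr_rename ρ E
  | .appR _ E => exact surr_rename ρ E
  | .reset _ E => simp only [ECtx.rename, ECtx.surr, surr_rename ρ E]

@[simp] theorem ECtx.weaken_surr {n : ℕ} (E : ECtx 0) : (E.weaken : ECtx n).surr = E.surr :=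
  ECtx.surr_rename _ E

/-- A closed expression is a value, or reduces, or is control-stuck, or is an error. -/
theorem exp_cases (e : Exp 0) : (∃ v, e = .val v) ∨ (∃ e', Red e e') ∨ IsStuck e ∨
    ∃ (E : ECtx 0) (a : Exp 0), IsBad a ∧ e = E.plug a := by
  rcases exists_focus_or_value e with h | ⟨E, a, ha, rfl⟩
  · exact .inl h
  refine .inr ?_
  by_cases hred : ∃ e', Red (E.plug a) e'
  · exact .inl hred
  refine .inr ?_
  by_cases hg : ∃ p b, a = .grab (.prompt p) b
  · obtain ⟨p, b, rfl⟩ := hg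
    refine .inl ⟨E, p, b, fun hp => hred ?_, rfl⟩
    obtain ⟨E₁, E₂, rfl, h₂⟩ := E.exists_split_of_mem_surr hp
    exact ⟨_, (Contract.capture E₁ E₂ p b h₂).red⟩
  · refine .inr ⟨E, a, ⟨ha, fun E' e' hc => hred ?_, fun p b h => hg ⟨p, b, h⟩⟩, rfl⟩
    cases hc with
    | beta _ b v => exact ⟨_, (Contract.beta E b v).red⟩
    | ret _ p v => exact ⟨_, (Contract.ret E p v).red⟩
    | capture _ _ p b => exact absurd ⟨p, b, rfl⟩ hg
    | throw _ E' e => exact ⟨_, (Contract.throw E E' e).red⟩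
    | gen _ _ b =>
      obtain ⟨q, hq⟩ := exists_prompt_notMem (b.prompts ∪ E.prompts)
      simp only [Finset.mem_union, not_or] at hq
      exact ⟨_, (Contract.gen E q b hq.1 (freshFor_inst b hq.2)).red⟩

theorem IsStuck.plug {e : Exp 0} (h : IsStuck e) (E : ECtx 0) :
    (∃ e', Red (E.plug e) e') ∨ IsStuck (E.plug e) := by
  obtain ⟨E', p, b, -, rfl⟩ := h
  by_cases hp : p ∈ (E.comp E').surr
  · obtain ⟨E₁, E₂, hE, h₂⟩ := (E.comp E').exists_split_of_mem_surr hp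
    rw [← ECtx.comp_plug, hE]
    exact .inl ⟨_, (Contract.capture E₁ E₂ p b h₂).red⟩
  · exact .inr ⟨_, p, b, hp, (ECtx.comp_plug _ _ _).symm⟩

/-- `reify E` evaluates to `⌜E⌝` in two steps; the prompt in between can be chosen freely. -/
theorem ECtx.reify_red (E : ECtx 0) (S : Finset Prompt) :
    ∃ e, RedFresh S E.reify e ∧ RedFresh S e (.val (.cont E)) := by
  obtain ⟨q, hq⟩ := exists_prompt_notMem (E.prompts ∪ S)
  simp only [Finset.mem_union, not_or] at hq
  have hinst : (Exp.reset (.var 0) ((E.rename Fin.succ).plug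
      (.grab (.var 0) (.val (.var 0))))).inst (.prompt q) =
      .reset (.prompt q) (E.plug (.grab (.prompt q) (.val (.var 0)))) := by
    simp only [Exp.inst, Exp.subst, ECtx.plug_subst, ECtx.rename_succ_inst, Val.subst]
    rfl
  refine ⟨_, ⟨.gen q _ ?_, freshFor_inst _ hq.2⟩, ?_, ?_⟩
  · simpa [Exp.prompts, Val.prompts, ECtx.plug_prompts, ECtx.rename_prompts] using hq.1
  · rw [hinst]
    exact Red.capture q E (.val (.var 0)) fun h => hq.1 (E.surr_subset_prompts h)
  · rw [hinst]
    refine .of_subset _ ?_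
    simp only [Exp.prompts, Val.prompts, ECtx.plug_prompts]
    grind

theorem redFresh_throw (S : Finset Prompt) (E : ECtx 0) (e : Exp 0) :
    RedFresh S (.push (.cont E) e) (E.plug e) :=
  ⟨.throw E e, .of_subset _ (by rw [ECtx.plug_prompts]; exact subset_rfl)⟩

/-! ### Evaluation in the context closure of a simulation -/

/-- The properties of a bisimulation that make its context closure compatible with evaluation.
`WE` relates environments, and `WR` relates expressions running next to environments. The
right-hand expression is asked to follow the left-hand one by reductions that generate prompts
outside of its environment. The fields follow the labels of the transition system. Running
pairs only occur when the administrative rules are off. -/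
structure Simulation (adm : Prop) (WE : Env → Env → Prop)
    (WR : Env → Exp 0 → Env → Exp 0 → Prop) : Prop where
  not_adm : ∀ {Γ Δ e f}, WR Γ e Δ f → ¬ adm
  length : ∀ {Γ Δ}, WE Γ Δ → Γ.length = Δ.length
  lam : ∀ {Γ Δ b v' v w}, WE Γ Δ → Env.Paired Γ Δ (.lam b) v' →
    CongVal adm (Env.Paired Γ Δ) v w →
    ∃ c f, v' = .lam c ∧ RedsFresh Δ.prompts (c.inst w) f ∧ WR Γ (b.inst v) Δ f
  cont : ∀ {Γ Δ E v'}, WE Γ Δ → Env.Paired Γ Δ (.cont E) v' → ∃ F, v' = .cont F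
  ctx : ∀ {Γ Δ E F v w}, WE Γ Δ → Env.Paired Γ Δ (.cont E) (.cont F) →
    CongVal adm (Env.Paired Γ Δ) v w →
    ∃ f, RedsFresh Δ.prompts (F.plug (.val w)) f ∧ WR Γ (E.plug (.val v)) Δ f
  prompt : ∀ {Γ Δ p v'}, WE Γ Δ → Env.Paired Γ Δ (.prompt p) v' → ∃ q, v' = .prompt q
  prompt_inj : ∀ {Γ Δ p q p' q'}, WE Γ Δ → Env.Paired Γ Δ (.prompt p) (.prompt q) →
    Env.Paired Γ Δ (.prompt p') (.prompt q') → (p = p' ↔ q = q')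
  newPrompt : ∀ {Γ Δ}, WE Γ Δ → ∀ X Y : Finset Prompt,
    (¬ adm → X ⊆ Γ.prompts ∧ Y ⊆ Δ.prompts) →
    ∃ p q, p ∉ X ∧ q ∉ Y ∧ WE (Γ ++ [.prompt p]) (Δ ++ [.prompt q])
  decomp : ∀ {Γ Δ E₁ E₂ F p q}, WE Γ Δ →
    Env.Paired Γ Δ (.cont (E₁.comp (.reset p E₂))) (.cont F) →
    Env.Paired Γ Δ (.prompt p) (.prompt q) → p ∉ E₂.surr →
    ∃ F₁ F₂, F = F₁.comp (.reset q F₂) ∧ q ∉ F₂.surr ∧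
      WE (Γ ++ [.cont E₁, .cont E₂]) (Δ ++ [.cont F₁, .cont F₂])
  surr : ∀ {Γ Δ E F p q}, WE Γ Δ → Env.Paired Γ Δ (.cont E) (.cont F) →
    Env.Paired Γ Δ (.prompt p) (.prompt q) → q ∈ F.surr → p ∈ E.surr
  run_value : ∀ {Γ Δ v f}, WR Γ (.val v) Δ f →
    ∃ w, RedsFresh Δ.prompts f (.val w) ∧ WE (Γ ++ [v]) (Δ ++ [w])
  run_red : ∀ {Γ Δ e f e'}, WR Γ e Δ f → Red e e' →
    ∃ e₁ f₁, RedFresh Γ.prompts e e₁ ∧ RedsFresh Δ.prompts f f₁ ∧ WR Γ e₁ Δ f₁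
  run_stuck_red : ∀ {Γ Δ e f E F e'}, WR Γ e Δ f → IsStuck e →
    CongCtx adm (Env.Paired Γ Δ) E F → Red (E.plug e) e' →
    ∃ f', RedStar (F.plug f) f' ∧ WR Γ e' Δ f'
  run_stuck : ∀ {Γ Δ e f E F}, WR Γ e Δ f → IsStuck e →
    CongCtx adm (Env.Paired Γ Δ) E F → IsStuck (E.plug e) → Reach IsStuck (F.plug f)

theorem CongVal.of_rel {adm : Prop} {H : Val 0 → Val 0 → Prop} {v w : Val 0} (h : H v w) :
    CongVal adm H v w := by
  have := CongVal.hole (adm := adm) (n := 0) h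
  rwa [Val.weaken_self, Val.weaken_self] at this

theorem CongCtx.of_rel {n : ℕ} {adm : Prop} {H : Val 0 → Val 0 → Prop} {E F : ECtx 0}
    (h : H (.cont E) (.cont F)) : CongCtx adm H (E.weaken : ECtx n) F.weaken := by
  have := CongCtx.star (adm := adm) (n := n) h .hole
  rwa [ECtx.comp_hole, ECtx.comp_hole] at this

theorem Env.paired_concat {Γ Δ : Env} (hl : Γ.length = Δ.length) (v w : Val 0) :
    Env.Paired (Γ ++ [v]) (Δ ++ [w]) v w :=
  ⟨Γ.length, by simp, by simp [hl]⟩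

section Simulation

variable {adm : Prop} {WE : Env → Env → Prop} {WR : Env → Exp 0 → Env → Exp 0 → Prop}
  {H : Val 0 → Val 0 → Prop}

theorem CongExp.left_prompts {Γ Δ : Env} {n : ℕ} {e f : Exp n} (ha : ¬ adm)
    (h : CongExp adm (Env.Paired Γ Δ) e f) : e.prompts ⊆ Γ.prompts := by
  rw [eq_false ha] at h
  exact h.prompts_subset fun _ _ => Env.Paired.prompts_subset

theorem CongExp.right_prompts {Γ Δ : Env} {n : ℕ} {e f : Exp n} (ha : ¬ adm)
    (h : CongExp adm (Env.Paired Γ Δ) e f) : f.prompts ⊆ Δ.prompts :=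
  (h.symm fun _ _ => Env.Paired.symm).left_prompts ha

theorem CongVal.right_prompts {Γ Δ : Env} {n : ℕ} {v w : Val n} (ha : ¬ adm)
    (h : CongVal adm (Env.Paired Γ Δ) v w) : w.prompts ⊆ Δ.prompts :=
  (CongExp.val h).right_prompts ha

theorem CongCtx.left_prompts {Γ Δ : Env} {n : ℕ} {E F : ECtx n} (ha : ¬ adm)
    (h : CongCtx adm (Env.Paired Γ Δ) E F) : E.prompts ⊆ Γ.prompts := by
  rw [eq_false ha] at h
  exact h.prompts_subset fun _ _ => Env.Paired.prompts_subset

theorem CongCtx.right_prompts {Γ Δ : Env} {n : ℕ} {E F : ECtx n} (ha : ¬ adm)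
    (h : CongCtx adm (Env.Paired Γ Δ) E F) : F.prompts ⊆ Δ.prompts :=
  (h.symm fun _ _ => Env.Paired.symm).left_prompts ha

variable (adm WE WR) in
/-- Pairs of expressions in the evaluation position of a pair of related expressions. -/
inductive FocusPair (Γ Δ : Env) : Exp 0 → Exp 0 → Prop
  | run {e f : Exp 0} (h : WR Γ e Δ f) (he : ¬ e.IsValue) : FocusPair Γ Δ e f
  | bad {e f : Exp 0} (h : IsBad e) : FocusPair Γ Δ e f
  | app {v v' w w' : Val 0} (hW : WE Γ Δ) (hv : CongVal adm (Env.Paired Γ Δ) v v')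
      (hw : CongVal adm (Env.Paired Γ Δ) w w') :
      FocusPair Γ Δ (.app (.val v) (.val w)) (.app (.val v') (.val w'))
  | fresh {e f : Exp 1} (hW : WE Γ Δ) (h : CongExp adm (Env.Paired Γ Δ) e f) :
      FocusPair Γ Δ (.fresh e) (.fresh f)
  | ret {p q : Prompt} {v w : Val 0} (hW : WE Γ Δ) (h : CongVal adm (Env.Paired Γ Δ) v w) :
      FocusPair Γ Δ (.reset (.prompt p) (.val v)) (.reset (.prompt q) (.val w))
  | grab {v w : Val 0} {e f : Exp 1} (hW : WE Γ Δ) (hv : CongVal adm (Env.Paired Γ Δ) v w)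
      (h : CongExp adm (Env.Paired Γ Δ) e f) : FocusPair Γ Δ (.grab v e) (.grab w f)
  | push {v w : Val 0} {e f : Exp 0} (hW : WE Γ Δ) (hv : CongVal adm (Env.Paired Γ Δ) v w)
      (h : CongExp adm (Env.Paired Γ Δ) e f) : FocusPair Γ Δ (.push v e) (.push w f)
  | adm {e e' f : Exp 0} (hW : WE Γ Δ)
      (hr : ∀ G : ECtx 0, Relation.TransGen Red (G.plug e) (G.plug e'))
      (h : CongExp adm (Env.Paired Γ Δ) e' f) : FocusPair Γ Δ e f

variable (adm WE WR) in
/-- The result of looking for the evaluation position of related expressions `e` and `f`,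
where environments may grow by transitions that do not make `e` reduce, and where `f`
catches up with `e` by reductions that generate prompts not in `S`. -/
def Decomposes (Γ Δ : Env) (S : Finset Prompt) (e f : Exp 0) : Prop :=
  ∃ X Y : Env,
    (∃ v w, WE (Γ ++ X) (Δ ++ Y) ∧ CongVal adm (Env.Paired (Γ ++ X) (Δ ++ Y)) v w ∧
      e = .val v ∧ RedsFresh S f (.val w)) ∨
    (∃ E F e₀ f₀, CongCtx adm (Env.Paired (Γ ++ X) (Δ ++ Y)) E F ∧
      FocusPair adm WE WR (Γ ++ X) (Δ ++ Y) e₀ f₀ ∧ e = E.plug e₀ ∧ RedsFresh S f (F.plug f₀))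

variable (adm WE WR H) in
/-- `Decomposes` in all pairs of related environments that extend `H`. -/
def AlwaysDecomposes (e f : Exp 0) : Prop :=
  ∀ (Γ Δ : Env) (S : Finset Prompt), (∀ v w, H v w → Env.Paired Γ Δ v w) → WE Γ Δ →
    f.prompts ⊆ S → (¬ adm → S ⊆ Δ.prompts) → Decomposes adm WE WR Γ Δ S e f

theorem Decomposes.of_focus {Γ Δ : Env} {S : Finset Prompt} {e f : Exp 0}
    (h : FocusPair adm WE WR Γ Δ e f) : Decomposes adm WE WR Γ Δ S e f :=
  ⟨[], [], .inr ⟨.hole, .hole, e, f, .hole, by simpa using h, rfl, .refl⟩⟩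

theorem Decomposes.of_append {Γ Δ X Y : Env} {S : Finset Prompt} {e f : Exp 0}
    (h : Decomposes adm WE WR (Γ ++ X) (Δ ++ Y) S e f) : Decomposes adm WE WR Γ Δ S e f := by
  obtain ⟨X', Y', h⟩ := h
  rw [List.append_assoc, List.append_assoc] at h
  exact ⟨X ++ X', Y ++ Y', h⟩

theorem Decomposes.of_reds {Γ Δ : Env} {S S' : Finset Prompt} {e f f' : Exp 0}
    (h : Decomposes adm WE WR Γ Δ S' e f') (hS : S ⊆ S') (hr : RedsFresh S f f') :
    Decomposes adm WE WR Γ Δ S e f := by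
  obtain ⟨X, Y, ⟨v, w, h₁, h₂, h₃, h₄⟩ | ⟨E, F, e₀, f₀, h₁, h₂, h₃, h₄⟩⟩ := h
  · exact ⟨X, Y, .inl ⟨v, w, h₁, h₂, h₃, hr.trans (h₄.mono hS)⟩⟩
  · exact ⟨X, Y, .inr ⟨E, F, e₀, f₀, h₁, h₂, h₃, hr.trans (h₄.mono hS)⟩⟩

/-- To decompose related expressions under a frame, it suffices to treat the case where the
framed expressions have become values. -/
theorem Decomposes.frame {Γ Δ : Env} {S : Finset Prompt} {e f : Exp 0}
    (h : Decomposes adm WE WR Γ Δ S e f) {E F : ECtx 0} (hE : CongCtx adm (Env.Paired Γ Δ) E F)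
    (hF : F.prompts ⊆ S)
    (hval : ∀ X Y v w, WE (Γ ++ X) (Δ ++ Y) → CongVal adm (Env.Paired (Γ ++ X) (Δ ++ Y)) v w →
      Decomposes adm WE WR (Γ ++ X) (Δ ++ Y) S (E.plug (.val v)) (F.plug (.val w))) :
    Decomposes adm WE WR Γ Δ S (E.plug e) (F.plug f) := by
  obtain ⟨X, Y, ⟨v, w, hW, hv, rfl, hr⟩ | ⟨E', F', e₀, f₀, hE', h₀, rfl, hr⟩⟩ := h
  · exact ((hval X Y v w hW hv).of_reds subset_rfl (hr.plug hF)).of_append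
  · refine ⟨X, Y, .inr ⟨E.comp E', F.comp F', e₀, f₀,
      (hE.mono fun _ _ h => h.append X Y).comp hE', h₀, (ECtx.comp_plug _ _ _).symm, ?_⟩⟩
    rw [ECtx.comp_plug]
    exact hr.plug hF

theorem AlwaysDecomposes.val {v w : Val 0} (h : CongVal adm H v w) :
    AlwaysDecomposes adm WE WR H (.val v) (.val w) := fun Γ Δ S hH hW _ _ =>
  ⟨[], [], .inl ⟨v, w, by simpa using hW, by simpa using h.mono hH, rfl, .refl⟩⟩

theorem AlwaysDecomposes.app {e₁ e₂ f₁ f₂ : Exp 0} (h₁ : AlwaysDecomposes adm WE WR H e₁ f₁)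
    (h₂ : AlwaysDecomposes adm WE WR H e₂ f₂) (h : CongExp adm H e₂ f₂) :
    AlwaysDecomposes adm WE WR H (.app e₁ e₂) (.app f₁ f₂) := by
  intro Γ Δ S hH hW hf hS
  have hf₁ : f₁.prompts ⊆ S := Finset.subset_union_left.trans hf
  have hf₂ : f₂.prompts ⊆ S := Finset.subset_union_right.trans hf
  refine (h₁ Γ Δ S hH hW hf₁ hS).frame (E := .appL .hole e₂) (F := .appL .hole f₂)
    (.appL .hole (h.mono hH)) (by simpa [ECtx.prompts] using hf₂) ?_
  intro X Y v w hW' hv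
  -- the prompts of the value `w` may be new, and they have to be avoided from now on
  have hS' : ¬ adm → S ∪ w.prompts ⊆ Env.prompts (Δ ++ Y) := fun ha =>
    Finset.union_subset ((hS ha).trans (by
      rw [Env.prompts_append]; exact Finset.subset_union_left)) (hv.right_prompts ha)
  refine Decomposes.of_reds ?_ (S' := S ∪ w.prompts) Finset.subset_union_left .refl
  refine (h₂ (Γ ++ X) (Δ ++ Y) (S ∪ w.prompts) (fun v w h => (hH v w h).append X Y) hW'
    (hf₂.trans Finset.subset_union_left) hS').frame
    (E := .appR v .hole) (F := .appR w .hole) (.appR hv .hole) (by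
      simp [ECtx.prompts]) ?_
  intro X' Y' v' w' hW'' hv'
  exact .of_focus (.app hW'' (hv.mono fun _ _ h => h.append X' Y') hv')

theorem AlwaysDecomposes.reset {p q : Prompt} {e f : Exp 0} (hp : H (.prompt p) (.prompt q))
    (h : AlwaysDecomposes adm WE WR H e f) :
    AlwaysDecomposes adm WE WR H (.reset (.prompt p) e) (.reset (.prompt q) f) := by
  intro Γ Δ S hH hW hf hS
  refine (h Γ Δ S hH hW (Finset.subset_union_right.trans hf) hS).frame
    (E := .reset p .hole) (F := .reset q .hole) (.reset (hH _ _ hp) .hole) ?_ ?_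
  · simpa [ECtx.prompts] using hf (Finset.mem_union_left _ (Finset.mem_singleton_self q))
  · intro X Y v w hW' hv
    exact .of_focus (.ret hW' hv)

theorem AlwaysDecomposes.star (hs : Simulation adm WE WR) {E F : ECtx 0} {e f : Exp 0}
    (hE : H (.cont E) (.cont F)) (h : AlwaysDecomposes adm WE WR H e f) :
    AlwaysDecomposes adm WE WR H (E.plug e) (F.plug f) := by
  intro Γ Δ S hH hW hf hS
  rw [ECtx.plug_prompts] at hf
  have hE' := CongCtx.of_rel (adm := adm) (n := 0) (hH _ _ hE)
  rw [ECtx.weaken_self, ECtx.weaken_self] at hE'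
  refine (h Γ Δ S hH hW (Finset.subset_union_right.trans hf) hS).frame hE'
    (Finset.subset_union_left.trans hf) ?_
  intro X Y v w hW' hv
  obtain ⟨f', hr, hR⟩ := hs.ctx hW' ((hH _ _ hE).append X Y) hv
  have hS' : S ⊆ Env.prompts (Δ ++ Y) := (hS (hs.not_adm hR)).trans (by
    rw [Env.prompts_append]; exact Finset.subset_union_left)
  refine Decomposes.of_reds ?_ hS' (hr.mono hS')
  by_cases hval : (E.plug (.val v)).IsValue
  · obtain ⟨u, hu⟩ := hval.exists_eq
    rw [hu] at hR ⊢
    obtain ⟨u', hr', hW''⟩ := hs.run_value hR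
    exact ⟨[u], [u'], .inl ⟨u, u', hW'', .of_rel (Env.paired_concat (hs.length hW') u u'), rfl, hr'⟩⟩
  · exact .of_focus (.run hR hval)

theorem AlwaysDecomposes.bad {e f : Exp 0} (h : IsBad e) : AlwaysDecomposes adm WE WR H e f :=
  fun _ _ _ _ _ _ _ => .of_focus (.bad h)

theorem AlwaysDecomposes.reset' (hs : Simulation adm WE WR) {v w : Val 0} {e f : Exp 0}
    (hv : CongVal adm H v w) (h : AlwaysDecomposes adm WE WR H e f) :
    AlwaysDecomposes adm WE WR H (.reset v e) (.reset w f) := by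
  by_cases hp : ∃ p, v = .prompt p
  · obtain ⟨p, rfl⟩ := hp
    have hH : H (.prompt p) w := by
      rcases hv.closed_cases with ⟨_, _, h, -⟩ | ⟨_, _, h, -⟩ | h
      · cases h
      · cases h
      · exact h
    intro Γ Δ S hΓ hW
    obtain ⟨q, rfl⟩ := hs.prompt hW (hΓ _ _ hH)
    exact AlwaysDecomposes.reset hH h Γ Δ S hΓ hW
  · exact .bad (isBad_reset fun p hv => hp ⟨p, hv⟩)

mutual

/-- Closed related expressions decompose into related evaluation contexts and foci. The index `n`
is kept general, as the induction runs over an inductive family that includes open expressions. -/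
theorem CongExp.alwaysDecomposes (hs : Simulation adm WE WR) : ∀ {n : ℕ} {e f : Exp n},
    CongExp adm H e f → ∀ hn : n = 0, AlwaysDecomposes adm WE WR H (hn ▸ e) (hn ▸ f)
  | _, _, _, .val hv, hn => by subst hn; exact .val hv
  | _, _, _, .app h₁ h₂, hn => by
    have ih₁ := h₁.alwaysDecomposes hs hn
    have ih₂ := h₂.alwaysDecomposes hs hn
    subst hn
    exact .app ih₁ ih₂ h₂
  | _, _, _, .fresh h, hn => by
    subst hn
    exact fun _ _ _ hH hW _ _ => .of_focus (.fresh hW (h.mono hH))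
  | _, _, _, .reset hv h, hn => by
    have ih := h.alwaysDecomposes hs hn
    subst hn
    exact .reset' hs hv ih
  | _, _, _, .grab hv h, hn => by
    subst hn
    exact fun _ _ _ hH hW _ _ => .of_focus (.grab hW (hv.mono hH) (h.mono hH))
  | _, _, _, .push hv h, hn => by
    subst hn
    exact fun _ _ _ hH hW _ _ => .of_focus (.push hW (hv.mono hH) (h.mono hH))
  | _, _, _, .star hE h, hn => by
    have ih := h.alwaysDecomposes hs hn
    subst hn
    rw [ECtx.weaken_self, ECtx.weaken_self]
    exact .star hs hE ih
  | _, _, _, .throwL _ hE h, hn => by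
    subst hn
    exact fun _ _ _ hH hW _ _ => .of_focus (.adm hW
      (fun G => .single (Contract.throw G _ _).red) ((hE.plug h).mono hH))
  | _, _, _, .throwR (E := E) (F := F) (e := e) (f := f) _ hE h, hn => by
    have ih := h.alwaysDecomposes hs hn
    have ih' := hE.alwaysDecomposes hs hn
    subst hn
    intro Γ Δ S hH hW hf hS
    refine Decomposes.of_reds (ih' e f ih h Γ Δ S hH hW ?_ hS) subset_rfl
      (.single (redFresh_throw S F f))
    rwa [ECtx.plug_prompts]
  | _, _, _, .reifyL (E := E) (F := F) _ hE, hn => by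
    subst hn
    refine fun _ _ _ hH hW _ _ => .of_focus (.adm hW (e' := .val (.cont E)) (fun G => ?_)
      (.val (.cont (hE.mono hH))))
    obtain ⟨e, h₁, h₂⟩ := E.reify_red G.prompts
    exact .tail (.single (h₁.plug subset_rfl).1) (h₂.plug subset_rfl).1
  | _, _, _, .reifyR (E := E) (F := F) _ hE, hn => by
    subst hn
    intro Γ Δ S hH hW hf hS
    obtain ⟨f, h₁, h₂⟩ := F.reify_red S
    refine Decomposes.of_reds (AlwaysDecomposes.val (.cont hE) Γ Δ S hH hW ?_ hS) subset_rfl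
      (.tail (.single h₁) h₂)
    simpa [ECtx.reify, Exp.prompts, Val.prompts, ECtx.plug_prompts, ECtx.rename_prompts] using hf
  | _, _, _, .badReset _ hv _, hn => by
    subst hn
    exact .bad (isBad_reset hv.ne_prompt)
  | _, _, _, .badGrab _ hv _, hn => by
    subst hn
    exact .bad (isBad_grab hv.ne_prompt)

theorem CongCtx.alwaysDecomposes (hs : Simulation adm WE WR) : ∀ {n : ℕ} {E F : ECtx n},
    CongCtx adm H E F → ∀ (hn : n = 0) (e f : Exp 0), AlwaysDecomposes adm WE WR H e f →
      CongExp adm H e f →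
      AlwaysDecomposes adm WE WR H ((hn ▸ E : ECtx 0).plug e) ((hn ▸ F : ECtx 0).plug f)
  | _, _, _, .hole, hn, _, _, h, _ => by subst hn; exact h
  | _, _, _, .appL hE h', hn, e, f, h, hc => by
    have ih := hE.alwaysDecomposes hs hn e f h hc
    have ih' := h'.alwaysDecomposes hs hn
    subst hn
    exact .app ih ih' h'
  | _, _, _, .appR hv hE, hn, e, f, h, hc => by
    have ih := hE.alwaysDecomposes hs hn e f h hc
    subst hn
    exact .app (.val hv) ih (hE.plug hc)
  | _, _, _, .reset hp hE, hn, e, f, h, hc => by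
    have ih := hE.alwaysDecomposes hs hn e f h hc
    subst hn
    exact .reset hp ih
  | _, _, _, .star h₀ hE, hn, e, f, h, hc => by
    have ih := hE.alwaysDecomposes hs hn e f h hc
    subst hn
    simp only [ECtx.weaken_self, ECtx.comp_plug]
    exact .star hs h₀ ih

end

/-- Related prompts delimit the hole of related evaluation contexts on both sides or on none.
Only one direction is needed, as the other one is contained in `CongCtx.exists_split`. -/
theorem CongCtx.mem_surr (hs : Simulation adm WE WR) {Γ Δ : Env} {p q : Prompt}
    (hW : WE Γ Δ) (hp : Env.Paired Γ Δ (.prompt p) (.prompt q)) : ∀ {n : ℕ} {E F : ECtx n},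
    CongCtx adm (Env.Paired Γ Δ) E F → q ∈ F.surr → p ∈ E.surr
  | _, _, _, .hole, h => by simp [ECtx.surr] at h
  | _, _, _, .appL hE _, h => hE.mem_surr hs hW hp h
  | _, _, _, .appR _ hE, h => hE.mem_surr hs hW hp h
  | _, _, _, .reset hp' hE, h => by
    rw [ECtx.surr, Finset.mem_union, Finset.mem_singleton] at h ⊢
    exact h.imp (hs.prompt_inj hW hp hp').2 (hE.mem_surr hs hW hp)
  | _, _, _, .star h₀ hE, h => by
    rw [ECtx.comp_surr, Finset.mem_union, ECtx.weaken_surr] at h ⊢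
    exact h.imp (hs.surr hW h₀ hp) (hE.mem_surr hs hW hp)

/-- Related evaluation contexts can be cut at the innermost delimiters with a given pair of
related prompts. When the delimiters lie inside of a pair of continuations of the environments,
the two halves of these have to be added to the environments. -/
theorem CongCtx.exists_split (hs : Simulation adm WE WR) {Γ Δ : Env} {p q : Prompt}
    (hW : WE Γ Δ) (hp : Env.Paired Γ Δ (.prompt p) (.prompt q)) : ∀ {n : ℕ} {E F : ECtx n},
    CongCtx adm (Env.Paired Γ Δ) E F → p ∈ E.surr →
    ∃ (X Y : Env) (E₁ E₂ F₁ F₂ : ECtx n), WE (Γ ++ X) (Δ ++ Y) ∧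
      CongCtx adm (Env.Paired (Γ ++ X) (Δ ++ Y)) E₁ F₁ ∧
      CongCtx adm (Env.Paired (Γ ++ X) (Δ ++ Y)) E₂ F₂ ∧
      E = E₁.comp (.reset p E₂) ∧ F = F₁.comp (.reset q F₂) ∧ p ∉ E₂.surr ∧ q ∉ F₂.surr
  | _, _, _, .hole, h => by simp [ECtx.surr] at h
  | _, _, _, .appL (e := e) (f := f) hE hc, h => by
    obtain ⟨X, Y, E₁, E₂, F₁, F₂, hW', h₁, h₂, rfl, rfl, h₃⟩ := hE.exists_split hs hW hp h
    exact ⟨X, Y, .appL E₁ e, E₂, .appL F₁ f, F₂, hW',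
      .appL h₁ (hc.mono fun _ _ h => h.append X Y), h₂, rfl, rfl, h₃⟩
  | _, _, _, .appR (v := v) (w := w) hv hE, h => by
    obtain ⟨X, Y, E₁, E₂, F₁, F₂, hW', h₁, h₂, rfl, rfl, h₃⟩ := hE.exists_split hs hW hp h
    exact ⟨X, Y, .appR v E₁, E₂, .appR w F₁, F₂, hW',
      .appR (hv.mono fun _ _ h => h.append X Y) h₁, h₂, rfl, rfl, h₃⟩
  | _, _, _, .reset (p := p') (q := q') (E := E) (F := F) hp' hE, h => by
    by_cases hpE : p ∈ E.surr
    · obtain ⟨X, Y, E₁, E₂, F₁, F₂, hW', h₁, h₂, rfl, rfl, h₃⟩ := hE.exists_split hs hW hp hpE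
      exact ⟨X, Y, .reset p' E₁, E₂, .reset q' F₁, F₂, hW',
        .reset (hp'.append X Y) h₁, h₂, rfl, rfl, h₃⟩
    · obtain rfl : p = p' := by simpa [ECtx.surr, hpE] using h
      obtain rfl : q = q' := (hs.prompt_inj hW hp hp').1 rfl
      refine ⟨[], [], .hole, E, .hole, F, by simpa using hW, .hole, by simpa using hE, rfl, rfl,
        hpE, fun h => hpE (hE.mem_surr hs hW hp h)⟩
  | _, _, _, .star (E₀ := E₀) (F₀ := F₀) (E := E) (F := F) h₀ hE, h => by
    by_cases hpE : p ∈ E.surr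
    · obtain ⟨X, Y, E₁, E₂, F₁, F₂, hW', h₁, h₂, rfl, rfl, h₃⟩ := hE.exists_split hs hW hp hpE
      exact ⟨X, Y, E₀.weaken.comp E₁, E₂, F₀.weaken.comp F₁, F₂, hW',
        .star (h₀.append X Y) h₁, h₂, (ECtx.comp_assoc _ _ _).symm,
        (ECtx.comp_assoc _ _ _).symm, h₃⟩
    · have hpE₀ : p ∈ E₀.surr := by simpa [ECtx.comp_surr, hpE] using h
      obtain ⟨E₁, E₂, rfl, hp₂⟩ := E₀.exists_split_of_mem_surr hpE₀
      obtain ⟨F₁, F₂, rfl, hq₂, hW'⟩ := hs.decomp hW h₀ hp hp₂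
      have hl := hs.length hW
      have h₁ : Env.Paired (Γ ++ [.cont E₁, .cont E₂]) (Δ ++ [.cont F₁, .cont F₂])
          (.cont E₁) (.cont F₁) := ⟨Γ.length, by simp, by simp [hl]⟩
      have h₂ : Env.Paired (Γ ++ [.cont E₁, .cont E₂]) (Δ ++ [.cont F₁, .cont F₂])
          (.cont E₂) (.cont F₂) := ⟨Γ.length + 1, by simp, by simp [hl]⟩
      refine ⟨_, _, E₁.weaken, E₂.weaken.comp E, F₁.weaken, F₂.weaken.comp F, hW', .of_rel h₁,
        .star h₂ (hE.mono fun _ _ h => h.append _ _), ?_, ?_, ?_, ?_⟩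
      · rw [ECtx.weaken, ECtx.comp_rename, ECtx.comp_assoc]; rfl
      · rw [ECtx.weaken, ECtx.comp_rename, ECtx.comp_assoc]; rfl
      · rw [ECtx.comp_surr, ECtx.weaken_surr, Finset.mem_union]
        exact fun h => h.elim hp₂ hpE
      · rw [ECtx.comp_surr, ECtx.weaken_surr, Finset.mem_union]
        exact fun h => h.elim hq₂ fun h => hpE (hE.mem_surr hs hW hp h)

variable (adm WE WR) in
/-- The context closure of a simulation: related expressions over related environments, or
running pairs in related evaluation contexts. -/
def Closure (e f : Exp 0) : Prop :=
  (∃ Γ Δ, WE Γ Δ ∧ CongExp adm (Env.Paired Γ Δ) e f) ∨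
    ∃ Γ Δ E F e₀ f₀, WR Γ e₀ Δ f₀ ∧ CongCtx adm (Env.Paired Γ Δ) E F ∧ e = E.plug e₀ ∧
      f = F.plug f₀

variable (adm WE WR) in
/-- What evaluation of the left-hand side of a pair in the closure achieves. -/
def Progresses (e f : Exp 0) : Prop :=
  (e.IsValue ∧ Reach Exp.IsValue f) ∨ (IsStuck e ∧ Reach IsStuck f) ∨ IsError e ∨
    ∃ e' f', Relation.TransGen Red e e' ∧ RedStar f f' ∧ Closure adm WE WR e' f'

theorem Progresses.of_redStar {e f f' : Exp 0} (h : Progresses adm WE WR e f')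
    (hr : RedStar f f') : Progresses adm WE WR e f := by
  rcases h with ⟨h, h'⟩ | ⟨h, h'⟩ | h | ⟨e', f'', h₁, h₂, h₃⟩
  · exact .inl ⟨h, (hr.reach_iff observable_isValue).2 h'⟩
  · exact .inr (.inl ⟨h, (hr.reach_iff observable_isStuck).2 h'⟩)
  · exact .inr (.inr (.inl h))
  · exact .inr (.inr (.inr ⟨e', f'', h₁, hr.trans h₂, h₃⟩))

theorem Progresses.of_red {e e' f f' : Exp 0} (h : Red e e') (hr : RedStar f f')
    (hc : Closure adm WE WR e' f') : Progresses adm WE WR e f :=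
  .inr (.inr (.inr ⟨e', f', .single h, hr, hc⟩))

theorem Progresses.of_bad {a f : Exp 0} (h : IsBad a) (E : ECtx 0) :
    Progresses adm WE WR (E.plug a) f :=
  .inr (.inr (.inl (h.isError E)))

/-- The case analysis on the focus: the context provides it, or the environments do. -/
theorem FocusPair.progresses (hs : Simulation adm WE WR) {Γ Δ : Env} {e f : Exp 0}
    (h : FocusPair adm WE WR Γ Δ e f) {E F : ECtx 0}
    (hE : CongCtx adm (Env.Paired Γ Δ) E F) :
    Progresses adm WE WR (E.plug e) (F.plug f) := by
  cases h with
  | run hR he =>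
    have ha := hs.not_adm hR
    rcases exp_cases e with ⟨v, rfl⟩ | ⟨e', hr⟩ | hst | ⟨E', a, hb, rfl⟩
    · exact absurd trivial he
    · obtain ⟨e₁, f₁, h₁, h₂, h₃⟩ := hs.run_red hR hr
      exact .of_red (h₁.plug (hE.left_prompts ha)).1 (h₂.plug (hE.right_prompts ha)).redStar
        (.inr ⟨Γ, Δ, E, F, e₁, f₁, h₃, hE, rfl, rfl⟩)
    · rcases hst.plug E with ⟨e', hr⟩ | hst'
      · obtain ⟨f', h₁, h₂⟩ := hs.run_stuck_red hR hst hE hr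
        exact .of_red hr h₁ (.inr ⟨Γ, Δ, .hole, .hole, e', f', h₂, .hole, rfl, rfl⟩)
      · exact .inr (.inl ⟨hst', hs.run_stuck hR hst hE hst'⟩)
    · rw [← ECtx.comp_plug]
      exact .of_bad hb _
  | bad hb => exact .of_bad hb _
  | @app v v' w w' hW hv hw =>
    by_cases hlam : ∃ b, v = .lam b
    · obtain ⟨b, rfl⟩ := hlam
      rcases hv.closed_cases with ⟨_, c, ⟨⟩, rfl, hbc⟩ | ⟨_, _, ⟨⟩, -⟩ | hH
      · exact .of_red (Contract.beta E b w).red (.single (Contract.beta F c w').red)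
          (.inl ⟨Γ, Δ, hW, hE.plug (hbc.inst hw)⟩)
      · obtain ⟨c, f, rfl, hr, hR⟩ := hs.lam hW hH hw
        refine .of_red (Contract.beta E b w).red (.head (Contract.beta F c w').red ?_)
          (.inr ⟨Γ, Δ, E, F, _, f, hR, hE, rfl, rfl⟩)
        exact (hr.plug (hE.right_prompts (hs.not_adm hR))).redStar
    · exact .of_bad (isBad_app fun b hb => hlam ⟨b, hb⟩) _
  | @fresh b c hW hbc =>
    -- the prompts that are generated become values of the environments
    obtain ⟨p, q, hp, hq, hW'⟩ := hs.newPrompt hW (b.prompts ∪ E.prompts) (c.prompts ∪ F.prompts)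
      fun ha => ⟨Finset.union_subset (hbc.left_prompts ha) (hE.left_prompts ha),
        Finset.union_subset (hbc.right_prompts ha) (hE.right_prompts ha)⟩
    simp only [Finset.mem_union, not_or] at hp hq
    refine .of_red (Contract.gen E p b hp.1 (freshFor_inst b hp.2)).red
      (.single (Contract.gen F q c hq.1 (freshFor_inst c hq.2)).red) (.inl ⟨_, _, hW', ?_⟩)
    exact (hE.mono fun _ _ h => h.append _ _).plug ((hbc.mono fun _ _ h => h.append _ _).inst
      (.of_rel (Env.paired_concat (hs.length hW) _ _)))
  | @ret p q v w hW hv =>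
    exact .of_red (Contract.ret E p v).red (.single (Contract.ret F q w).red)
      (.inl ⟨Γ, Δ, hW, hE.plug (.val hv)⟩)
  | @grab v w b c hW hv hbc =>
    by_cases hpr : ∃ p, v = .prompt p
    · obtain ⟨p, rfl⟩ := hpr
      have hH : Env.Paired Γ Δ (.prompt p) w := by
        rcases hv.closed_cases with ⟨_, _, h, -⟩ | ⟨_, _, h, -⟩ | h
        · cases h
        · cases h
        · exact h
      obtain ⟨q, rfl⟩ := hs.prompt hW hH
      -- captured at a delimiter of the surrounding contexts, or stuck on both sides
      by_cases hpE : p ∈ E.surr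
      · obtain ⟨X, Y, E₁, E₂, F₁, F₂, hW', h₁, h₂, rfl, rfl, hp₂, hq₂⟩ :=
          hE.exists_split hs hW hH hpE
        exact .of_red (Contract.capture E₁ E₂ p b hp₂).red
          (.single (Contract.capture F₁ F₂ q c hq₂).red)
          (.inl ⟨_, _, hW', h₁.plug ((hbc.mono fun _ _ h => h.append X Y).inst (.cont h₂))⟩)
      · exact .inr (.inl ⟨⟨E, p, b, hpE, rfl⟩,
          0, ⟨F, q, c, fun h => hpE (hE.mem_surr hs hW hH h), rfl⟩⟩)
    · exact .of_bad (isBad_grab fun p hp => hpr ⟨p, hp⟩) _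
  | @push v w e f hW hv hef =>
    by_cases hcont : ∃ E', v = .cont E'
    · obtain ⟨E', rfl⟩ := hcont
      rcases hv.closed_cases with ⟨_, _, ⟨⟩, -⟩ | ⟨_, F', ⟨⟩, rfl, hE'⟩ | hH
      · exact .of_red (Contract.throw E E' e).red (.single (Contract.throw F F' f).red)
          (.inl ⟨Γ, Δ, hW, hE.plug (hE'.plug hef)⟩)
      · obtain ⟨F', rfl⟩ := hs.cont hW hH
        refine .of_red (Contract.throw E E' e).red (.single (Contract.throw F F' f).red)
          (.inl ⟨Γ, Δ, hW, hE.plug ?_⟩)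
        simpa using CongExp.star hH hef
    · exact .of_bad (isBad_push fun E' h => hcont ⟨E', h⟩) _
  | adm hW hr hef =>
    exact .inr (.inr (.inr ⟨_, _, hr E, .refl, .inl ⟨Γ, Δ, hW, hE.plug hef⟩⟩))

theorem Closure.progresses (hs : Simulation adm WE WR) {e f : Exp 0}
    (h : Closure adm WE WR e f) : Progresses adm WE WR e f := by
  -- related expressions over related environments: look for the evaluation position
  have key : ∀ {Γ Δ e f}, WE Γ Δ → CongExp adm (Env.Paired Γ Δ) e f →
      Progresses adm WE WR e f := by
    intro Γ Δ e f hW hef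
    obtain ⟨X, Y, ⟨v, w, -, -, rfl, hr⟩ | ⟨E, F, e₀, f₀, hE, h₀, rfl, hr⟩⟩ :=
      hef.alwaysDecomposes hs rfl Γ Δ f.prompts (fun _ _ h => h) hW subset_rfl hef.right_prompts
    · exact .inl ⟨trivial, reach_iff.2 ⟨_, hr.redStar, trivial⟩⟩
    · exact (h₀.progresses hs hE).of_redStar hr.redStar
  rcases h with ⟨Γ, Δ, hW, hef⟩ | ⟨Γ, Δ, E, F, e₀, f₀, hR, hE, rfl, rfl⟩
  · exact key hW hef
  -- a running pair that has ended in a value joins the environments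
  · by_cases hval : e₀.IsValue
    · obtain ⟨v, rfl⟩ := hval.exists_eq
      obtain ⟨w, hr, hW⟩ := hs.run_value hR
      refine (key hW ?_).of_redStar (hr.plug (hE.right_prompts (hs.not_adm hR))).redStar
      have hl : Γ.length = Δ.length := by simpa using hs.length hW
      exact (hE.mono fun _ _ h => h.append _ _).plug (.val (.of_rel (Env.paired_concat hl v w)))
    · exact FocusPair.progresses hs (.run hR hval) hE

/-- Observables are transported along the context closure of a simulation. -/
theorem Closure.reach (hs : Simulation adm WE WR) {P : Exp 0 → Prop}
    (hP : P = Exp.IsValue ∨ P = IsStuck) {e f : Exp 0} (h : Closure adm WE WR e f)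
    (he : Reach P e) : Reach P f := by
  obtain ⟨n, he⟩ := he
  induction n using Nat.strong_induction_on generalizing e f with
  | _ n ih =>
    have hreach : Reach P e := ⟨n, he⟩
    -- the last case decreases the number of steps to the observable, as the left-hand side does
    -- at least one step
    rcases h.progresses hs with ⟨hv, h'⟩ | ⟨hst, h'⟩ | herr | ⟨e', f', h₁, h₂, h₃⟩
    · rcases hP with rfl | rfl
      · exact h'
      · exact absurd hv (hreach.of_isNormal (observable_isValue.isNormal hv)).not_isValue
    · rcases hP with rfl | rfl
      · exact absurd (hreach.of_isNormal (observable_isStuck.isNormal hst)) hst.not_isValue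
      · exact h'
    · rcases hP with rfl | rfl
      · exact absurd hreach herr.not_reach_isValue
      · exact absurd hreach herr.not_reach_isStuck
    · obtain ⟨m, hm, he'⟩ := he.of_transGen (observable_of_eq hP) h₁
      exact (RedStar.reach_iff (observable_of_eq hP) h₂).2 (ih m hm h₃ he')

end Simulation

/-! ### The labeled transition system -/

theorem State.of_eq_run (Γ : Env) {e : Exp 0} (he : ¬ e.IsValue) : State.of Γ e = .run Γ e he := by
  cases e with
  | val v => exact absurd trivial he
  | _ => rfl

theorem State.run_eq_of {Γ Δ : Env} {e f : Exp 0} {he : ¬ e.IsValue}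
    (h : State.run Γ e he = State.of Δ f) : Γ = Δ ∧ e = f := by
  cases f with
  | val v => cases h
  | _ => cases h; exact ⟨rfl, rfl⟩

theorem State.env_eq_of {Γ Δ : Env} {f : Exp 0} (h : State.env Γ = State.of Δ f) :
    ∃ v, f = .val v ∧ Γ = Δ ++ [v] := by
  cases f with
  | val v => cases h; exact ⟨v, rfl, rfl⟩
  | _ => cases h

theorem RedFresh.lts {Γ : Env} {e e' : Exp 0} (h : RedFresh Γ.prompts e e') :
    Lts (.of Γ e) .tau (.of Γ e') := by
  have he : ¬ e.IsValue := fun hv => observable_isValue.isNormal hv _ h.1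
  rw [State.of_eq_run Γ he]
  exact .tau Γ e e' he h.1 h.2

theorem RedsFresh.tauStar {Γ : Env} {e e' : Exp 0} (h : RedsFresh Γ.prompts e e') :
    TauStar (.of Γ e) (.of Γ e') :=
  Relation.ReflTransGen.lift (State.of Γ) (fun _ _ (h : RedFresh _ _ _) => h.lts) _ _ h

theorem Lts.of_tau {Γ : Env} {e : Exp 0} {t : State} (h : Lts (.of Γ e) .tau t) :
    ∃ e', t = .of Γ e' ∧ RedFresh Γ.prompts e e' := by
  generalize hs : State.of Γ e = s at h
  cases h with
  | tau Γ' e₁ e₂ h₁ hr hf =>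
    obtain ⟨rfl, rfl⟩ := State.run_eq_of hs.symm
    exact ⟨e₂, rfl, hr, hf⟩

theorem TauStar.of_state {Γ : Env} {e : Exp 0} {t : State} (h : TauStar (.of Γ e) t) :
    ∃ e', t = .of Γ e' ∧ RedsFresh Γ.prompts e e' := by
  induction h with
  | refl => exact ⟨e, rfl, .refl⟩
  | tail _ h ih =>
    obtain ⟨e', rfl, hr⟩ := ih
    obtain ⟨e'', rfl, hr'⟩ := h.of_tau
    exact ⟨e'', rfl, hr.tail hr'⟩

theorem TauStar.of_env {Γ : Env} {t : State} (h : TauStar (.env Γ) t) : t = .env Γ := by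
  induction h with
  | refl => rfl
  | tail _ h ih => subst ih; cases h

theorem WeakLts.of_env {Γ : Env} {a : Label} {t : State} (h : WeakLts (.env Γ) a t)
    (ha : a ≠ .tau) : ∃ t', Lts (.env Γ) a t' ∧ TauStar t' t := by
  rcases h with ⟨rfl, -⟩ | ⟨-, s, t', h₁, h₂, h₃⟩
  · exact absurd rfl ha
  · rw [h₁.of_env] at h₂
    exact ⟨t', h₂, h₃⟩

/-! ### Star-bisimilarity -/

theorem StarBisimilar.symm {s t : State} (h : StarBisimilar s t) : StarBisimilar t s := by
  obtain ⟨R, ⟨-, -, hR⟩, hst⟩ := h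
  refine ⟨fun s t => R t s, ⟨fun _ _ h => h, fun _ _ h => h, fun s t h => ?_⟩, hst⟩
  obtain ⟨h₁, h₂, h₃, h₄⟩ := hR t s h
  exact ⟨h₃, h₄, h₁, h₂⟩

/-- Star-bisimilarity is matched by all transitions: the distinction between passive and active
ones only matters for up-to techniques. -/
theorem StarBisimilar.step {s t s' : State} {a : Label} (h : StarBisimilar s t)
    (hs : Lts s a s') : ∃ t', WeakLts t a t' ∧ StarBisimilar s' t' := by
  obtain ⟨R, hR, hst⟩ := h
  obtain ⟨h₁, h₂, -, -⟩ := hR.2.2 s t hst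
  by_cases ha : a.Passive
  · obtain ⟨t', ht, h'⟩ := h₁ a s' hs ha
    exact ⟨t', ht, R, hR, h'⟩
  · obtain ⟨t', ht, h'⟩ := h₂ a s' hs ha
    exact ⟨t', ht, R, hR, h'⟩

theorem StarBisimilar.step_env {Γ Δ : Env} {s' : State} {a : Label}
    (h : StarBisimilar (.env Γ) (.env Δ)) (hs : Lts (.env Γ) a s') (ha : a ≠ .tau) :
    ∃ t t', Lts (.env Δ) a t ∧ TauStar t t' ∧ StarBisimilar s' t' := by
  obtain ⟨t', ht, h'⟩ := h.step hs
  obtain ⟨t, h₁, h₂⟩ := ht.of_env ha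
  exact ⟨t, t', h₁, h₂, h'⟩

theorem StarBisimilar.step_stuck {Γ Δ : Env} {e f e' : Exp 0} {E F : ECtx 0}
    (h : StarBisimilar (.of Γ e) (.of Δ f)) (he : IsStuck e)
    (hE : CongCtx False (Env.Paired Γ Δ) E F) (hr : RedBis (E.plug e) e') :
    ∃ f₁ f₂ f', RedsFresh Δ.prompts f f₁ ∧ IsStuck f₁ ∧ RedStar (F.plug f₁) f₂ ∧
      RedStar f₂ f' ∧ StarBisimilar (.of Γ e') (.of Δ f') := by
  obtain ⟨M, hM₁, hM₂⟩ := hE.exists_fill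
  rw [State.of_eq_run Γ he.not_isValue] at h
  obtain ⟨t', ht, h'⟩ := h.step (Lts.stuck Γ e he.not_isValue M E e' he hM₁ hr)
  rcases ht with ⟨h, -⟩ | ⟨-, s, t, h₁, h₂, h₃⟩
  · cases h
  obtain ⟨f₁, rfl, hr₁⟩ := h₁.of_state
  generalize hs : State.of Δ f₁ = s at h₂
  cases h₂ with
  | stuck Δ' f₁' hf₁ _ F' f₂ hst hF hr' =>
    obtain ⟨rfl, rfl⟩ := State.run_eq_of hs.symm
    obtain rfl : F' = F := by rw [hM₂] at hF; exact (Option.some.inj hF).symm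
    obtain ⟨f', rfl, hr₃⟩ := h₃.of_state
    refine ⟨f₁', f₂, f', hr₁, hst, ?_, hr₃.redStar, h'⟩
    rcases hr' with hr' | ⟨-, rfl⟩
    · exact .single hr'
    · exact .refl

/-- Star-bisimilarity of environments of equal length. -/
def EnvBisimilar (Γ Δ : Env) : Prop :=
  Γ.length = Δ.length ∧ StarBisimilar (.env Γ) (.env Δ)

/-- Star-bisimilarity of expressions next to environments of equal length. -/
def RunBisimilar (Γ : Env) (e : Exp 0) (Δ : Env) (f : Exp 0) : Prop :=
  Γ.length = Δ.length ∧ StarBisimilar (.of Γ e) (.of Δ f)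

theorem EnvBisimilar.ctx {Γ Δ : Env} {E : ECtx 0} {v' v w : Val 0} (h : EnvBisimilar Γ Δ)
    (hE : Env.Paired Γ Δ (.cont E) v') (hv : CongVal False (Env.Paired Γ Δ) v w) :
    ∃ F f, v' = .cont F ∧ RedsFresh Δ.prompts (F.plug (.val w)) f ∧
      RunBisimilar Γ (E.plug (.val v)) Δ f := by
  obtain ⟨i, hi, hi'⟩ := hE
  obtain ⟨V, hV, hV'⟩ := hv.exists_fill
  obtain ⟨t, t', h₁, h₂, h₃⟩ := h.2.step_env (.ctx Γ i V E v hi hV) (by simp)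
  cases h₁ with
  | ctx _ _ _ F w' hF hw =>
    obtain ⟨f, rfl, hr⟩ := h₂.of_state
    obtain rfl : w' = w := Option.some.inj (hw.symm.trans hV')
    exact ⟨F, f, Option.some.inj (hi'.symm.trans hF), hr, h.1, h₃⟩

theorem EnvBisimilar.eqPrompt {Γ Δ : Env} {i j : ℕ} {p : Prompt} (h : EnvBisimilar Γ Δ)
    (hi : Γ[i]? = some (.prompt p)) (hj : Γ[j]? = some (.prompt p)) :
    ∃ q, Δ[i]? = some (.prompt q) ∧ Δ[j]? = some (.prompt q) := by
  obtain ⟨t, t', h₁, -, -⟩ := h.2.step_env (.eqPrompt Γ i j p hi hj) (by simp)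
  cases h₁ with
  | eqPrompt _ _ _ q hi' hj' => exact ⟨q, hi', hj'⟩

/-- Related prompts that are equal on the left are equal on the right. -/
theorem EnvBisimilar.eqPrompt' {Γ Δ : Env} {p q p' q' : Prompt} (h : EnvBisimilar Γ Δ)
    (hp : Env.Paired Γ Δ (.prompt p) (.prompt q)) (hp' : Env.Paired Γ Δ (.prompt p') (.prompt q'))
    (hpp' : p = p') : q = q' := by
  subst hpp'
  obtain ⟨i, hi, hi'⟩ := hp
  obtain ⟨j, hj, hj'⟩ := hp'
  obtain ⟨r, hr, hr'⟩ := h.eqPrompt hi hj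
  rw [hr] at hi'
  rw [hr'] at hj'
  simp only [Option.some.injEq, Val.prompt.injEq] at hi' hj'
  exact hi'.symm.trans hj'

/-- The right-hand continuation is determined by the position in the environment, so that the
transition decomposes it. -/
theorem EnvBisimilar.decomp {Γ Δ : Env} {E₁ E₂ F : ECtx 0} {p q : Prompt} (h : EnvBisimilar Γ Δ)
    (hE : Env.Paired Γ Δ (.cont (E₁.comp (.reset p E₂))) (.cont F))
    (hp : Env.Paired Γ Δ (.prompt p) (.prompt q)) (h₂ : p ∉ E₂.surr) :
    ∃ F₁ F₂, F = F₁.comp (.reset q F₂) ∧ q ∉ F₂.surr ∧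
      EnvBisimilar (Γ ++ [.cont E₁, .cont E₂]) (Δ ++ [.cont F₁, .cont F₂]) := by
  obtain ⟨i, hi, hi'⟩ := hE
  obtain ⟨j, hj, hj'⟩ := hp
  obtain ⟨t, t', h₁, h₂, h₃⟩ := h.2.step_env (.decomp Γ i j E₁ E₂ p hi hj h₂) (by simp)
  cases h₁ with
  | decomp _ _ _ F₁ F₂ q' hF hq hF₂ =>
    rw [h₂.of_env] at h₃
    have hq' : q = q' := by
      have := Option.some.inj (hj'.symm.trans hq)
      injection this
    subst hq'
    refine ⟨F₁, F₂, ?_, hF₂, by simp [h.1], h₃⟩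
    have := Option.some.inj (hi'.symm.trans hF)
    injection this

theorem EnvBisimilar.symm {Γ Δ : Env} (h : EnvBisimilar Γ Δ) : EnvBisimilar Δ Γ :=
  ⟨h.1.symm, h.2.symm⟩

/-- Star-bisimilarity satisfies all requirements of a simulation, each by the transition that
tests it. -/
theorem simulation_starBisimilar : Simulation False EnvBisimilar RunBisimilar where
  not_adm _ := id
  length h := h.1
  lam := by
    rintro Γ Δ b v' v w h ⟨i, hi, hi'⟩ hv
    obtain ⟨V, hV, hV'⟩ := hv.exists_fill
    obtain ⟨t, t', h₁, h₂, h₃⟩ := h.2.step_env (.lam Γ i V b v hi hV) (by simp)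
    cases h₁ with
    | lam _ _ _ c w' hc hw =>
      obtain ⟨f, rfl, hr⟩ := h₂.of_state
      obtain rfl : w' = w := Option.some.inj (hw.symm.trans hV')
      exact ⟨c, f, Option.some.inj (hi'.symm.trans hc), hr, h.1, h₃⟩
  cont := by
    intro Γ Δ E v' h hE
    obtain ⟨F, -, hF, -⟩ := h.ctx hE (v := .lam (.val (.var 0))) (.lam (.val (.var 0)))
    exact ⟨F, hF⟩
  ctx := by
    intro Γ Δ E F v w h hE hv
    obtain ⟨F', f, ⟨⟩, hf⟩ := h.ctx hE hv
    exact ⟨f, hf⟩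
  prompt := by
    rintro Γ Δ p v' h ⟨i, hi, hi'⟩
    obtain ⟨q, hq, -⟩ := h.eqPrompt hi hi
    exact ⟨q, Option.some.inj (hi'.symm.trans hq)⟩
  prompt_inj h hp hp' := ⟨h.eqPrompt' hp hp', h.symm.eqPrompt' hp.symm hp'.symm⟩
  newPrompt := by
    intro Γ Δ h X Y hXY
    obtain ⟨p, hp⟩ := exists_prompt_notMem Γ.prompts
    obtain ⟨t, t', h₁, h₂, h₃⟩ := h.2.step_env (.newPrompt Γ p hp) (by simp)
    cases h₁ with
    | newPrompt _ q hq =>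
      rw [h₂.of_env] at h₃
      exact ⟨p, q, fun h => hp ((hXY id).1 h), fun h => hq ((hXY id).2 h), by simp [h.1], h₃⟩
  decomp h hE hp h₂ := h.decomp hE hp h₂
  surr := by
    intro Γ Δ E F p q h hE hp hq
    obtain ⟨F₁, F₂, rfl, h₂⟩ := F.exists_split_of_mem_surr hq
    obtain ⟨E₁, E₂, rfl, -⟩ := h.symm.decomp hE.symm hp.symm h₂
    simp [ECtx.comp_surr, ECtx.surr]
  run_value := by
    rintro Γ Δ v f ⟨hl, h⟩
    -- the transition `val` forces the other side to evaluate to a value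
    obtain ⟨t', ht, h'⟩ := h.step (Lts.val (Γ ++ [v]))
    rcases ht with ⟨h, -⟩ | ⟨-, s, t, h₁, h₂, h₃⟩
    · cases h
    obtain ⟨f₁, rfl, hr⟩ := h₁.of_state
    generalize hs : State.of Δ f₁ = s at h₂
    cases h₂ with
    | val Δ' =>
      obtain ⟨w, rfl, rfl⟩ := State.env_eq_of hs.symm
      rw [h₃.of_env] at h'
      exact ⟨w, hr, by simp [hl], h'⟩
  run_red := by
    rintro Γ Δ e f e' ⟨hl, h⟩ hr
    obtain ⟨e₁, he₁⟩ := hr.exists_redFresh Γ.prompts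
    obtain ⟨t', ht, h'⟩ := h.step he₁.lts
    rcases ht with ⟨-, ht⟩ | ⟨h, -⟩
    · obtain ⟨f₁, rfl, hf⟩ := ht.of_state
      exact ⟨e₁, f₁, he₁, hf, hl, h'⟩
    · exact absurd rfl h
  run_stuck_red := by
    rintro Γ Δ e f E F e' ⟨hl, h⟩ he hE hr
    obtain ⟨f₁, f₂, f', h₁, -, h₂, h₃, h'⟩ := h.step_stuck he hE (.inl hr)
    exact ⟨f', ((h₁.plug (hE.right_prompts id)).redStar.trans h₂).trans h₃, hl, h'⟩
  run_stuck := by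
    rintro Γ Δ e f E F ⟨hl, h⟩ he hE hst
    -- the answer to the test by `F` need not be stuck itself, but it is when tested once more
    -- in the empty context
    have hn : RedBis (E.plug e) (E.plug e) := .inr ⟨observable_isStuck.isNormal hst, rfl⟩
    obtain ⟨f₁, f₂, f', h₁, -, h₂, h₃, h'⟩ := h.step_stuck he hE hn
    obtain ⟨f₁', -, -, h₁', hst', -⟩ := h'.step_stuck hst (E := .hole) .hole hn
    refine reach_iff.2 ⟨f₁', ?_, hst'⟩
    exact (((h₁.plug (hE.right_prompts id)).redStar.trans h₂).trans h₃).trans h₁'.redStar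

/-- Star-bisimilarity is sound for contextual equivalence. -/
theorem StarBisimilar.ctxEq {e₁ e₂ : Exp 0} (h : StarBisimilar (.of [] e₁) (.of [] e₂)) :
    CtxEq e₁ e₂ := by
  have key : ∀ {e₁ e₂ : Exp 0} {E : ECtx 0}, StarBisimilar (.of [] e₁) (.of [] e₂) →
      E.prompts = ∅ → Closure False EnvBisimilar RunBisimilar (E.plug e₁) (E.plug e₂) :=
    fun h hE => .inr ⟨[], [], _, _, _, _, ⟨rfl, h⟩, .refl _ (by simp [hE]), rfl, rfl⟩
  intro E hE
  exact obsEq_iff.2 fun P hP => ⟨(key h hE).reach simulation_starBisimilar hP,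
    (key h.symm hE).reach simulation_starBisimilar hP⟩

/-! ### Administrative equivalence -/

/-- The identity relation on prompts. -/
def PromptId (v w : Val 0) : Prop := ∃ p, v = .prompt p ∧ w = .prompt p

/-- Environments made of prompts, related to themselves, form a simulation for which the
administrative rules are allowed: no test on a λ-abstraction or on a continuation applies. -/
theorem simulation_prompts :
    Simulation True (fun Γ Δ => Γ = Δ ∧ ∀ v ∈ Γ, ∃ p, v = .prompt p) (fun _ _ _ _ => False) where
  not_adm h := h.elim
  length h := h.1 ▸ rfl
  lam := by
    rintro Γ _ b v' v w ⟨rfl, h⟩ ⟨i, hi, -⟩ -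
    obtain ⟨p, hp⟩ := h _ (List.mem_of_getElem? hi)
    cases hp
  cont := by
    rintro Γ _ E v' ⟨rfl, h⟩ ⟨i, hi, -⟩
    obtain ⟨p, hp⟩ := h _ (List.mem_of_getElem? hi)
    cases hp
  ctx := by
    rintro Γ _ E F v w ⟨rfl, h⟩ ⟨i, hi, -⟩ -
    obtain ⟨p, hp⟩ := h _ (List.mem_of_getElem? hi)
    cases hp
  prompt := by
    rintro Γ _ p v' ⟨rfl, h⟩ ⟨i, hi, hi'⟩
    exact ⟨p, Option.some.inj (hi'.symm.trans hi)⟩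
  prompt_inj := by
    rintro Γ _ p q p' q' ⟨rfl, h⟩ ⟨i, hi, hi'⟩ ⟨j, hj, hj'⟩
    have h₁ := Option.some.inj (hi'.symm.trans hi)
    have h₂ := Option.some.inj (hj'.symm.trans hj)
    cases h₁
    cases h₂
    rfl
  newPrompt := by
    rintro Γ _ ⟨rfl, h⟩ X Y -
    obtain ⟨p, hp⟩ := exists_prompt_notMem (X ∪ Y)
    simp only [Finset.mem_union, not_or] at hp
    refine ⟨p, p, hp.1, hp.2, rfl, fun v hv => ?_⟩
    rcases List.mem_append.1 hv with hv | hv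
    · exact h v hv
    · exact ⟨p, List.mem_singleton.1 hv⟩
  decomp := by
    rintro Γ _ E₁ E₂ F p q ⟨rfl, h⟩ ⟨i, hi, -⟩
    obtain ⟨p, hp⟩ := h _ (List.mem_of_getElem? hi)
    cases hp
  surr := by
    rintro Γ _ E F p q ⟨rfl, h⟩ ⟨i, hi, -⟩
    obtain ⟨p, hp⟩ := h _ (List.mem_of_getElem? hi)
    cases hp
  run_value h := h.elim
  run_red h := h.elim
  run_stuck_red h := h.elim
  run_stuck h := h.elim

mutual

/-- Only finitely many prompts are used to relate two expressions. -/
theorem CongExp.exists_finset {adm : Prop} : ∀ {n : ℕ} {e f : Exp n}, CongExp adm PromptId e f →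
    ∃ S : Finset Prompt, ∀ H : Val 0 → Val 0 → Prop, (∀ p ∈ S, H (.prompt p) (.prompt p)) →
      CongExp adm H e f
  | _, _, _, .val hv => by
    obtain ⟨S, h⟩ := hv.exists_finset
    exact ⟨S, fun H hH => .val (h H hH)⟩
  | _, _, _, .app h h' => by
    obtain ⟨S, h⟩ := h.exists_finset
    obtain ⟨S', h'⟩ := h'.exists_finset
    exact ⟨S ∪ S', fun H hH => .app (h H fun p hp => hH p (Finset.mem_union_left _ hp))
      (h' H fun p hp => hH p (Finset.mem_union_right _ hp))⟩
  | _, _, _, .fresh h => by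
    obtain ⟨S, h⟩ := h.exists_finset
    exact ⟨S, fun H hH => .fresh (h H hH)⟩
  | _, _, _, .reset h h' => by
    obtain ⟨S, h⟩ := h.exists_finset
    obtain ⟨S', h'⟩ := h'.exists_finset
    exact ⟨S ∪ S', fun H hH => .reset (h H fun p hp => hH p (Finset.mem_union_left _ hp))
      (h' H fun p hp => hH p (Finset.mem_union_right _ hp))⟩
  | _, _, _, .grab h h' => by
    obtain ⟨S, h⟩ := h.exists_finset
    obtain ⟨S', h'⟩ := h'.exists_finset
    exact ⟨S ∪ S', fun H hH => .grab (h H fun p hp => hH p (Finset.mem_union_left _ hp))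
      (h' H fun p hp => hH p (Finset.mem_union_right _ hp))⟩
  | _, _, _, .push h h' => by
    obtain ⟨S, h⟩ := h.exists_finset
    obtain ⟨S', h'⟩ := h'.exists_finset
    exact ⟨S ∪ S', fun H hH => .push (h H fun p hp => hH p (Finset.mem_union_left _ hp))
      (h' H fun p hp => hH p (Finset.mem_union_right _ hp))⟩
  | _, _, _, .star ⟨_, h, _⟩ _ => by cases h
  | _, _, _, .throwL ha h h' => by
    obtain ⟨S, h⟩ := h.exists_finset
    obtain ⟨S', h'⟩ := h'.exists_finset
    exact ⟨S ∪ S', fun H hH => .throwL ha (h H fun p hp => hH p (Finset.mem_union_left _ hp))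
      (h' H fun p hp => hH p (Finset.mem_union_right _ hp))⟩
  | _, _, _, .throwR ha h h' => by
    obtain ⟨S, h⟩ := h.exists_finset
    obtain ⟨S', h'⟩ := h'.exists_finset
    exact ⟨S ∪ S', fun H hH => .throwR ha (h H fun p hp => hH p (Finset.mem_union_left _ hp))
      (h' H fun p hp => hH p (Finset.mem_union_right _ hp))⟩
  | _, _, _, .reifyL ha h => by
    obtain ⟨S, h⟩ := h.exists_finset
    exact ⟨S, fun H hH => .reifyL ha (h H hH)⟩
  | _, _, _, .reifyR ha h => by
    obtain ⟨S, h⟩ := h.exists_finset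
    exact ⟨S, fun H hH => .reifyR ha (h H hH)⟩
  | _, _, _, .badReset ha hv hw => ⟨∅, fun _ _ => .badReset ha hv hw⟩
  | _, _, _, .badGrab ha hv hw => ⟨∅, fun _ _ => .badGrab ha hv hw⟩

theorem CongVal.exists_finset {adm : Prop} : ∀ {n : ℕ} {v w : Val n}, CongVal adm PromptId v w →
    ∃ S : Finset Prompt, ∀ H : Val 0 → Val 0 → Prop, (∀ p ∈ S, H (.prompt p) (.prompt p)) →
      CongVal adm H v w
  | _, _, _, .var x => ⟨∅, fun _ _ => .var x⟩
  | _, _, _, .lam h => by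
    obtain ⟨S, h⟩ := h.exists_finset
    exact ⟨S, fun H hH => .lam (h H hH)⟩
  | _, _, _, .cont h => by
    obtain ⟨S, h⟩ := h.exists_finset
    exact ⟨S, fun H hH => .cont (h H hH)⟩
  | _, _, _, .hole ⟨p, hv, hw⟩ => by
    subst hv hw
    exact ⟨{p}, fun H hH => .hole (hH p (Finset.mem_singleton_self p))⟩

theorem CongCtx.exists_finset {adm : Prop} : ∀ {n : ℕ} {E F : ECtx n}, CongCtx adm PromptId E F →
    ∃ S : Finset Prompt, ∀ H : Val 0 → Val 0 → Prop, (∀ p ∈ S, H (.prompt p) (.prompt p)) →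
      CongCtx adm H E F
  | _, _, _, .hole => ⟨∅, fun _ _ => .hole⟩
  | _, _, _, .appL h h' => by
    obtain ⟨S, h⟩ := h.exists_finset
    obtain ⟨S', h'⟩ := h'.exists_finset
    exact ⟨S ∪ S', fun H hH => .appL (h H fun p hp => hH p (Finset.mem_union_left _ hp))
      (h' H fun p hp => hH p (Finset.mem_union_right _ hp))⟩
  | _, _, _, .appR h h' => by
    obtain ⟨S, h⟩ := h.exists_finset
    obtain ⟨S', h'⟩ := h'.exists_finset
    exact ⟨S ∪ S', fun H hH => .appR (h H fun p hp => hH p (Finset.mem_union_left _ hp))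
      (h' H fun p hp => hH p (Finset.mem_union_right _ hp))⟩
  | _, _, _, .reset (p := p) ⟨p', hp, hq⟩ h => by
    cases hp
    cases hq
    obtain ⟨S, h⟩ := h.exists_finset
    exact ⟨{p} ∪ S, fun H hH => .reset
      (hH p (Finset.mem_union_left _ (Finset.mem_singleton_self p)))
      (h H fun p hp => hH p (Finset.mem_union_right _ hp))⟩
  | _, _, _, .star ⟨_, h, _⟩ _ => by cases h

end

/-- One use of the administrative rules does not change the observables. -/
theorem CongExp.sameObs {e f : Exp 0} (h : CongExp True PromptId e f) : SameObs e f := by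
  have key : ∀ {e f : Exp 0}, CongExp True PromptId e f →
      Closure True (fun Γ Δ => Γ = Δ ∧ ∀ v ∈ Γ, ∃ p, v = .prompt p) (fun _ _ _ _ => False) e f := by
    intro e f h
    obtain ⟨S, h⟩ := h.exists_finset
    refine .inl ⟨S.toList.map .prompt, _, ⟨rfl, fun v hv => ?_⟩, h _ fun p hp => ?_⟩
    · obtain ⟨p, -, rfl⟩ := List.mem_map.1 hv
      exact ⟨p, rfl⟩
    · obtain ⟨i, hi⟩ := List.mem_iff_getElem?.1
        (List.mem_map_of_mem (f := Val.prompt (n := 0)) (Finset.mem_toList.2 hp))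
      exact ⟨i, hi, hi⟩
  have hsymm : ∀ v w, PromptId v w → PromptId w v := fun _ _ ⟨p, hv, hw⟩ => ⟨p, hw, hv⟩
  exact fun P hP => ⟨(key h).reach simulation_prompts hP,
    (key (h.symm hsymm)).reach simulation_prompts hP⟩

/-- Administrative equivalence: the equivalence generated by the administrative rules,
applied anywhere in an expression. -/
abbrev AdmEq {n : ℕ} : Exp n → Exp n → Prop := Relation.EqvGen (CongExp True PromptId)

/-- Administrative equivalence of values. -/
abbrev AdmEqVal {n : ℕ} : Val n → Val n → Prop := Relation.EqvGen (CongVal True PromptId)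

theorem AdmEq.sameObs {e f : Exp 0} (h : AdmEq e f) : SameObs e f := by
  induction h with
  | rel _ _ h => exact h.sameObs
  | refl e => exact .refl e
  | symm _ _ _ ih => exact ih.symm
  | trans _ _ _ _ _ ih ih' => exact ih.trans ih'

theorem eqvGen_map {α β : Type*} {r : α → α → Prop} {s : β → β → Prop} (g : α → β)
    (hg : ∀ a b, r a b → s (g a) (g b)) {a b : α} (h : Relation.EqvGen r a b) :
    Relation.EqvGen s (g a) (g b) := by
  induction h with
  | rel _ _ h => exact .rel _ _ (hg _ _ h)
  | refl a => exact .refl _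
  | symm _ _ _ ih => exact .symm _ _ ih
  | trans _ _ _ _ _ ih ih' => exact .trans _ _ _ ih ih'

theorem CongExp.promptId_refl {adm : Prop} {n : ℕ} (e : Exp n) : CongExp adm PromptId e e :=
  .refl e fun p _ => ⟨p, rfl, rfl⟩

theorem CongVal.promptId_refl {adm : Prop} {n : ℕ} (v : Val n) : CongVal adm PromptId v v :=
  .refl v fun p _ => ⟨p, rfl, rfl⟩

theorem CongCtx.promptId_refl {adm : Prop} {n : ℕ} (E : ECtx n) : CongCtx adm PromptId E E :=
  .refl E fun p _ => ⟨p, rfl, rfl⟩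

section AdmEq

variable {n m : ℕ}

theorem AdmEq.val {v w : Val n} (h : AdmEqVal v w) : AdmEq (.val v) (.val w) :=
  eqvGen_map Exp.val (fun _ _ h => .val h) h

theorem AdmEq.app {e₁ e₂ f₁ f₂ : Exp n} (h₁ : AdmEq e₁ f₁) (h₂ : AdmEq e₂ f₂) :
    AdmEq (.app e₁ e₂) (.app f₁ f₂) :=
  .trans _ _ _ (eqvGen_map (Exp.app · e₂) (fun _ _ h => .app h (.promptId_refl _)) h₁)
    (eqvGen_map (Exp.app f₁ ·) (fun _ _ h => .app (.promptId_refl _) h) h₂)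

theorem AdmEq.fresh {e f : Exp (n + 1)} (h : AdmEq e f) : AdmEq (.fresh e) (.fresh f) :=
  eqvGen_map Exp.fresh (fun _ _ h => .fresh h) h

theorem AdmEqVal.lam {e f : Exp (n + 1)} (h : AdmEq e f) : AdmEqVal (.lam e) (.lam f) :=
  eqvGen_map Val.lam (fun _ _ h => .lam h) h

theorem AdmEq.reset {v w : Val n} {e f : Exp n} (hv : AdmEqVal v w) (h : AdmEq e f) :
    AdmEq (.reset v e) (.reset w f) :=
  .trans _ _ _ (eqvGen_map (Exp.reset · e) (fun _ _ h => .reset h (.promptId_refl _)) hv)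
    (eqvGen_map (Exp.reset w ·) (fun _ _ h => .reset (.promptId_refl _) h) h)

theorem AdmEq.grab {v w : Val n} {e f : Exp (n + 1)} (hv : AdmEqVal v w) (h : AdmEq e f) :
    AdmEq (.grab v e) (.grab w f) :=
  .trans _ _ _ (eqvGen_map (Exp.grab · e) (fun _ _ h => .grab h (.promptId_refl _)) hv)
    (eqvGen_map (Exp.grab w ·) (fun _ _ h => .grab (.promptId_refl _) h) h)

theorem AdmEq.push {v w : Val n} {e f : Exp n} (hv : AdmEqVal v w) (h : AdmEq e f) :
    AdmEq (.push v e) (.push w f) :=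
  .trans _ _ _ (eqvGen_map (Exp.push · e) (fun _ _ h => .push h (.promptId_refl _)) hv)
    (eqvGen_map (Exp.push w ·) (fun _ _ h => .push (.promptId_refl _) h) h)

theorem AdmEq.rename (ρ : Fin n → Fin m) {e f : Exp n} (h : AdmEq e f) :
    AdmEq (e.rename ρ) (f.rename ρ) :=
  eqvGen_map (Exp.rename ρ) (fun _ _ h => h.rename ρ) h

theorem AdmEq.subst (σ : Fin n → Val m) {e f : Exp n} (h : AdmEq e f) :
    AdmEq (e.subst σ) (f.subst σ) :=
  eqvGen_map (Exp.subst σ) (fun _ _ h => h.subst fun _ => .promptId_refl _) h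

theorem admEq_throw (E : ECtx n) (e : Exp n) : AdmEq (.push (.cont E) e) (E.plug e) :=
  .rel _ _ (.throwL trivial (.promptId_refl E) (.promptId_refl e))

theorem admEq_reify (E : ECtx n) : AdmEq E.reify (.val (.cont E)) :=
  .rel _ _ (.reifyL trivial (.promptId_refl E))

end AdmEq

/-! ### Abstraction of the last value of an environment -/

/-- The substitution of a closed value for the last variable. -/
def lastSub (v : Val 0) {n : ℕ} : Fin (n + 1) → Val n := Fin.lastCases v.weaken Val.var

@[simp] theorem lastSub_last (v : Val 0) {n : ℕ} : lastSub v (Fin.last n) = v.weaken :=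
  Fin.lastCases_last

@[simp] theorem lastSub_castSucc (v : Val 0) {n : ℕ} (i : Fin n) :
    lastSub v i.castSucc = .var i :=
  Fin.lastCases_castSucc i

theorem liftSub_lastSub (v : Val 0) {n : ℕ} : liftSub (lastSub v (n := n)) = lastSub v := by
  funext i
  cases i using Fin.lastCases with
  | last => rw [← Fin.succ_last, liftSub_succ, lastSub_last, Fin.succ_last, lastSub_last,
      Val.weaken_rename]
  | cast i =>
    rw [lastSub_castSucc]
    cases i using Fin.cases with
    | zero => rfl
    | succ i => rw [← Fin.succ_castSucc, liftSub_succ, lastSub_castSucc]; rfl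

/-- Extension of a renaming by a new last variable. -/
def lastRen {n m : ℕ} (ρ : Fin n → Fin m) : Fin (n + 1) → Fin (m + 1) :=
  Fin.lastCases (Fin.last m) fun i => (ρ i).castSucc

theorem Exp.lastRen_lastSub (v : Val 0) {n m : ℕ} (ρ : Fin n → Fin m) (e : Exp (n + 1)) :
    (e.rename (lastRen ρ)).subst (lastSub v) = (e.subst (lastSub v)).rename ρ := by
  rw [Exp.subst_rename, Exp.rename_subst]
  congr 1
  funext i
  cases i using Fin.lastCases with
  | last => simp [lastRen]
  | cast i => simp [lastRen, Val.rename]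

/-- Related values over `Γ, v` and `Δ, w` that arise from related values over `Γ` and `Δ` by
substituting `v` and `w` for a variable. -/
def AbsVal (Γ Δ : Env) (v w : Val 0) {n : ℕ} (a b : Val n) : Prop :=
  ∃ a' b' : Val (n + 1), CongVal False (Env.Paired Γ Δ) a' b' ∧
    AdmEqVal (a'.subst (lastSub v)) a ∧ AdmEqVal (b'.subst (lastSub w)) b

/-- Related expressions over `Γ, v` and `Δ, w` that arise, up to administrative equivalence,
from related expressions over `Γ` and `Δ` by substituting `v` and `w` for a variable. -/
def AbsExp (Γ Δ : Env) (v w : Val 0) {n : ℕ} (e f : Exp n) : Prop :=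
  ∃ e' f' : Exp (n + 1), CongExp False (Env.Paired Γ Δ) e' f' ∧
    AdmEq (e'.subst (lastSub v)) e ∧ AdmEq (f'.subst (lastSub w)) f

/-- Evaluation contexts in which the value can be abstracted as soon as they are plugged. A
context itself cannot be abstracted, as its delimiters are prompts and not variables. -/
def AbsCtx (Γ Δ : Env) (v w : Val 0) {n : ℕ} (E F : ECtx n) : Prop :=
  ∀ {m : ℕ} (ρ : Fin n → Fin m) {e f : Exp m}, AbsExp Γ Δ v w e f →
    AbsExp Γ Δ v w ((E.rename ρ).plug e) ((F.rename ρ).plug f)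

section Abstraction

variable {Γ Δ : Env} {v w : Val 0} {n m : ℕ}

theorem AbsExp.rename {e f : Exp n} (h : AbsExp Γ Δ v w e f) (ρ : Fin n → Fin m) :
    AbsExp Γ Δ v w (e.rename ρ) (f.rename ρ) := by
  obtain ⟨e', f', h₁, h₂, h₃⟩ := h
  refine ⟨_, _, h₁.rename (lastRen ρ), ?_, ?_⟩ <;> rw [Exp.lastRen_lastSub]
  · exact h₂.rename ρ
  · exact h₃.rename ρ

theorem AbsExp.of_admEq {e e' f f' : Exp n} (h : AbsExp Γ Δ v w e f) (he : AdmEq e e')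
    (hf : AdmEq f f') : AbsExp Γ Δ v w e' f' := by
  obtain ⟨e₀, f₀, h₁, h₂, h₃⟩ := h
  exact ⟨e₀, f₀, h₁, h₂.trans _ _ _ he, h₃.trans _ _ _ hf⟩

theorem AbsExp.val {a b : Val n} (h : AbsVal Γ Δ v w a b) :
    AbsExp Γ Δ v w (.val a) (.val b) := by
  obtain ⟨a', b', h₁, h₂, h₃⟩ := h
  exact ⟨_, _, .val h₁, .val h₂, .val h₃⟩

theorem AbsExp.app {e₁ e₂ f₁ f₂ : Exp n} (h : AbsExp Γ Δ v w e₁ f₁)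
    (h' : AbsExp Γ Δ v w e₂ f₂) : AbsExp Γ Δ v w (.app e₁ e₂) (.app f₁ f₂) := by
  obtain ⟨_, _, h₁, h₂, h₃⟩ := h
  obtain ⟨_, _, h₁', h₂', h₃'⟩ := h'
  exact ⟨_, _, .app h₁ h₁', .app h₂ h₂', .app h₃ h₃'⟩

theorem AbsExp.fresh {e f : Exp (n + 1)} (h : AbsExp Γ Δ v w e f) :
    AbsExp Γ Δ v w (.fresh e) (.fresh f) := by
  obtain ⟨e', f', h₁, h₂, h₃⟩ := h
  refine ⟨_, _, .fresh h₁, ?_, ?_⟩ <;> rw [Exp.subst, liftSub_lastSub]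
  · exact .fresh h₂
  · exact .fresh h₃

theorem AbsVal.lam {e f : Exp (n + 1)} (h : AbsExp Γ Δ v w e f) :
    AbsVal Γ Δ v w (.lam e) (.lam f) := by
  obtain ⟨e', f', h₁, h₂, h₃⟩ := h
  refine ⟨_, _, .lam h₁, ?_, ?_⟩ <;> rw [Val.subst, liftSub_lastSub]
  · exact .lam h₂
  · exact .lam h₃

theorem AbsExp.reset {a b : Val n} {e f : Exp n} (h : AbsVal Γ Δ v w a b)
    (h' : AbsExp Γ Δ v w e f) : AbsExp Γ Δ v w (.reset a e) (.reset b f) := by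
  obtain ⟨_, _, h₁, h₂, h₃⟩ := h
  obtain ⟨_, _, h₁', h₂', h₃'⟩ := h'
  exact ⟨_, _, .reset h₁ h₁', .reset h₂ h₂', .reset h₃ h₃'⟩

theorem AbsExp.push {a b : Val n} {e f : Exp n} (h : AbsVal Γ Δ v w a b)
    (h' : AbsExp Γ Δ v w e f) : AbsExp Γ Δ v w (.push a e) (.push b f) := by
  obtain ⟨_, _, h₁, h₂, h₃⟩ := h
  obtain ⟨_, _, h₁', h₂', h₃'⟩ := h'
  exact ⟨_, _, .push h₁ h₁', .push h₂ h₂', .push h₃ h₃'⟩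

theorem AbsExp.grab {a b : Val n} {e f : Exp (n + 1)} (h : AbsVal Γ Δ v w a b)
    (h' : AbsExp Γ Δ v w e f) : AbsExp Γ Δ v w (.grab a e) (.grab b f) := by
  obtain ⟨a', b', h₁, h₂, h₃⟩ := h
  obtain ⟨e', f', h₁', h₂', h₃'⟩ := h'
  refine ⟨_, _, .grab h₁ h₁', ?_, ?_⟩ <;> rw [Exp.subst, liftSub_lastSub]
  · exact .grab h₂ h₂'
  · exact .grab h₃ h₃'

theorem AbsVal.var (x : Fin n) : AbsVal Γ Δ v w (.var x) (.var x) := by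
  refine ⟨_, _, .var x.castSucc, ?_, ?_⟩ <;> rw [Val.subst, lastSub_castSucc] <;> exact .refl _

theorem Env.Paired.of_concat (hl : Γ.length = Δ.length) {a b : Val 0}
    (h : Env.Paired (Γ ++ [v]) (Δ ++ [w]) a b) : Env.Paired Γ Δ a b ∨ a = v ∧ b = w := by
  obtain ⟨i, hi, hi'⟩ := h
  rcases lt_trichotomy i Γ.length with h | rfl | h
  · rw [List.getElem?_append_left h] at hi
    rw [List.getElem?_append_left (hl ▸ h)] at hi'
    exact .inl ⟨i, hi, hi'⟩
  · refine .inr ⟨?_, ?_⟩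
    · simpa using hi.symm
    · rw [hl] at hi'
      simpa using hi'.symm
  · rw [List.getElem?_eq_none (by simpa using h)] at hi
    cases hi

theorem AbsVal.hole (hl : Γ.length = Δ.length) {a b : Val 0}
    (h : Env.Paired (Γ ++ [v]) (Δ ++ [w]) a b) :
    AbsVal Γ Δ v w (a.weaken : Val n) b.weaken := by
  rcases h.of_concat hl with h | ⟨rfl, rfl⟩
  · exact ⟨_, _, .hole h, by rw [Val.weaken_subst]; exact .refl _,
      by rw [Val.weaken_subst]; exact .refl _⟩
  · refine ⟨_, _, .var (Fin.last n), ?_, ?_⟩ <;> rw [Val.subst, lastSub_last] <;> exact .refl _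

/-- Abstraction for plugging: `E[e]` is computed by `⌜E⌝ ◁ e`. -/
theorem AbsExp.star (hl : Γ.length = Δ.length) {E F : ECtx 0} {e f : Exp n}
    (h : Env.Paired (Γ ++ [v]) (Δ ++ [w]) (.cont E) (.cont F)) (h' : AbsExp Γ Δ v w e f) :
    AbsExp Γ Δ v w (E.weaken.plug e) (F.weaken.plug f) :=
  (AbsExp.push (AbsVal.hole hl h) h').of_admEq (admEq_throw _ _) (admEq_throw _ _)

/-- Abstraction for continuations: `⌜E⌝` is computed by capturing `E`. -/
theorem AbsExp.cont {E F : ECtx n} (h : AbsCtx Γ Δ v w E F) :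
    AbsExp Γ Δ v w (.val (.cont E)) (.val (.cont F)) :=
  (AbsExp.fresh (.reset (.var 0)
    (h Fin.succ (.grab (.var 0) (.val (.var 0)))))).of_admEq (admEq_reify E) (admEq_reify F)

theorem Val.isInert_lam (e : Exp (n + 1)) : (Val.lam e).IsInert := by
  simp only [Val.IsInert]

/-- A delimiter at a λ-abstraction or a continuation is an error whatever the components are, so
that it can be replaced by one without holes. This covers values that cannot be abstracted as
values, namely the continuations. -/
theorem AbsExp.badReset {a b : Val n} {e f : Exp n} (ha : a.IsInert) (hb : b.IsInert) :
    AbsExp Γ Δ v w (.reset a e) (.reset b f) :=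
  (AbsExp.reset (.lam (.val (.var 0))) (.val (.lam (.val (.var 0))))).of_admEq
    (.rel _ _ (.badReset trivial (Val.isInert_lam _) ha))
    (.rel _ _ (.badReset trivial (Val.isInert_lam _) hb))

theorem AbsExp.badGrab {a b : Val n} {e f : Exp (n + 1)} (ha : a.IsInert) (hb : b.IsInert) :
    AbsExp Γ Δ v w (.grab a e) (.grab b f) :=
  (AbsExp.grab (.lam (.val (.var 0))) (.val (.var 0))).of_admEq
    (.rel _ _ (.badGrab trivial (Val.isInert_lam _) ha)) (.rel _ _ (.badGrab trivial (Val.isInert_lam _) hb))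

theorem AbsExp.of_val {a b : Val n}
    (h : AbsVal Γ Δ v w a b ∨ ∃ E F, a = .cont E ∧ b = .cont F ∧ AbsCtx Γ Δ v w E F) :
    AbsExp Γ Δ v w (.val a) (.val b) := by
  rcases h with h | ⟨E, F, rfl, rfl, h⟩
  · exact .val h
  · exact .cont h

mutual

/-- The last values of the environments can be abstracted from all related expressions. -/
theorem CongExp.abs (hl : Γ.length = Δ.length) : ∀ {n : ℕ} {e f : Exp n},
    CongExp False (Env.Paired (Γ ++ [v]) (Δ ++ [w])) e f → AbsExp Γ Δ v w e f
  | _, _, _, .val hv => .of_val (hv.abs hl)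
  | _, _, _, .app h h' => .app (h.abs hl) (h'.abs hl)
  | _, _, _, .fresh h => .fresh (h.abs hl)
  | _, _, _, .reset hv h => by
    rcases hv.abs hl with hv' | ⟨E, F, rfl, rfl, -⟩
    · exact .reset hv' (h.abs hl)
    · exact .badReset trivial trivial
  | _, _, _, .grab hv h => by
    rcases hv.abs hl with hv' | ⟨E, F, rfl, rfl, -⟩
    · exact .grab hv' (h.abs hl)
    · exact .badGrab trivial trivial
  | _, _, _, .push hv h => by
    rcases hv.abs hl with hv' | ⟨E, F, rfl, rfl, hE⟩
    · exact .push hv' (h.abs hl)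
    · have := hE id (h.abs hl)
      rw [ECtx.rename_id, ECtx.rename_id] at this
      exact this.of_admEq (.symm _ _ (admEq_throw _ _)) (.symm _ _ (admEq_throw _ _))
  | _, _, _, .star hE h => .star hl hE (h.abs hl)

/-- Abstraction for values. A continuation need not be administratively equivalent to an
abstracted value; only the expression that returns it can be abstracted. -/
theorem CongVal.abs (hl : Γ.length = Δ.length) : ∀ {n : ℕ} {a b : Val n},
    CongVal False (Env.Paired (Γ ++ [v]) (Δ ++ [w])) a b →
    AbsVal Γ Δ v w a b ∨ ∃ E F, a = .cont E ∧ b = .cont F ∧ AbsCtx Γ Δ v w E F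
  | _, _, _, .var x => .inl (.var x)
  | _, _, _, .lam h => .inl (.lam (h.abs hl))
  | _, _, _, .cont hE => .inr ⟨_, _, rfl, rfl, hE.abs hl⟩
  | _, _, _, .hole h => .inl (.hole hl h)

theorem CongCtx.abs (hl : Γ.length = Δ.length) : ∀ {n : ℕ} {E F : ECtx n},
    CongCtx False (Env.Paired (Γ ++ [v]) (Δ ++ [w])) E F → AbsCtx Γ Δ v w E F
  | _, _, _, .hole => fun _ _ _ h => h
  | _, _, _, .appL hE h => fun ρ _ _ h' => .app (hE.abs hl ρ h') ((h.abs hl).rename ρ)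
  | _, _, _, .appR hv hE => fun ρ _ _ h' =>
    .app ((AbsExp.of_val (hv.abs hl)).rename ρ) (hE.abs hl ρ h')
  | _, _, _, .reset hp hE => fun ρ _ _ h' => .reset (AbsVal.hole hl hp) (hE.abs hl ρ h')
  | _, _, _, .star h₀ hE => fun ρ _ _ h' => by
    rw [ECtx.comp_rename, ECtx.comp_rename, ECtx.comp_plug, ECtx.comp_plug, ECtx.weaken_rename,
      ECtx.weaken_rename]
    exact .star hl h₀ (hE.abs hl ρ h')

end

end Abstraction

/-! ### Indistinguishable environments -/

/-- The syntactic class of a value. -/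
def Val.kind {n : ℕ} : Val n → ℕ
  | .var _ => 0
  | .lam _ => 1
  | .prompt _ => 2
  | .cont _ => 3

/-- Environments of the same length whose values are of the same kinds. -/
def Env.SameKinds (Γ Δ : Env) : Prop := Γ.map Val.kind = Δ.map Val.kind

/-- No pair of fillings of one expression context by the two environments can be
distinguished. -/
def Indist (Γ Δ : Env) : Prop :=
  ∀ a b : Exp 0, CongExp False (Env.Paired Γ Δ) a b → SameObs a b

/-- The analogue of `Indist` for an expression over each environment: no pair of fillings of one
evaluation context distinguishes the two expressions. -/
def IndistExp (Γ : Env) (e : Exp 0) (Δ : Env) (f : Exp 0) : Prop :=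
  Env.SameKinds Γ Δ ∧
    ∀ E F : ECtx 0, CongCtx False (Env.Paired Γ Δ) E F → SameObs (E.plug e) (F.plug f)

section SameKinds

variable {Γ Δ : Env}

theorem Env.SameKinds.length_eq (h : Env.SameKinds Γ Δ) : Γ.length = Δ.length := by
  simpa using congrArg List.length h

theorem Env.SameKinds.symm (h : Env.SameKinds Γ Δ) : Env.SameKinds Δ Γ := Eq.symm h

theorem Env.SameKinds.concat (h : Env.SameKinds Γ Δ) {v w : Val 0} (hv : v.kind = w.kind) :
    Env.SameKinds (Γ ++ [v]) (Δ ++ [w]) := by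
  simp only [Env.SameKinds, List.map_append, List.map_cons, List.map_nil, hv] at *
  rw [h]

theorem Env.SameKinds.exists_getElem? (h : Env.SameKinds Γ Δ) {i : ℕ} {v : Val 0}
    (hi : Γ[i]? = some v) : ∃ w, Δ[i]? = some w ∧ v.kind = w.kind := by
  have := congrArg (fun l => l[i]?) h
  simp only [List.getElem?_map, hi, Option.map_some] at this
  obtain ⟨w, hw, hk⟩ := Option.map_eq_some_iff.1 this.symm
  exact ⟨w, hw, hk.symm⟩

theorem Env.SameKinds.exists_lam (h : Env.SameKinds Γ Δ) {i : ℕ} {e : Exp 1}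
    (hi : Γ[i]? = some (.lam e)) : ∃ f, Δ[i]? = some (.lam f) := by
  obtain ⟨w, hw, hk⟩ := h.exists_getElem? hi
  cases w <;> first | exact ⟨_, hw⟩ | cases hk

theorem Env.SameKinds.exists_prompt (h : Env.SameKinds Γ Δ) {i : ℕ} {p : Prompt}
    (hi : Γ[i]? = some (.prompt p)) : ∃ q, Δ[i]? = some (.prompt q) := by
  obtain ⟨w, hw, hk⟩ := h.exists_getElem? hi
  cases w <;> first | exact ⟨_, hw⟩ | cases hk

theorem Env.SameKinds.exists_cont (h : Env.SameKinds Γ Δ) {i : ℕ} {E : ECtx 0}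
    (hi : Γ[i]? = some (.cont E)) : ∃ F, Δ[i]? = some (.cont F) := by
  obtain ⟨w, hw, hk⟩ := h.exists_getElem? hi
  cases w <;> first | exact ⟨_, hw⟩ | cases hk

mutual

/-- Filling a context is defined for one of two environments of the same kinds if it is for the
other one. -/
theorem MCtx.fill_cong (h : Env.SameKinds Γ Δ) {n : ℕ} : ∀ (C : MCtx n) {e : Exp n},
    C.fill Γ = some e → ∃ f, C.fill Δ = some f ∧ CongExp False (Env.Paired Γ Δ) e f
  | .val V, e, he => by
    simp only [MCtx.fill, Option.bind_eq_some_iff, Option.some.injEq] at he ⊢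
    obtain ⟨v, hv, rfl⟩ := he
    obtain ⟨w, hw, hvw⟩ := V.fill_cong h hv
    exact ⟨_, ⟨w, hw, rfl⟩, .val hvw⟩
  | .app C₁ C₂, e, he => by
    simp only [MCtx.fill, Option.bind_eq_some_iff, Option.some.injEq] at he ⊢
    obtain ⟨e₁, h₁, e₂, h₂, rfl⟩ := he
    obtain ⟨f₁, h₁', hc₁⟩ := C₁.fill_cong h h₁
    obtain ⟨f₂, h₂', hc₂⟩ := C₂.fill_cong h h₂
    exact ⟨_, ⟨_, h₁', _, h₂', rfl⟩, .app hc₁ hc₂⟩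
  | .fresh C, e, he => by
    simp only [MCtx.fill, Option.bind_eq_some_iff, Option.some.injEq] at he ⊢
    obtain ⟨e₁, h₁, rfl⟩ := he
    obtain ⟨f₁, h₁', hc₁⟩ := C.fill_cong h h₁
    exact ⟨_, ⟨_, h₁', rfl⟩, .fresh hc₁⟩
  | .reset V C, e, he => by
    simp only [MCtx.fill, Option.bind_eq_some_iff, Option.some.injEq] at he ⊢
    obtain ⟨v, hv, e₂, h₂, rfl⟩ := he
    obtain ⟨w, hw, hvw⟩ := V.fill_cong h hv
    obtain ⟨f₂, h₂', hc₂⟩ := C.fill_cong h h₂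
    exact ⟨_, ⟨_, hw, _, h₂', rfl⟩, .reset hvw hc₂⟩
  | .grab V C, e, he => by
    simp only [MCtx.fill, Option.bind_eq_some_iff, Option.some.injEq] at he ⊢
    obtain ⟨v, hv, e₂, h₂, rfl⟩ := he
    obtain ⟨w, hw, hvw⟩ := V.fill_cong h hv
    obtain ⟨f₂, h₂', hc₂⟩ := C.fill_cong h h₂
    exact ⟨_, ⟨_, hw, _, h₂', rfl⟩, .grab hvw hc₂⟩
  | .push V C, e, he => by
    simp only [MCtx.fill, Option.bind_eq_some_iff, Option.some.injEq] at he ⊢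
    obtain ⟨v, hv, e₂, h₂, rfl⟩ := he
    obtain ⟨w, hw, hvw⟩ := V.fill_cong h hv
    obtain ⟨f₂, h₂', hc₂⟩ := C.fill_cong h h₂
    exact ⟨_, ⟨_, hw, _, h₂', rfl⟩, .push hvw hc₂⟩
  | .star i C, e, he => by
    simp only [MCtx.fill, Option.bind_eq_some_iff, Option.some.injEq, Env.contAt_eq_some] at he ⊢
    obtain ⟨E, hE, e₁, h₁, rfl⟩ := he
    obtain ⟨F, hF⟩ := h.exists_cont hE
    obtain ⟨f₁, h₁', hc₁⟩ := C.fill_cong h h₁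
    exact ⟨_, ⟨_, hF, _, h₁', rfl⟩, .star ⟨i, hE, hF⟩ hc₁⟩

theorem MVal.fill_cong (h : Env.SameKinds Γ Δ) {n : ℕ} : ∀ (V : MVal n) {v : Val n},
    V.fill Γ = some v → ∃ w, V.fill Δ = some w ∧ CongVal False (Env.Paired Γ Δ) v w
  | .var x, v, hv => by
    cases hv
    exact ⟨_, rfl, .var x⟩
  | .lam C, v, hv => by
    simp only [MVal.fill, Option.bind_eq_some_iff, Option.some.injEq] at hv ⊢
    obtain ⟨e₁, h₁, rfl⟩ := hv
    obtain ⟨f₁, h₁', hc₁⟩ := C.fill_cong h h₁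
    exact ⟨_, ⟨_, h₁', rfl⟩, .lam hc₁⟩
  | .cont F, v, hv => by
    simp only [MVal.fill, Option.bind_eq_some_iff, Option.some.injEq] at hv ⊢
    obtain ⟨e₁, h₁, rfl⟩ := hv
    obtain ⟨f₁, h₁', hc₁⟩ := F.fill_cong h h₁
    exact ⟨_, ⟨_, h₁', rfl⟩, .cont hc₁⟩
  | .hole i, v, hv => by
    simp only [MVal.fill, Option.bind_eq_some_iff, Option.some.injEq] at hv ⊢
    obtain ⟨v₀, h₁, rfl⟩ := hv
    obtain ⟨w, hw, -⟩ := h.exists_getElem? h₁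
    exact ⟨_, ⟨_, hw, rfl⟩, .hole ⟨i, h₁, hw⟩⟩

theorem MECtx.fill_cong (h : Env.SameKinds Γ Δ) {n : ℕ} : ∀ (M : MECtx n) {E : ECtx n},
    M.fill Γ = some E → ∃ F, M.fill Δ = some F ∧ CongCtx False (Env.Paired Γ Δ) E F
  | .hole, E, hE => by
    cases hE
    exact ⟨_, rfl, .hole⟩
  | .appL M C, E, hE => by
    simp only [MECtx.fill, Option.bind_eq_some_iff, Option.some.injEq] at hE ⊢
    obtain ⟨e₁, h₁, e₂, h₂, rfl⟩ := hE
    obtain ⟨f₁, h₁', hc₁⟩ := M.fill_cong h h₁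
    obtain ⟨f₂, h₂', hc₂⟩ := C.fill_cong h h₂
    exact ⟨_, ⟨_, h₁', _, h₂', rfl⟩, .appL hc₁ hc₂⟩
  | .appR V M, E, hE => by
    simp only [MECtx.fill, Option.bind_eq_some_iff, Option.some.injEq] at hE ⊢
    obtain ⟨v, hv, e₂, h₂, rfl⟩ := hE
    obtain ⟨w, hw, hvw⟩ := V.fill_cong h hv
    obtain ⟨f₂, h₂', hc₂⟩ := M.fill_cong h h₂
    exact ⟨_, ⟨_, hw, _, h₂', rfl⟩, .appR hvw hc₂⟩
  | .reset i M, E, hE => by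
    simp only [MECtx.fill, Option.bind_eq_some_iff, Option.some.injEq, Env.promptAt_eq_some]
      at hE ⊢
    obtain ⟨p, hp, e₁, h₁, rfl⟩ := hE
    obtain ⟨q, hq⟩ := h.exists_prompt hp
    obtain ⟨f₁, h₁', hc₁⟩ := M.fill_cong h h₁
    exact ⟨_, ⟨_, hq, _, h₁', rfl⟩, .reset ⟨i, hp, hq⟩ hc₁⟩
  | .star i M, E, hE => by
    simp only [MECtx.fill, Option.bind_eq_some_iff, Option.some.injEq, Env.contAt_eq_some] at hE ⊢
    obtain ⟨E₀, hE₀, e₁, h₁, rfl⟩ := hE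
    obtain ⟨F₀, hF₀⟩ := h.exists_cont hE₀
    obtain ⟨f₁, h₁', hc₁⟩ := M.fill_cong h h₁
    exact ⟨_, ⟨_, hF₀, _, h₁', rfl⟩, .star ⟨i, hE₀, hF₀⟩ hc₁⟩

end

end SameKinds

/-! ### Tests on environments -/

/-- The identity, as the result of a successful test. -/
def idVal {n : ℕ} : Val n := .lam (.val (.var 0))

theorem CongVal.idVal {adm : Prop} {H : Val 0 → Val 0 → Prop} {n : ℕ} :
    CongVal adm H (idVal : Val n) idVal :=
  .lam (.val (.var 0))

/-- The test for being a continuation: capture it, discard it, and return. -/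
def contTest (v : Val 0) : Exp 0 :=
  .fresh (.reset (.var 0) (.push v.weaken (.grab (.var 0) (.val idVal))))

/-- The test that splits `⌜E⌝` at the innermost delimiter `p` into `⌜E₁⌝` and `⌜E₂⌝`, and applies
`g` to both. -/
def splitTest (E : ECtx 0) (p : Prompt) (g : Val 0) : Exp 0 :=
  .fresh (.reset (.var 0) (.push (.cont E.weaken) (.grab (.prompt p) (.grab (.var 1)
    (.app (.app (.val g.weaken) (.val (.var 0))) (.val (.var 1)))))))

theorem contTest_inst (v : Val 0) (k : Prompt) :
    (Exp.reset (.var 0) (.push v.weaken (.grab (.var 0) (.val idVal)))).inst (.prompt k) =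
      .reset (.prompt k) (.push v (.grab (.prompt k) (.val idVal))) := by
  simp only [Exp.inst, Exp.subst, Val.weaken_subst, Val.weaken_self, Val.subst, idVal]
  rfl

theorem splitTest_inst (E : ECtx 0) (p k : Prompt) (g : Val 0) :
    (Exp.reset (.var 0) (.push (.cont E.weaken) (.grab (.prompt p) (.grab (.var 1)
      (.app (.app (.val g.weaken) (.val (.var 0))) (.val (.var 1))))))).inst (.prompt k) =
      .reset (.prompt k) (.push (.cont E) (.grab (.prompt p) (.grab (.prompt k)
        (.app (.app (.val g.weaken) (.val (.var 0))) (.val (.var 1)))))) := by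
  simp only [Exp.inst, Exp.subst, Val.weaken_subst, ECtx.weaken_subst, ECtx.weaken_self, Val.subst]
  rfl

theorem splitTest_red (E : ECtx 0) (p : Prompt) (g : Val 0) : ∃ k, k ≠ p ∧ k ∉ E.prompts ∧
    RedStar (splitTest E p g) (.reset (.prompt k) (E.plug (.grab (.prompt p) (.grab (.prompt k)
        (.app (.app (.val g.weaken) (.val (.var 0))) (.val (.var 1))))))) := by
  obtain ⟨k, hk⟩ := exists_prompt_notMem ({p} ∪ E.prompts ∪ g.prompts)
  simp only [Finset.mem_union, not_or, Finset.mem_singleton] at hk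
  refine ⟨k, hk.1.1, hk.1.2, .head (.gen k _ ?_) (.single ?_)⟩
  · simp [Exp.prompts, Val.prompts, hk]
  · rw [splitTest_inst]
    exact (Contract.throw (.reset k .hole) E _).red

/-- The grab at `p` captures `E₂`, and the following grab at a new prompt, which the test has
put around `E`, captures `E₁`. -/
theorem splitTest_split (E₁ E₂ : ECtx 0) (p : Prompt) (g : Val 0) (hp : p ∉ E₂.surr) :
    RedStar (splitTest (E₁.comp (.reset p E₂)) p g)
      (.app (.app (.val g) (.val (.cont E₁))) (.val (.cont E₂))) := by
  obtain ⟨k, -, hk, hr⟩ := splitTest_red (E₁.comp (.reset p E₂)) p g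
  have h₁ := (Contract.capture (.reset k E₁) E₂ p (.grab (.prompt k)
        (.app (.app (.val g.weaken) (.val (.var 0))) (.val (.var 1)))) hp).red
  have hk' : k ∉ E₁.surr := fun h => hk (by
    rw [ECtx.comp_prompts]
    exact Finset.mem_union_left _ (E₁.surr_subset_prompts h))
  have h₂ := Red.capture k E₁ (.app (.app (.val g.weaken) (.val (.var 0)))
    (.val (Val.cont E₂).weaken)) hk'
  have e₁ : (Exp.grab (.prompt k) (.app (.app (.val g.weaken) (.val (.var 0)))
      (.val (.var 1)))).inst (.cont E₂) = .grab (.prompt k)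
        (.app (.app (.val g.weaken) (.val (.var 0))) (.val (Val.cont E₂).weaken)) := by
    simp only [Exp.inst, Exp.subst, Val.weaken_subst, Val.subst]
    rw [show (1 : Fin 2) = Fin.succ 0 from rfl, liftSub_succ, liftSub_zero]
    have : (Val.cont E₂).rename (Fin.succ (n := 0)) = (Val.cont E₂).weaken :=
      congrArg (Val.cont E₂).rename (funext fun i => i.elim0)
    rw [Fin.cases_zero, this]
  have e₂ : (Exp.app (.app (.val g.weaken) (.val (.var 0)))
      (.val (Val.cont E₂).weaken)).inst (.cont E₁) =
      .app (.app (.val g) (.val (.cont E₁))) (.val (.cont E₂)) := by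
    simp only [Exp.inst, Exp.subst, Val.weaken_subst, Val.weaken_self, Val.subst]
    rfl
  rw [e₁] at h₁
  rw [e₂] at h₂
  exact hr.trans (.head h₁ (.single h₂))


theorem not_reach_isValue_of_isStuck {e : Exp 0} (h : IsStuck e) : ¬ Reach Exp.IsValue e :=
  fun h' => h.not_isValue (h'.of_isNormal (observable_isStuck.isNormal h))

theorem reach_isValue_contTest {v : Val 0} : Reach Exp.IsValue (contTest v) ↔ ∃ E, v = .cont E := by
  obtain ⟨k, hk⟩ := exists_prompt_notMem v.prompts
  have h₁ : Red (contTest v) _ := .gen k _ (by simpa [Exp.prompts, Val.prompts, idVal] using hk)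
  rw [contTest_inst] at h₁
  rw [h₁.reach_iff observable_isValue]
  constructor
  · intro h
    by_contra hv
    have hb : IsBad (.push v (.grab (.prompt k) (.val idVal))) :=
      isBad_push fun E hE => hv ⟨E, hE⟩
    exact (hb.isError (.reset k .hole)).not_reach_isValue h
  · rintro ⟨E, rfl⟩
    have hE : k ∉ E.surr := fun h => hk (E.surr_subset_prompts h)
    exact reach_iff.2 ⟨_, .head (Contract.throw (.reset k .hole) E _).red
      (.single (.capture k E _ hE)), trivial⟩

theorem reach_isValue_reset {v : Val 0} :
    Reach Exp.IsValue (.reset v (.val idVal)) ↔ ∃ p, v = .prompt p := by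
  constructor
  · intro h
    by_contra hv
    exact ((isBad_reset fun p hp => hv ⟨p, hp⟩).isError .hole).not_reach_isValue h
  · rintro ⟨p, rfl⟩
    exact reach_iff.2 ⟨_, .single (.ret p _), trivial⟩

theorem reach_isValue_reset_grab {p q : Prompt} :
    Reach Exp.IsValue (.reset (.prompt p) (.grab (.prompt q) (.val idVal))) ↔ p = q := by
  constructor
  · intro h
    by_contra hpq
    refine not_reach_isValue_of_isStuck ⟨.reset p .hole, q, _, ?_, rfl⟩ h
    simpa [ECtx.surr] using Ne.symm hpq
  · rintro rfl
    exact reach_iff.2 ⟨_, .single (.capture p .hole _ (by simp [ECtx.surr])), trivial⟩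

theorem lastSub_zero (v : Val 0) : (lastSub v : Fin 1 → Val 0) = Fin.cases v Val.var := by
  funext i
  rw [show i = Fin.last 0 from Fin.ext (by omega), lastSub_last, Val.weaken_self]
  rfl

theorem Exp.subst_lastSub (e : Exp 1) (v : Val 0) : e.subst (lastSub v) = e.inst v := by
  rw [Exp.inst, lastSub_zero]

theorem redStar_app_app (a : Exp 2) (v w : Val 0) :
    RedStar (.app (.app (.val (.lam (.val (.lam a)))) (.val v)) (.val w))
      ((a.subst (lastSub v)).subst (lastSub w)) := by
  have h₁ := Red.beta (.val (.lam a)) v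
  have h₂ := Red.beta (a.subst (lastSub v)) w
  rw [← Exp.subst_lastSub, Exp.subst, Val.subst, liftSub_lastSub] at h₁
  rw [← Exp.subst_lastSub] at h₂
  refine .head (.compat (.appL .hole (.val w)) _ _ h₁ ?_) (.single h₂)
  have := Exp.inst_prompts_subset (.val (.lam a)) v
  rw [← Exp.subst_lastSub, Exp.subst, Val.subst, liftSub_lastSub] at this
  exact .of_subset _ this

theorem reach_isValue_splitTest {E : ECtx 0} {p : Prompt} :
    Reach Exp.IsValue (splitTest E p (.lam (.val idVal))) ↔ p ∈ E.surr := by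
  constructor
  · intro h
    by_contra hp
    obtain ⟨k, hk, -, hr⟩ := splitTest_red E p (.lam (.val idVal))
    refine not_reach_isValue_of_isStuck ⟨.reset k E, p, _, ?_, rfl⟩
      ((hr.reach_iff observable_isValue).1 h)
    simp [ECtx.surr, hp, hk.symm]
  · intro h
    obtain ⟨E₁, E₂, rfl, h₂⟩ := E.exists_split_of_mem_surr h
    exact reach_iff.2 ⟨_, (splitTest_split E₁ E₂ p _ h₂).trans (redStar_app_app _ _ _), trivial⟩

section Indist

variable {Γ Δ : Env}

theorem Indist.reach_iff (h : Indist Γ Δ) {a b : Exp 0}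
    (hc : CongExp False (Env.Paired Γ Δ) a b) : Reach Exp.IsValue a ↔ Reach Exp.IsValue b :=
  h a b hc _ (.inl rfl)

/-- Values of different kinds are distinguished by their use as a delimiter and by throwing to
them. -/
theorem Indist.kind_eq (h : Indist Γ Δ) {v w : Val 0} (hvw : Env.Paired Γ Δ v w) :
    v.kind = w.kind := by
  have h₁ := h.reach_iff (.reset (.of_rel hvw) (.val .idVal))
  have h₂ := h.reach_iff (a := contTest v) (b := contTest w)
    (.fresh (.reset (.var 0) (.push (.hole hvw) (.grab (.var 0) (.val .idVal)))))
  rw [reach_isValue_reset, reach_isValue_reset] at h₁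
  rw [reach_isValue_contTest, reach_isValue_contTest] at h₂
  cases v <;> cases w <;>
    first | rfl | exact Fin.elim0 ‹_› | (simp at h₁; done) | simp at h₂

theorem Indist.prompt_eq (h : Indist Γ Δ) {p q p' q' : Prompt}
    (hp : Env.Paired Γ Δ (.prompt p) (.prompt q))
    (hp' : Env.Paired Γ Δ (.prompt p') (.prompt q')) : p = p' ↔ q = q' := by
  have := h.reach_iff (.reset (.of_rel hp) (.grab (.prompt hp') (.val .idVal)))
  rwa [reach_isValue_reset_grab, reach_isValue_reset_grab] at this

theorem CongExp.splitTest {adm : Prop} {H : Val 0 → Val 0 → Prop} {E F : ECtx 0} {p q : Prompt}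
    {g g' : Val 0} (hE : H (.cont E) (.cont F)) (hp : H (.prompt p) (.prompt q))
    (hg : CongVal adm H g g') : CongExp adm H (splitTest E p g) (splitTest F q g') :=
  .fresh (.reset (.var 0) (.push (.cont (.of_rel hE)) (.grab (.prompt hp) (.grab (.var 1)
    (.app (.app (.val (hg.rename _)) (.val (.var 0))) (.val (.var 1)))))))

theorem Indist.mem_surr (h : Indist Γ Δ) {E F : ECtx 0} {p q : Prompt}
    (hE : Env.Paired Γ Δ (.cont E) (.cont F)) (hp : Env.Paired Γ Δ (.prompt p) (.prompt q)) :
    p ∈ E.surr ↔ q ∈ F.surr := by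
  have := h.reach_iff (.splitTest hE hp (.lam (.val .idVal)))
  rwa [reach_isValue_splitTest, reach_isValue_splitTest] at this

/-- Two values that are indistinguishable as arguments extend environments to indistinguishable
ones, since every occurrence of the last value in a filling can be abstracted. -/
theorem Indist.concat (hl : Γ.length = Δ.length) {v w : Val 0}
    (h : ∀ a b : Exp 1, CongExp False (Env.Paired Γ Δ) a b →
      SameObs (.app (.val (.lam a)) (.val v)) (.app (.val (.lam b)) (.val w))) :
    Indist (Γ ++ [v]) (Δ ++ [w]) := by
  intro a b hc
  obtain ⟨a', b', hc', ha, hb⟩ := hc.abs hl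
  rw [Exp.subst_lastSub] at ha hb
  exact ((ha.sameObs.symm.trans (Red.beta a' v).sameObs.symm).trans (h a' b' hc')).trans
    ((Red.beta b' w).sameObs.trans hb.sameObs)

/-- Indistinguishable continuations that are split at related prompts have indistinguishable
parts: these are passed to an arbitrary function by `splitTest`. -/
theorem Indist.split (h : Indist Γ Δ) (hl : Γ.length = Δ.length) {E₁ E₂ F₁ F₂ : ECtx 0}
    {p q : Prompt}
    (hE : Env.Paired Γ Δ (.cont (E₁.comp (.reset p E₂))) (.cont (F₁.comp (.reset q F₂))))
    (hp : Env.Paired Γ Δ (.prompt p) (.prompt q)) (h₁ : p ∉ E₂.surr) (h₂ : q ∉ F₂.surr) :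
    Indist (Γ ++ [.cont E₁] ++ [.cont E₂]) (Δ ++ [.cont F₁] ++ [.cont F₂]) := by
  intro a b hc
  obtain ⟨a₁, b₁, hc₁, ha₁, hb₁⟩ := hc.abs (by simpa using hl)
  obtain ⟨a₂, b₂, hc₂, ha₂, hb₂⟩ := hc₁.abs hl
  have ha : AdmEq _ a := (AdmEq.subst (lastSub (.cont E₂)) ha₂).trans _ _ _ ha₁
  have hb : AdmEq _ b := (AdmEq.subst (lastSub (.cont F₂)) hb₂).trans _ _ _ hb₁
  have hs := h _ _ (.splitTest hE hp (.lam (.val (.lam hc₂))))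
  have hta : RedStar _ _ := (splitTest_split E₁ E₂ p _ h₁).trans
    (redStar_app_app a₂ (.cont E₁) (.cont E₂))
  have htb : RedStar _ _ := (splitTest_split F₁ F₂ q _ h₂).trans
    (redStar_app_app b₂ (.cont F₁) (.cont F₂))
  exact ((ha.sameObs.symm.trans hta.sameObs.symm).trans hs).trans (htb.sameObs.trans hb.sameObs)

end Indist

/-! ### Indistinguishability is a star-bisimulation -/

theorem redFresh_beta (S : Finset Prompt) (e : Exp 1) (v : Val 0) :
    RedFresh S (.app (.val (.lam e)) (.val v)) (e.inst v) :=
  ⟨.beta e v, .of_subset _ (e.inst_prompts_subset v)⟩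

/-- A control-stuck expression can only be captured, which generates no prompt. -/
theorem IsStuck.redFresh {e e' : Exp 0} {E : ECtx 0} (h : IsStuck e) (hr : Red (E.plug e) e')
    (S : Finset Prompt) : RedFresh S (E.plug e) e' := by
  refine ⟨hr, .of_subset _ ?_⟩
  obtain ⟨E', p, b, -, rfl⟩ := h
  rw [← ECtx.comp_plug] at hr ⊢
  generalize E.comp E' = E₀ at hr ⊢
  cases hr.contract (.grab _ _) with
  | capture E₁ E₂ =>
    have := capture_prompts_subset E₂ p b
    simp only [ECtx.plug_prompts, ECtx.comp_prompts, ECtx.prompts, Exp.prompts, Val.prompts] at *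
    grind

section IndistExp

variable {Γ Δ : Env} {e f e' f' : Exp 0}

theorem IndistExp.symm (h : IndistExp Γ e Δ f) : IndistExp Δ f Γ e :=
  ⟨h.1.symm, fun _ _ hE => (h.2 _ _ (hE.symm fun _ _ => Env.Paired.symm)).symm⟩

theorem Indist.exp (h : Indist Γ Δ) (hk : Env.SameKinds Γ Δ)
    (hc : CongExp False (Env.Paired Γ Δ) e f) : IndistExp Γ e Δ f :=
  ⟨hk, fun _ _ hE => h _ _ (hE.plug hc)⟩

theorem IndistExp.plug (h : IndistExp Γ e Δ f) {E F : ECtx 0}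
    (hE : CongCtx False (Env.Paired Γ Δ) E F) : IndistExp Γ (E.plug e) Δ (F.plug f) :=
  ⟨h.1, fun E' F' hE' => by
    rw [← ECtx.comp_plug, ← ECtx.comp_plug]
    exact h.2 _ _ (hE'.comp hE)⟩

theorem IndistExp.red_left (h : IndistExp Γ e Δ f) (hr : RedsFresh Γ.prompts e e') :
    IndistExp Γ e' Δ f :=
  ⟨h.1, fun _ _ hE => (hr.plug (hE.left_prompts id)).redStar.sameObs.symm.trans (h.2 _ _ hE)⟩

theorem IndistExp.red_right (h : IndistExp Γ e Δ f) (hr : RedsFresh Δ.prompts f f') :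
    IndistExp Γ e Δ f' :=
  (h.symm.red_left hr).symm

theorem IndistExp.exists_reds (h : IndistExp Γ e Δ f) {P : Exp 0 → Prop}
    (hP : P = Exp.IsValue ∨ P = IsStuck) (he : P e) : ∃ f', RedsFresh Δ.prompts f f' ∧ P f' :=
  (((h.2 _ _ .hole) P hP).1 ⟨0, he⟩).exists_redsFresh (observable_of_eq hP) _

/-- Indistinguishable values extend indistinguishable environments. -/
theorem IndistExp.indist {v w : Val 0} (h : IndistExp Γ (.val v) Δ (.val w)) :
    Indist (Γ ++ [v]) (Δ ++ [w]) :=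
  .concat h.1.length_eq fun _ _ hc => h.2 _ _ (.appR (.lam hc) .hole)

theorem IndistExp.sameKinds {v w : Val 0} (h : IndistExp Γ (.val v) Δ (.val w)) :
    Env.SameKinds (Γ ++ [v]) (Δ ++ [w]) :=
  h.1.concat (h.indist.kind_eq (Env.paired_concat h.1.length_eq v w))

theorem Indist.val {v w : Val 0} (h : Indist (Γ ++ [v]) (Δ ++ [w])) (hk : Env.SameKinds Γ Δ) :
    IndistExp Γ (.val v) Δ (.val w) :=
  ⟨hk, fun _ _ hE => h _ _ ((hE.mono fun _ _ h => h.append _ _).plug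
    (.val (.of_rel (Env.paired_concat hk.length_eq v w))))⟩

/-- New prompts are indistinguishable. -/
theorem Indist.newPrompt (h : Indist Γ Δ) (hk : Env.SameKinds Γ Δ) {p q : Prompt}
    (hp : p ∉ Γ.prompts) (hq : q ∉ Δ.prompts) :
    IndistExp Γ (.val (.prompt p)) Δ (.val (.prompt q)) := by
  have hr : ∀ {p : Prompt} {Γ : Env}, p ∉ Γ.prompts →
      RedsFresh Γ.prompts (.fresh (.val (.var 0))) (.val (.prompt p)) := fun {p _} hp =>
    .single ⟨.gen p (.val (.var 0)) (by simp [Exp.prompts, Val.prompts]), freshFor_inst _ hp⟩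
  exact ((h.exp hk (.fresh (.val (.var 0)))).red_left (hr hp)).red_right (hr hq)

end IndistExp

/-- The states made of indistinguishable expressions. -/
def IndistState (s t : State) : Prop :=
  ∃ Γ e Δ f, s = .of Γ e ∧ t = .of Δ f ∧ IndistExp Γ e Δ f

theorem IndistState.symm {s t : State} (h : IndistState s t) : IndistState t s := by
  obtain ⟨Γ, e, Δ, f, rfl, rfl, h⟩ := h
  exact ⟨Δ, f, Γ, e, rfl, rfl, h.symm⟩

theorem IndistExp.state {Γ Δ : Env} {e f : Exp 0} (h : IndistExp Γ e Δ f) :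
    IndistState (.of Γ e) (.of Δ f) :=
  ⟨Γ, e, Δ, f, rfl, rfl, h⟩

theorem Indist.lts {Γ Δ : Env} (h : Indist Γ Δ) (hk : Env.SameKinds Γ Δ)
    (hst : IndistState (.env Γ) (.env Δ)) {a : Label} {s : State} (hs : Lts (.env Γ) a s) :
    ∃ t, Lts (.env Δ) a t ∧ IndistState s t := by
  cases hs with
  | lam _ i V e v hi hV =>
    obtain ⟨f, hf⟩ := hk.exists_lam hi
    obtain ⟨w, hw, hvw⟩ := V.fill_cong hk hV
    have := (h.exp hk (.app (.val (.of_rel ⟨i, hi, hf⟩)) (.val hvw))).red_left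
      (.single (redFresh_beta _ e v))
    exact ⟨_, .lam Δ i V f w hf hw, (this.red_right (.single (redFresh_beta _ f w))).state⟩
  | val => exact ⟨_, .val Δ, hst⟩
  | ctx _ i V E v hi hV =>
    obtain ⟨F, hF⟩ := hk.exists_cont hi
    obtain ⟨w, hw, hvw⟩ := V.fill_cong hk hV
    have := h.exp hk (.star ⟨i, hi, hF⟩ (.val hvw))
    rw [ECtx.weaken_self, ECtx.weaken_self] at this
    exact ⟨_, .ctx Δ i V F w hF hw, this.state⟩
  | eqPrompt _ i j p hi hj =>
    obtain ⟨q, hq⟩ := hk.exists_prompt hi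
    obtain ⟨q', hq'⟩ := hk.exists_prompt hj
    obtain rfl := (h.prompt_eq ⟨i, hi, hq⟩ ⟨j, hj, hq'⟩).1 rfl
    exact ⟨_, .eqPrompt Δ i j q hq hq', hst⟩
  | newPrompt _ p hp =>
    obtain ⟨q, hq⟩ := exists_prompt_notMem Δ.prompts
    exact ⟨_, .newPrompt Δ q hq, (h.newPrompt hk hp hq).state⟩
  | decomp _ i j E₁ E₂ p hi hj hp =>
    obtain ⟨F, hF⟩ := hk.exists_cont hi
    obtain ⟨q, hq⟩ := hk.exists_prompt hj
    have hsurr := (h.mem_surr ⟨i, hi, hF⟩ ⟨j, hj, hq⟩).1 (by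
      rw [ECtx.comp_surr]
      exact Finset.mem_union_right _ (Finset.mem_union_left _ (Finset.mem_singleton_self p)))
    obtain ⟨F₁, F₂, rfl, hq₂⟩ := F.exists_split_of_mem_surr hsurr
    have h' := (h.split hk.length_eq ⟨i, hi, hF⟩ ⟨j, hj, hq⟩ hp hq₂).val (hk.concat rfl)
    have : IndistState (.env (Γ ++ [.cont E₁] ++ [.cont E₂]))
        (.env (Δ ++ [.cont F₁] ++ [.cont F₂])) := h'.state
    rw [List.append_assoc, List.append_assoc] at this
    exact ⟨_, .decomp Δ i j F₁ F₂ q hF hq hq₂, this⟩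

theorem IndistState.lts {s t s' : State} (h : IndistState s t) {a : Label} (hs : Lts s a s') :
    ∃ t', WeakLts t a t' ∧ IndistState s' t' := by
  obtain ⟨Γ, e, Δ, f, rfl, rfl, h⟩ := h
  generalize hse : State.of Γ e = s at hs
  have env : ∀ {Γ'}, s = .env Γ' → ∃ t', WeakLts (.of Δ f) a t' ∧ IndistState s' t' := by
    rintro Γ' rfl
    obtain ⟨v, rfl, rfl⟩ := State.env_eq_of hse.symm
    -- the right-hand expression need not be a value yet: the transition is preceded by its
    -- evaluation
    obtain ⟨f', hr, hf⟩ := h.exists_reds (.inl rfl) trivial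
    obtain ⟨w, rfl⟩ := hf.exists_eq
    have h' := h.red_right hr
    obtain ⟨t', ht, hst⟩ := h'.indist.lts h'.sameKinds h'.state hs
    exact ⟨t', .inr ⟨(by rintro rfl; cases hs), _, _, hr.tauStar, ht, .refl⟩, hst⟩
  cases hs with
  | tau Γ' e₁ e₂ _ hr hf =>
    obtain ⟨rfl, rfl⟩ := State.run_eq_of hse.symm
    -- indistinguishability is invariant under reduction, so that the answer is to stay
    exact ⟨_, .inl ⟨rfl, .refl⟩, (h.red_left (.single ⟨hr, hf⟩)).state⟩
  | stuck Γ' e₁ he M E e₂ hst hM hr =>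
    obtain ⟨rfl, rfl⟩ := State.run_eq_of hse.symm
    obtain ⟨F, hF, hE⟩ := M.fill_cong h.1 hM
    obtain ⟨f₁, hf₁, hst'⟩ := h.exists_reds (.inr rfl) hst
    have hplug := (h.red_right hf₁).plug hE
    have hl : IndistExp Γ' e₂ Δ (F.plug f₁) := by
      rcases hr with hr | ⟨-, rfl⟩
      · exact hplug.red_left (.single (hst.redFresh hr _))
      · exact hplug
    have hstep : ∃ f₂, RedBis (F.plug f₁) f₂ ∧ RedsFresh Δ.prompts (F.plug f₁) f₂ := by
      rcases hst'.plug F with ⟨f₂, hr'⟩ | hn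
      · exact ⟨f₂, .inl hr', .single (hst'.redFresh hr' _)⟩
      · exact ⟨_, .inr ⟨observable_isStuck.isNormal hn, rfl⟩, .refl⟩
    obtain ⟨f₂, hb, hr'⟩ := hstep
    have ht := Lts.stuck Δ f₁ hst'.not_isValue M F f₂ hst' hF hb
    rw [← State.of_eq_run Δ hst'.not_isValue] at ht
    exact ⟨_, .inr ⟨nofun, _, _, hf₁.tauStar, ht, .refl⟩, (hl.red_right hr').state⟩
  | _ => exact env rfl

theorem isStarBisimulation_indistState : IsStarBisimulation IndistState := by
  refine ⟨fun _ _ h => h, fun _ _ h => h, fun s t h => ⟨fun a s' hs _ => h.lts hs,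
    fun a s' hs _ => h.lts hs, fun a t' ht _ => ?_, fun a t' ht _ => ?_⟩⟩ <;>
  · obtain ⟨s', h₁, h₂⟩ := h.symm.lts ht
    exact ⟨s', h₁, h₂.symm⟩

/-- Star-bisimilarity is complete for contextual equivalence. -/
theorem CtxEq.starBisimilar {e₁ e₂ : Exp 0} (h : CtxEq e₁ e₂) :
    StarBisimilar (.of [] e₁) (.of [] e₂) := by
  refine ⟨IndistState, isStarBisimulation_indistState, IndistExp.state ⟨rfl, fun E F hE => ?_⟩⟩
  -- over empty environments, related evaluation contexts are equal and promptless
  obtain ⟨M, hM₁, hM₂⟩ := hE.exists_fill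
  obtain rfl : E = F := Option.some.inj (hM₁.symm.trans hM₂)
  exact obsEq_iff.1 (h E (Finset.subset_empty.1 (hE.left_prompts id)))

end MultiPrompt

theorem mainTheorem2 (e₁ e₂ : MultiPrompt.Exp 0) :
    MultiPrompt.CtxEq e₁ e₂ ↔
      MultiPrompt.StarBisimilar (MultiPrompt.State.of [] e₁) (MultiPrompt.State.of [] e₂) :=
  ⟨MultiPrompt.CtxEq.starBisimilar, MultiPrompt.StarBisimilar.ctxEq⟩
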